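/- Let $n\ge 1$ and let $q\in\mathbb C$ be nonzero and not a root of unity. Let $e_{ij}\in\operatorname{End}\mathbb C^n$ be the matrix units. **The algebra.** Let $$\overline R(x)=\sum_i e_{ii}\otimes e_{ii}+\frac{1-x}{q-q^{-1}x}\sum_{i\ne j}e_{ii}\otimes e_{jj}+\frac{(q-q^{-1})x}{q-q^{-1}x}\sum_{i>j}e_{ij}\otimes e_{ji}+\frac{q-q^{-1}}{q-q^{-1}x}\sum_{i<j}e_{ij}\otimes e_{ji}$$ and $R(x)=f(x)\overline R(x)$, expanded as a formal power series in $x$, where $f(x)=1+\sum_{k\ge1}f_kx^k$ is the unique power series with $f(xq^{2n})=f(x)\,\frac{(1-xq^2)(1-xq^{2n-2})}{(1-x)(1-xq^{2n})}$. The quantum affine algebra $\mathrm U_q(\widehat{\mathfrak{gl}}_n)$ is the associative $\mathbb C$-algebra generated by $l^+_{ij}[-r]$, $l^-_{ij}[r]$ ($1\le i,j\le n$, $r\ge 0$) and an invertible central element $q^c$, with defining relations $l^+_{ji}[0]=l^-_{ij}[0]=0$ for $i<j$, $l^+_{ii}[0]l^-_{ii}[0]=l^-_{ii}[0]l^+_{ii}[0]=1$,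 and $$R(u/v)L^\pm_1(u)L^\pm_2(v)=L^\pm_2(v)L^\pm_1(u)R(u/v),\qquad R(uq^{-c}/v)L^+_1(u)L^-_2(v)=L^-_2(v)L^+_1(u)R(uq^{c}/v),$$ where $L^\pm(u)=[l^\pm_{ij}(u)]$, $l^+_{ij}(u)=\sum_{r\ge0}l^+_{ij}[-r]u^r$, $l^-_{ij}(u)=\sum_{r\ge0}l^-_{ij}[r]u^{-r}$, and a subscript $a$ indicates the copy of $\operatorname{End}\mathbb C^n$ in a tensor power. Let $\mathrm U_q(\widehat{\mathfrak{gl}}_n)_{\rm cri}$ be its quotient by the relation $q^c=q^{-n}$. **The vacuum module.** Let $V_q(\mathfrak{gl}_n)$ be the quotient of $\mathrm U_q(\widehat{\mathfrak{gl}}_n)_{\rm cri}$ by the left ideal generated by all $l^-_{ij}[r]$ with $r>0$ and all $l^-_{ij}[0]-\delta_{ij}$ with $i\ge j$, let $\mathbf 1$ be the image of $1$, and let $$\mathfrak z_q(\widehat{\mathfrak{gl}}_n)=\{v\in V_q(\mathfrak{gl}_n)\mid L^-(u)v=Iv\},$$ i.e. $l^-_{ij}[r]v=\delta_{ij}\delta_{r0}v$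 for all $i,j,r$. This is an algebra with unit $\mathbf 1$ under the multiplication induced from the quantum affine algebra, $(x\mathbf 1)(y\mathbf 1)=xy\mathbf 1$. **The idempotents.** Let $\lambda$ be a Young diagram with $m$ boxes and at most $n$ rows, and let $\Lambda$ be a standard $\lambda$-tableau. Let $c_k(\Lambda)=j-i$ be the content of the box $(i,j)$ occupied by $k$, let $d_k(\Lambda)=c_{k+1}(\Lambda)-c_k(\Lambda)$, and $[a]_q=(q^a-q^{-a})/(q-q^{-1})$. Let $V_\lambda$ be the representation of the Hecke algebra $\mathcal H_m$ (generators $T_1,\dots,T_{m-1}$, the braid relations and $(T_k-q)(T_k+q^{-1})=0$) with orthonormal basis $\{v_\Lambda\}$ (with respect to a symmetric bilinear form $\langle\,,\rangle$) indexed by the standard $\lambda$-tableaux and $$T_kv_\Lambda=\frac{q^{d_k(\Lambda)}}{[d_k(\Lambda)]_q}v_\Lambda+\sqrt{1-\frac1{[d_k(\Lambda)]_q^2}}\;v_{\sigma_k\Lambda},$$ where $\sigma_k\Lambda$ is obtained by swapping $k$ and $k+1$, $v_{\sigma_k\Lambda}=0$ if $\sigma_k\Lambda$ is not standard, and the square root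 is the principal one. Let $T_\sigma=T_{i_1}\cdots T_{i_l}$ for a reduced decomposition $\sigma=\sigma_{i_1}\cdots\sigma_{i_l}$ into the adjacent transpositions $\sigma_k=(k,k+1)$, let $c_\lambda=\prod_{\alpha\in\lambda}q^{c(\alpha)}[h(\alpha)]_q$ with $c(\alpha)$, $h(\alpha)$ the content and the hook length of the box $\alpha$, and $$e_\Lambda=\frac1{c_\lambda}\sum_{\sigma\in\mathfrak S_m}\langle T_{\sigma^{-1}}v_\Lambda,v_\Lambda\rangle\,T_\sigma\in\mathcal H_m .$$ Let $\mathcal E_\Lambda$ be the image of $e_\Lambda$ in $(\operatorname{End}\mathbb C^n)^{\otimes m}$ under $T_k\mapsto P_{k,k+1}R_{k,k+1}$, where $P=\sum_{i,j} e_{ij}\otimes e_{ji}$ and $R=q\sum_ie_{ii}\otimes e_{ii}+\sum_{i\ne j}e_{ii}\otimes e_{jj}+(q-q^{-1})\sum_{i<j}e_{ij}\otimes e_{ji}$. **The series.** With $D=\operatorname{diag}[q^{n-1},q^{n-3},\dots,q^{-n+1}]$ set $$\overline S_\Lambda(z)=\operatorname{tr}_{1,\dots,m}L^+_1(zq^{-2c_1(\Lambda)})\cdots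 L^+_m(zq^{-2c_m(\Lambda)})\,D_1\cdots D_m\,\mathcal E_\Lambda,$$ a power series in $z$ with coefficients in $\mathrm U_q(\widehat{\mathfrak{gl}}_n)_{\rm cri}$. **Corollary 3.4.** 1. The series $\overline S_\Lambda(z)\mathbf 1$ does not depend on the standard $\lambda$-tableau $\Lambda$, but only on $\lambda$. 2. All coefficients of $\overline S_\Lambda(z)\mathbf 1$ belong to the algebra of invariants $\mathfrak z_q(\widehat{\mathfrak{gl}}_n)$. 3. The coefficients of all series $\overline S_\Lambda(z)$, for all standard tableaux $\Lambda$ of all shapes with at most $n$ rows, pairwise commute in $\mathrm U_q(\widehat{\mathfrak{gl}}_n)_{\rm cri}$; likewise, the coefficients of all series $\overline S_\Lambda(z)\mathbf 1$ pairwise commute in the algebra $\mathfrak z_q(\widehat{\mathfrak{gl}}_n)$. -/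

import Mathlib

open scoped Kronecker PowerSeries

noncomputable section

namespace QSugawara

/-! ### Reduced words in the symmetric group -/

/-- The adjacent transposition `σ_k = (k, k+1)` of the symmetric group `S_m`. -/
def adjSwap {m : ℕ} (k : Fin (m - 1)) : Equiv.Perm (Fin m) :=
  Equiv.swap ⟨k.1, by have := k.2; omega⟩ ⟨k.1 + 1, by have := k.2; omega⟩

theorem exists_word : ∀ {m : ℕ} (σ : Equiv.Perm (Fin m)),
    ∃ w : List (Fin (m - 1)), (w.map adjSwap).prod = σ
  | 0, σ => ⟨[], Subsingleton.elim _ _⟩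
  | m + 1, σ => by
    have h : σ ∈ Submonoid.closure
        (Set.range fun i : Fin m => Equiv.swap i.castSucc i.succ) := by
      rw [Equiv.Perm.mclosure_swap_castSucc_succ]; trivial
    induction h using Submonoid.closure_induction with
    | mem x hx => obtain ⟨i, rfl⟩ := hx; exact ⟨[i], by simp [adjSwap]; rfl⟩
    | one => exact ⟨[], rfl⟩
    | mul x y _ _ hx hy =>
      obtain ⟨u, hu⟩ := hx
      obtain ⟨v, hv⟩ := hy
      exact ⟨u ++ v, by simp [hu, hv]⟩

/-- `w` is a reduced decomposition `σ = σ_{i_1} … σ_{i_l}`: a decomposition of minimal length. -/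
def IsReducedWord {m : ℕ} (w : List (Fin (m - 1))) (σ : Equiv.Perm (Fin m)) : Prop :=
  (w.map adjSwap).prod = σ ∧
    ∀ w' : List (Fin (m - 1)), (w'.map adjSwap).prod = σ → w.length ≤ w'.length

theorem exists_reducedWord {m : ℕ} (σ : Equiv.Perm (Fin m)) :
    ∃ w : List (Fin (m - 1)), IsReducedWord w σ := by
  classical
  have h : ∃ l, ∃ w : List (Fin (m - 1)), (w.map adjSwap).prod = σ ∧ w.length = l :=
    let ⟨w, hw⟩ := exists_word σ; ⟨_, w, hw, rfl⟩
  obtain ⟨w, hw, hl⟩ := Nat.find_spec h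
  exact ⟨w, hw, fun w' hw' => hl ▸ Nat.find_min' h ⟨w', hw', rfl⟩⟩

/-- A chosen reduced decomposition. -/
def reducedWord {m : ℕ} (σ : Equiv.Perm (Fin m)) : List (Fin (m - 1)) :=
  (exists_reducedWord σ).choose

/-- The value `t_{i_1} … t_{i_l}` of the Hecke algebra element `T_σ = T_{i_1} … T_{i_l}` under
`T_k ↦ t_k`. When the `t_k` satisfy the braid relations, as in all uses below, it does not depend
on the chosen reduced decomposition of `σ`. -/
def heckeT {m : ℕ} {A : Type*} [Monoid A] (t : Fin (m - 1) → A) (σ : Equiv.Perm (Fin m)) : A :=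
  ((reducedWord σ).map t).prod

/-! ### Standard tableaux, Young's orthonormal form and the idempotents -/

/-- A standard `μ`-tableau, given by the bijection sending an entry to the box it occupies; the
entries are `0, …, m - 1` (instead of `1, …, m`) with `m = |μ|`. They increase along the rows
and down the columns. -/
structure StdTableau (μ : YoungDiagram) where
  /-- the box `(row, column)` occupied by an entry -/
  box : Fin μ.card ≃ μ.cells
  row_lt : ∀ k l, (box k).1.1 = (box l).1.1 → (box k).1.2 < (box l).1.2 → k < l
  col_lt : ∀ k l, (box k).1.2 = (box l).1.2 → (box k).1.1 < (box l).1.1 → k < l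

theorem StdTableau.box_injective {μ : YoungDiagram} :
    Function.Injective (StdTableau.box : StdTableau μ → _) := by
  rintro ⟨_, _, _⟩ ⟨_, _, _⟩ h
  simpa using h

instance (μ : YoungDiagram) : DecidableEq (StdTableau μ) := Classical.decEq _

instance (μ : YoungDiagram) : Fintype (StdTableau μ) :=
  Fintype.ofInjective _ StdTableau.box_injective

/-- The content `j - i` of the box `(i, j)` occupied by `k`. -/
def StdTableau.content {μ : YoungDiagram} (Λ : StdTableau μ) (k : Fin μ.card) : ℤ :=
  ((Λ.box k).1.2 : ℤ) - ((Λ.box k).1.1 : ℤ)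

/-- `d_k(Λ) = c_{k+1}(Λ) - c_k(Λ)`. -/
def StdTableau.d {μ : YoungDiagram} (Λ : StdTableau μ) (k : Fin (μ.card - 1)) : ℤ :=
  Λ.content ⟨k.1 + 1, by have := k.2; omega⟩ - Λ.content ⟨k.1, by have := k.2; omega⟩

/-- The `q`-number `[a]_q = (q^a - q^{-a}) / (q - q^{-1})`. -/
def qNum (q : ℂ) (a : ℤ) : ℂ := (q ^ a - q ^ (-a)) / (q - q⁻¹)

/-- The matrix of `T_k` in the orthonormal Young basis `v_Λ` of `V_μ` (column `Λ` is `T_k v_Λ`):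
`T_k v_Λ = q^d / [d]_q v_Λ + √(1 - 1/[d]_q²) v_{σ_k Λ}` with `d = d_k(Λ)`, where `σ_k Λ` is
obtained by swapping the entries `k` and `k + 1` and the second term is absent if `σ_k Λ` is not
standard. The square root is the principal one. -/
def youngMatrix (q : ℂ) (μ : YoungDiagram) (k : Fin (μ.card - 1)) :
    Matrix (StdTableau μ) (StdTableau μ) ℂ :=
  Matrix.of fun Γ Λ =>
    if Γ = Λ then q ^ Λ.d k / qNum q (Λ.d k)
    else if Γ.box = (adjSwap k).trans Λ.box then
      (1 - 1 / qNum q (Λ.d k) ^ 2) ^ (1 / 2 : ℂ)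
    else 0

/-- The hook length of a box; rows and columns are numbered from `0`. -/
def hookLength (μ : YoungDiagram) (α : ℕ × ℕ) : ℤ :=
  (μ.rowLen α.1 : ℤ) + (μ.colLen α.2 : ℤ) - (α.1 : ℤ) - (α.2 : ℤ) - 1

/-- The Schur element `c_μ = ∏_α q^{c(α)} [h(α)]_q`. -/
def schurElement (q : ℂ) (μ : YoungDiagram) : ℂ :=
  ∏ α ∈ μ.cells, q ^ ((α.2 : ℤ) - (α.1 : ℤ)) * qNum q (hookLength μ α)

/-- The value, under `T_k ↦ t_k`, of the primitive idempotent (diagonal matrix unit) of the Hecke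
algebra `e_Λ = (1 / c_μ) ∑_σ ⟨T_{σ⁻¹} v_Λ, v_Λ⟩ T_σ`. -/
def idempotent (q : ℂ) {μ : YoungDiagram} (Λ : StdTableau μ) {A : Type*} [Ring A] [Algebra ℂ A]
    (t : Fin (μ.card - 1) → A) : A :=
  (schurElement q μ)⁻¹ •
    ∑ σ : Equiv.Perm (Fin μ.card), heckeT (youngMatrix q μ) σ⁻¹ Λ Λ • heckeT t σ

/-! ### Operators on tensor powers

`(End ℂⁿ)^{⊗ m} ⊗ A` is identified with the algebra of matrices over `A` whose rows and columns
are indexed by `m`-tuples of elements of `{0, …, n - 1}`. -/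

/-- `C_a`: the matrix `C` in the `a`-th tensor factor, the identity in the other factors. -/
def at1 {m n : ℕ} {A : Type*} [Zero A] (a : Fin m) (C : Matrix (Fin n) (Fin n) A) :
    Matrix (Fin m → Fin n) (Fin m → Fin n) A :=
  Matrix.of fun I J => if ∀ b, b ≠ a → I b = J b then C (I a) (J a) else 0

/-- `C_{ab}`: the element `C` of `End ℂⁿ ⊗ End ℂⁿ` in the tensor factors `a` and `b`. -/
def at2 {m n : ℕ} {A : Type*} [Zero A] (a b : Fin m)
    (C : Matrix (Fin n × Fin n) (Fin n × Fin n) A) :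
    Matrix (Fin m → Fin n) (Fin m → Fin n) A :=
  Matrix.of fun I J =>
    if ∀ c, c ≠ a → c ≠ b → I c = J c then C (I a, I b) (J a, J b) else 0

/-- `P = ∑ e_ij ⊗ e_ji`. -/
def flipP (n : ℕ) : Matrix (Fin n × Fin n) (Fin n × Fin n) ℂ :=
  ∑ p : Fin n × Fin n, Matrix.single p.1 p.2 1 ⊗ₖ Matrix.single p.2 p.1 1

/-- `R = q ∑ e_ii ⊗ e_ii + ∑_{i ≠ j} e_ii ⊗ e_jj + (q - q⁻¹) ∑_{i < j} e_ij ⊗ e_ji`. -/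
def Rfin (n : ℕ) (q : ℂ) : Matrix (Fin n × Fin n) (Fin n × Fin n) ℂ :=
  q • ∑ i : Fin n, Matrix.single i i 1 ⊗ₖ Matrix.single i i 1
    + ∑ p : Fin n × Fin n with p.1 ≠ p.2, Matrix.single p.1 p.1 1 ⊗ₖ Matrix.single p.2 p.2 1
    + (q - q⁻¹) •
      ∑ p : Fin n × Fin n with p.1 < p.2, Matrix.single p.1 p.2 1 ⊗ₖ Matrix.single p.2 p.1 1

/-- `Ř_k = P_{k,k+1} R_{k,k+1}`, the image of `T_k` acting on `(ℂⁿ)^{⊗ m}`. -/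
def Rcheck (n : ℕ) (q : ℂ) {m : ℕ} (k : Fin (m - 1)) :
    Matrix (Fin m → Fin n) (Fin m → Fin n) ℂ :=
  at2 ⟨k.1, by have := k.2; omega⟩ ⟨k.1 + 1, by have := k.2; omega⟩ (flipP n * Rfin n q)

/-- `ℰ_Λ`, the image of the idempotent `e_Λ` on `(ℂⁿ)^{⊗ m}`. -/
def idempotentOp (n : ℕ) (q : ℂ) {μ : YoungDiagram} (Λ : StdTableau μ) :
    Matrix (Fin μ.card → Fin n) (Fin μ.card → Fin n) ℂ :=
  idempotent q Λ (Rcheck n q)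

/-! ### The `R`-matrix as a formal power series -/

/-- `(1 - x q²)(1 - x q^{2n-2}) / ((1 - x)(1 - x q^{2n}))` as a power series in `x`. -/
def gSeries (n : ℕ) (q : ℂ) : ℂ⟦X⟧ :=
  (1 - PowerSeries.C (q ^ 2) * PowerSeries.X) *
    (1 - PowerSeries.C (q ^ (2 * (n : ℤ) - 2)) * PowerSeries.X) *
    ((1 - PowerSeries.X) * (1 - PowerSeries.C (q ^ (2 * n)) * PowerSeries.X))⁻¹

/-- The coefficients `f_k` of the normalizing series `f(x)`, computed from its functional
equation. -/
def fCoeff (n : ℕ) (q : ℂ) : ℕ → ℂ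
  | 0 => 1
  | k + 1 => (∑ j : Fin (k + 1), fCoeff n q j.1 * PowerSeries.coeff (k + 1 - j.1) (gSeries n q)) /
      (q ^ (2 * n * (k + 1)) - 1)
decreasing_by exact j.2

/-- The normalizing series `f(x) = 1 + ∑ f_k x^k`. -/
def fSeries (n : ℕ) (q : ℂ) : ℂ⟦X⟧ := PowerSeries.mk (fCoeff n q)

theorem constantCoeff_gSeries (n : ℕ) (q : ℂ) : PowerSeries.coeff 0 (gSeries n q) = 1 := by
  simp [gSeries]

/-- The functional equation `f(x q^{2n}) = f(x) g(x)` which determines `f`. -/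
theorem fSeries_functional {n : ℕ} (hn : 1 ≤ n) {q : ℂ} (hq : ∀ k : ℕ, 0 < k → q ^ k ≠ 1) :
    PowerSeries.rescale (q ^ (2 * n)) (fSeries n q) = fSeries n q * gSeries n q := by
  ext k
  rw [PowerSeries.coeff_rescale, PowerSeries.coeff_mul,
    Finset.Nat.sum_antidiagonal_eq_sum_range_succ
      (fun i j => PowerSeries.coeff i (fSeries n q) * PowerSeries.coeff j (gSeries n q)),
    Finset.sum_range_succ, Nat.sub_self, constantCoeff_gSeries]
  simp only [fSeries, PowerSeries.coeff_mk, mul_one]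
  cases k with
  | zero => simp [fCoeff]
  | succ k =>
    have h : q ^ (2 * n * (k + 1)) - 1 ≠ 0 := sub_ne_zero.2 (hq _ (by positivity))
    have h2 : fCoeff n q (k + 1) * (q ^ (2 * n * (k + 1)) - 1) =
        ∑ j ∈ Finset.range (k + 1),
          fCoeff n q j * PowerSeries.coeff (k + 1 - j) (gSeries n q) := by
      rw [fCoeff, div_mul_cancel₀ _ h, Finset.sum_range]
    rw [← h2, ← pow_mul]
    ring

/-- The `R`-matrix `R̄(x)`, with entries expanded in non-negative powers of `x`. -/
def Rbar (n : ℕ) (q : ℂ) : Matrix (Fin n × Fin n) (Fin n × Fin n) ℂ⟦X⟧ :=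
  -- `den = q - q⁻¹ x`
  let den : ℂ⟦X⟧ := PowerSeries.C q - PowerSeries.C q⁻¹ * PowerSeries.X
  ∑ i : Fin n, Matrix.single i i 1 ⊗ₖ Matrix.single i i 1
    + ((1 - PowerSeries.X) * den⁻¹) •
      ∑ p : Fin n × Fin n with p.1 ≠ p.2, Matrix.single p.1 p.1 1 ⊗ₖ Matrix.single p.2 p.2 1
    + (PowerSeries.C (q - q⁻¹) * PowerSeries.X * den⁻¹) •
      ∑ p : Fin n × Fin n with p.1 > p.2, Matrix.single p.1 p.2 1 ⊗ₖ Matrix.single p.2 p.1 1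
    + (PowerSeries.C (q - q⁻¹) * den⁻¹) •
      ∑ p : Fin n × Fin n with p.1 < p.2, Matrix.single p.1 p.2 1 ⊗ₖ Matrix.single p.2 p.1 1

/-- The coefficient of `x^k` in `R(x) = f(x) R̄(x)`. -/
def Rcoeff (n : ℕ) (q : ℂ) (k : ℕ) : Matrix (Fin n × Fin n) (Fin n × Fin n) ℂ :=
  (fSeries n q • Rbar n q).map (PowerSeries.coeff k)

/-! ### The quantum affine algebra in the `RLL` presentation -/

/-- The generators: `lplus i j r` is `l⁺_ij[-r]`, `lminus i j r` is `l⁻_ij[r]`, and `qc`, `qcInv`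
are `q^c`, `q^{-c}`. -/
inductive Gen (n : ℕ) : Type
  | lplus (i j : Fin n) (r : ℕ)
  | lminus (i j : Fin n) (r : ℕ)
  | qc
  | qcInv

/-- The coefficient of `u^s`, `s ∈ ℤ`, in the matrix `L⁺(u) = [∑_r l⁺_ij[-r] u^r]`. -/
def plusMode {n : ℕ} {A : Type*} [Zero A] (x : Fin n → Fin n → ℕ → A) (s : ℤ) :
    Matrix (Fin n) (Fin n) A :=
  Matrix.of fun i j => if 0 ≤ s then x i j s.toNat else 0

/-- The coefficient of `u^s`, `s ∈ ℤ`, in the matrix `L⁻(u) = [∑_r l⁻_ij[r] u^{-r}]`. -/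
def minusMode {n : ℕ} {A : Type*} [Zero A] (x : Fin n → Fin n → ℕ → A) (s : ℤ) :
    Matrix (Fin n) (Fin n) A :=
  Matrix.of fun i j => if s ≤ 0 then x i j (-s).toNat else 0

/-- The coefficient of `u^s v^t` in `R(u γ / v) X_1(u) Y_2(v)`, for a central element `γ` and
formal series `X(u) = ∑ X(s) u^s`, `Y(v) = ∑ Y(t) v^t` of matrices, where `X(s) = 0` for `s < 0`
or `Y(t) = 0` for `t > 0`: all terms with `k > |s| + |t|` then vanish. -/
def rllLeft {n : ℕ} (q : ℂ) {A : Type*} [Ring A] [Algebra ℂ A] (γ : A)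
    (X Y : ℤ → Matrix (Fin n) (Fin n) A) (s t : ℤ) : Matrix (Fin n × Fin n) (Fin n × Fin n) A :=
  ∑ k ∈ Finset.range (s.natAbs + t.natAbs + 1),
    γ ^ k • ((Rcoeff n q k).map (algebraMap ℂ A) * ((X (s - k) ⊗ₖ 1) * (1 ⊗ₖ Y (t + k))))

/-- The coefficient of `u^s v^t` in `Y_2(v) X_1(u) R(u γ / v)`. -/
def rllRight {n : ℕ} (q : ℂ) {A : Type*} [Ring A] [Algebra ℂ A] (γ : A)
    (X Y : ℤ → Matrix (Fin n) (Fin n) A) (s t : ℤ) : Matrix (Fin n × Fin n) (Fin n × Fin n) A :=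
  ∑ k ∈ Finset.range (s.natAbs + t.natAbs + 1),
    γ ^ k • (((1 ⊗ₖ Y (t + k)) * (X (s - k) ⊗ₖ 1)) * (Rcoeff n q k).map (algebraMap ℂ A))

section Relations

variable (n : ℕ)

/-- `l⁺_ij[-r]` in the free algebra. -/
def freePlus (i j : Fin n) (r : ℕ) : FreeAlgebra ℂ (Gen n) := FreeAlgebra.ι ℂ (Gen.lplus i j r)

/-- `l⁻_ij[r]` in the free algebra. -/
def freeMinus (i j : Fin n) (r : ℕ) : FreeAlgebra ℂ (Gen n) := FreeAlgebra.ι ℂ (Gen.lminus i j r)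

/-- `q^c` in the free algebra. -/
def freeQc : FreeAlgebra ℂ (Gen n) := FreeAlgebra.ι ℂ Gen.qc

/-- `q^{-c}` in the free algebra. -/
def freeQcInv : FreeAlgebra ℂ (Gen n) := FreeAlgebra.ι ℂ Gen.qcInv

/-- The defining relations of `U_q(ĝl_n)`; the three `RLL` relations are imposed on all matrix
entries and on all coefficients of monomials `u^s v^t`. -/
inductive Rel (q : ℂ) : FreeAlgebra ℂ (Gen n) → FreeAlgebra ℂ (Gen n) → Prop
  | plus_zero (i j : Fin n) (h : i < j) : Rel q (freePlus n j i 0) 0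
  | minus_zero (i j : Fin n) (h : i < j) : Rel q (freeMinus n i j 0) 0
  | plus_minus (i : Fin n) : Rel q (freePlus n i i 0 * freeMinus n i i 0) 1
  | minus_plus (i : Fin n) : Rel q (freeMinus n i i 0 * freePlus n i i 0) 1
  | qc_qcInv : Rel q (freeQc n * freeQcInv n) 1
  | qcInv_qc : Rel q (freeQcInv n * freeQc n) 1
  | qc_central (g : Gen n) : Rel q (freeQc n * FreeAlgebra.ι ℂ g) (FreeAlgebra.ι ℂ g * freeQc n)
  | rll_plus (s t : ℤ) (I J : Fin n × Fin n) :
      Rel q (rllLeft q 1 (plusMode (freePlus n)) (plusMode (freePlus n)) s t I J)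
        (rllRight q 1 (plusMode (freePlus n)) (plusMode (freePlus n)) s t I J)
  | rll_minus (s t : ℤ) (I J : Fin n × Fin n) :
      Rel q (rllLeft q 1 (minusMode (freeMinus n)) (minusMode (freeMinus n)) s t I J)
        (rllRight q 1 (minusMode (freeMinus n)) (minusMode (freeMinus n)) s t I J)
  | rll_mixed (s t : ℤ) (I J : Fin n × Fin n) :
      Rel q (rllLeft q (freeQcInv n) (plusMode (freePlus n)) (minusMode (freeMinus n)) s t I J)
        (rllRight q (freeQc n) (plusMode (freePlus n)) (minusMode (freeMinus n)) s t I J)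

end Relations

/-- The quantum affine algebra `U_q(ĝl_n)`. -/
def Uq (n : ℕ) (q : ℂ) : Type := RingQuot (Rel n q)

instance (n : ℕ) (q : ℂ) : Ring (Uq n q) := inferInstanceAs (Ring (RingQuot (Rel n q)))

instance (n : ℕ) (q : ℂ) : Algebra ℂ (Uq n q) := inferInstanceAs (Algebra ℂ (RingQuot (Rel n q)))

/-- The canonical map from the free algebra onto the quantum affine algebra. -/
def toUq (n : ℕ) (q : ℂ) : FreeAlgebra ℂ (Gen n) →ₐ[ℂ] Uq n q := RingQuot.mkAlgHom ℂ (Rel n q)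

/-- The relation `q^c = q^{-n}`. -/
inductive CritRel (n : ℕ) (q : ℂ) : Uq n q → Uq n q → Prop
  | crit : CritRel n q (toUq n q (freeQc n)) (algebraMap ℂ (Uq n q) (q ^ (-(n : ℤ))))

/-- The quantum affine algebra at the critical level `c = -n`. -/
def UqCrit (n : ℕ) (q : ℂ) : Type := RingQuot (CritRel n q)

instance (n : ℕ) (q : ℂ) : Ring (UqCrit n q) := inferInstanceAs (Ring (RingQuot (CritRel n q)))

instance (n : ℕ) (q : ℂ) : Algebra ℂ (UqCrit n q) :=
  inferInstanceAs (Algebra ℂ (RingQuot (CritRel n q)))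

/-- The canonical map from the quantum affine algebra to its critical level quotient. -/
def UqToCrit (n : ℕ) (q : ℂ) : Uq n q →ₐ[ℂ] UqCrit n q := RingQuot.mkAlgHom ℂ (CritRel n q)

/-- The canonical map from the free algebra onto the critical level algebra. -/
def toCrit (n : ℕ) (q : ℂ) : FreeAlgebra ℂ (Gen n) →ₐ[ℂ] UqCrit n q :=
  (UqToCrit n q).comp (toUq n q)

theorem toUq_rel {n : ℕ} {q : ℂ} {x y : FreeAlgebra ℂ (Gen n)} (h : Rel n q x y) :
    toUq n q x = toUq n q y := RingQuot.mkAlgHom_rel ℂ h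

/-- The element `l⁺_ij[-r]` at the critical level. -/
def lPlus (n : ℕ) (q : ℂ) (i j : Fin n) (r : ℕ) : UqCrit n q := toCrit n q (freePlus n i j r)

/-- The element `l⁻_ij[r]` at the critical level. -/
def lMinus (n : ℕ) (q : ℂ) (i j : Fin n) (r : ℕ) : UqCrit n q := toCrit n q (freeMinus n i j r)

/-! ### The vacuum module and its invariants -/

/-- The left ideal generated by all `l⁻_ij[r]` with `r > 0` and all `l⁻_ij[0] - δ_ij` with
`i ≥ j`. -/
def vacIdeal (n : ℕ) (q : ℂ) : Submodule (UqCrit n q) (UqCrit n q) :=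
  Submodule.span (UqCrit n q)
    ({x | ∃ (i j : Fin n) (r : ℕ), 0 < r ∧ x = lMinus n q i j r} ∪
      {x | ∃ i j : Fin n, j ≤ i ∧ x = lMinus n q i j 0 - if i = j then 1 else 0})

/-- The vacuum module `V_q(gl_n)` at the critical level. -/
abbrev Vac (n : ℕ) (q : ℂ) : Type := UqCrit n q ⧸ vacIdeal n q

/-- The vacuum vector. -/
def vac (n : ℕ) (q : ℂ) : Vac n q := Submodule.Quotient.mk 1

/-- The subspace of invariants `z_q(ĝl_n) = {v | L⁻(u) v = I v}` of the vacuum module. -/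
def invariants (n : ℕ) (q : ℂ) : Submodule ℂ (Vac n q) where
  carrier := {v | ∀ (i j : Fin n) (r : ℕ),
    lMinus n q i j r • v = if i = j ∧ r = 0 then v else 0}
  zero_mem' := by intro i j r; simp
  add_mem' := by
    intro v w hv hw i j r
    rw [smul_add, hv, hw]; split_ifs <;> simp
  smul_mem' := by
    intro c v hv i j r
    rw [smul_comm, hv]; split_ifs <;> simp

theorem mem_invariants {n : ℕ} {q : ℂ} {v : Vac n q} : v ∈ invariants n q ↔
    ∀ (i j : Fin n) (r : ℕ), lMinus n q i j r • v = if i = j ∧ r = 0 then v else 0 := Iff.rfl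

theorem vacIdeal_le {n : ℕ} {q : ℂ} (w : invariants n q) :
    vacIdeal n q ≤ LinearMap.ker (LinearMap.toSpanSingleton (UqCrit n q) (Vac n q) w.1) := by
  refine Submodule.span_le.2 ?_
  rintro x (⟨i, j, r, hr, rfl⟩ | ⟨i, j, -, rfl⟩)
  · simp [w.2 i j r, hr.ne']
  · have h := w.2 i j 0
    by_cases e : i = j
    · subst e; simpa [sub_smul, sub_eq_zero] using h
    · simpa [e] using h

/-- For an invariant `w`, the endomorphism `x·1 ↦ x·w` of the vacuum module. -/
def rightMul {n : ℕ} {q : ℂ} (w : invariants n q) : Vac n q →ₗ[UqCrit n q] Vac n q :=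
  (vacIdeal n q).liftQ (LinearMap.toSpanSingleton (UqCrit n q) (Vac n q) w.1) (vacIdeal_le w)

@[simp] theorem rightMul_vac {n : ℕ} {q : ℂ} (w : invariants n q) :
    rightMul w (vac n q) = w.1 := by
  change LinearMap.toSpanSingleton (UqCrit n q) (Vac n q) w.1 1 = w.1
  simp

theorem Vac.exists_smul {n : ℕ} {q : ℂ} (v : Vac n q) :
    ∃ x : UqCrit n q, v = x • vac n q := by
  obtain ⟨x, rfl⟩ := Submodule.Quotient.mk_surjective _ v
  exact ⟨x, by rw [vac, ← Submodule.Quotient.mk_smul, smul_eq_mul, mul_one]⟩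

theorem rightMul_mem {n : ℕ} {q : ℂ} (v w : invariants n q) :
    rightMul w v.1 ∈ invariants n q := by
  intro i j r
  rw [← map_smul, v.2 i j r]
  split_ifs <;> simp

theorem vac_mem (n : ℕ) (q : ℂ) : vac n q ∈ invariants n q := by
  intro i j r
  rw [vac, ← Submodule.Quotient.mk_smul, smul_eq_mul, mul_one]
  split_ifs with h
  · obtain ⟨rfl, rfl⟩ := h
    refine (Submodule.Quotient.eq _).2 (Submodule.subset_span (Or.inr ⟨i, i, le_rfl, by simp⟩))
  · refine (Submodule.Quotient.mk_eq_zero _).2 ?_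
    rcases Nat.eq_zero_or_pos r with rfl | hr
    · have hij : i ≠ j := fun e => h ⟨e, rfl⟩
      rcases lt_or_gt_of_ne hij with hlt | hgt
      · have : lMinus n q i j 0 = 0 := by
          rw [lMinus, toCrit, AlgHom.comp_apply, toUq_rel (Rel.minus_zero i j hlt),
            map_zero, map_zero]
        rw [this]; exact zero_mem _
      · exact Submodule.subset_span (Or.inr ⟨i, j, hgt.le, by simp [hij]⟩)
    · exact Submodule.subset_span (Or.inl ⟨i, j, r, hr, rfl⟩)

/-- The product of invariants induced by the multiplication of the quantum affine algebra:
`(x·1)(y·1) = xy·1`. -/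
instance (n : ℕ) (q : ℂ) : Mul (invariants n q) := ⟨fun v w => ⟨rightMul w v.1, rightMul_mem v w⟩⟩

/-- The unit of the algebra of invariants is the vacuum vector. -/
instance (n : ℕ) (q : ℂ) : One (invariants n q) := ⟨⟨vac n q, vac_mem n q⟩⟩

theorem coe_mul {n : ℕ} {q : ℂ} (v w : invariants n q) :
    ((v * w : invariants n q) : Vac n q) = rightMul w v.1 := rfl

/-- The product is the one of the quantum affine algebra: `(x·1)(y·1) = xy·1`. -/
theorem coe_mul_of_eq {n : ℕ} {q : ℂ} (v w : invariants n q) (x y : UqCrit n q)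
    (hv : v.1 = x • vac n q) (hw : w.1 = y • vac n q) :
    ((v * w : invariants n q) : Vac n q) = (x * y) • vac n q := by
  rw [coe_mul, hv, map_smul, rightMul_vac, hw, mul_smul]

theorem coe_mul_smul {n : ℕ} {q : ℂ} (v w : invariants n q) (x : UqCrit n q)
    (hv : v.1 = x • vac n q) : ((v * w : invariants n q) : Vac n q) = x • w.1 := by
  rw [coe_mul, hv, map_smul, rightMul_vac]

/-- The ring structure of the algebra of invariants. -/
instance (n : ℕ) (q : ℂ) : Ring (invariants n q) :=
  { (inferInstance : AddCommGroup (invariants n q)) with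
    mul := (· * ·)
    one := 1
    left_distrib := by
      intro u v w
      obtain ⟨x, hx⟩ := Vac.exists_smul u.1
      ext1
      simp [coe_mul_smul u _ x hx]
    right_distrib := by
      intro u v w
      ext1
      simp [coe_mul]
    zero_mul := by intro u; ext1; simp [coe_mul]
    mul_zero := by
      intro u
      obtain ⟨x, hx⟩ := Vac.exists_smul u.1
      ext1
      simp [coe_mul_smul u _ x hx]
    mul_assoc := by
      intro u v w
      obtain ⟨x, hx⟩ := Vac.exists_smul u.1
      ext1
      rw [coe_mul, coe_mul_smul u _ x hx, coe_mul_smul u _ x hx, map_smul, coe_mul]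
    one_mul := by
      intro u
      ext1
      exact rightMul_vac u
    mul_one := by
      intro u
      obtain ⟨x, hx⟩ := Vac.exists_smul u.1
      ext1
      rw [coe_mul_smul u _ x hx, hx]
      rfl }

/-- `z_q(ĝl_n)` is an algebra over `ℂ`. -/
instance (n : ℕ) (q : ℂ) : Algebra ℂ (invariants n q) :=
  Algebra.ofModule
    (by
      intro c u v
      ext1
      simp only [coe_mul, Submodule.coe_smul]
      exact (rightMul v).map_smul_of_tower c u.1)
    (by
      intro c u v
      obtain ⟨x, hx⟩ := Vac.exists_smul u.1
      ext1
      rw [coe_mul_smul u _ x hx, Submodule.coe_smul, Submodule.coe_smul,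
        coe_mul_smul u _ x hx, smul_comm])

/-! ### The series `S̄_Λ(z)` -/

/-- The matrix `L⁺(z a)` for a scalar `a`: a matrix of formal power series in `z`. -/
def LPlus (n : ℕ) (q : ℂ) (a : ℂ) : Matrix (Fin n) (Fin n) (UqCrit n q)⟦X⟧ :=
  Matrix.of fun i j => PowerSeries.mk fun r => a ^ r • lPlus n q i j r

/-- `D = diag[q^{n-1}, q^{n-3}, …, q^{-n+1}]`. -/
def Dmat (n : ℕ) (q : ℂ) : Matrix (Fin n) (Fin n) ℂ :=
  Matrix.diagonal fun i => q ^ ((n : ℤ) - 1 - 2 * (i : ℤ))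

/-- `S̄_Λ(z) = tr_{1,…,m} L⁺_1(z q^{-2c_1(Λ)}) … L⁺_m(z q^{-2c_m(Λ)}) D_1 … D_m ℰ_Λ`. -/
def Sbar (n : ℕ) (q : ℂ) {μ : YoungDiagram} (Λ : StdTableau μ) : (UqCrit n q)⟦X⟧ :=
  Matrix.trace
    ((List.ofFn fun a => at1 a (LPlus n q (q ^ (-2 * Λ.content a)))).prod *
      ((List.ofFn fun a => at1 a (Dmat n q)).prod * idempotentOp n q Λ).map
        (algebraMap ℂ (UqCrit n q)⟦X⟧))

end QSugawara

end

open QSugawara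

/-! Let `X` be the tensor power (ℂⁿ)^{⊗m}, on which the Hecke algebra acts by Ř_k, and let ρ be
Young's form on V_λ. The proof takes place on the joint kernel K ⊂ X ⊗ V_λ of the operators Ř_k ⊗ 1
− 1 ⊗ ρ_k (`delta`), a model of Hom_H(V_λ, X). The starting point is `Rcheck_sub_eq`: Ř_k minus the
diagonal entry of ρ_k at Λ is a multiple of the baxterized Ř with spectral parameters q^{-2c_k(Λ)},
q^{-2c_{k+1}(Λ)}. The RLL relation for L⁺ (`LPlus_exch`) therefore shows that the block-diagonal
operator 𝓛, with blocks L⁺_1(zq^{-2c_1(Λ)}) … L⁺_m(zq^{-2c_m(Λ)}), preserves K (`ExchRel.delta_mul`,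
`delta_mul_blockDiagonal`). So does D_1 … D_m.

Independence of Λ: the element ∑_σ T_σ ⊗ ρ_σ (`symSum`) is annihilated by all `delta` on both sides.
Hence the partial trace over X of 𝓛 D ∑_σ T_σ ⊗ ρ_σ commutes with Young's form and is scalar by
Schur's lemma (`scalar_of_commute_youngMatrix`); its diagonal entries are the series of the tableaux
Λ, up to the factor c_λ. Summing over Λ also shows that the series is a multiple of the trace of 𝓛 D
over K (`exists_trace_eq`). The projection onto K is any matrix e with δ_k e = 0 and 1 − e in the
left ideal of the δ_k.

Invariance: at the critical level the mixed relation carries R at the shift qⁿ on one side and q⁻ⁿ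
on the other. Moving L⁻ through 𝓛 surrounds 𝓛 by products of R-matrices, and on the vacuum L⁻
becomes the identity. The R-matrices have scalar entries and preserve K, so they can be rotated
inside the trace, where crossing symmetry with D (`crossing_entry`) removes them. Crossing symmetry
rests on a telescoping sum (`sum_TB_diag_mul`) and on the functional equation of f
(`crossing_factor`).

Commutativity: the product of R-matrices over all pairs of factors of two tensor powers is
invertible, has scalar entries, preserves both kernels and intertwines the two orders of the
operators 𝓛 D. Rotating it through the trace over both kernels exchanges the two series
(`commute_trace_of_intertwine`). Commutativity among the invariants follows, because their product
is induced from the algebra. -/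

noncomputable section

namespace QSugawara

/-! ### Permutations: inversions, reduced words, Matsumoto's theorem. -/

section Words

variable {m : ℕ}

/-- The left position of the adjacent transposition `σ_k`. -/
def lo (k : Fin (m - 1)) : Fin m := ⟨k.1, by have := k.2; omega⟩

/-- The right position of the adjacent transposition `σ_k`. -/
def hi (k : Fin (m - 1)) : Fin m := ⟨k.1 + 1, by have := k.2; omega⟩

theorem adjSwap_eq (k : Fin (m - 1)) : adjSwap k = Equiv.swap (lo k) (hi k) := rfl

theorem lo_lt_hi (k : Fin (m - 1)) : lo k < hi k := by
  rw [Fin.lt_def]; simp [lo, hi]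

theorem lo_ne_hi (k : Fin (m - 1)) : lo k ≠ hi k := (lo_lt_hi k).ne

@[simp] theorem adjSwap_lo (k : Fin (m - 1)) : adjSwap k (lo k) = hi k := Equiv.swap_apply_left _ _

@[simp] theorem adjSwap_hi (k : Fin (m - 1)) : adjSwap k (hi k) = lo k := Equiv.swap_apply_right _ _

theorem adjSwap_of_ne {k : Fin (m - 1)} {a : Fin m} (h : a ≠ lo k) (h' : a ≠ hi k) :
    adjSwap k a = a := Equiv.swap_apply_of_ne_of_ne h h'

@[simp] theorem adjSwap_mul_self (k : Fin (m - 1)) : adjSwap k * adjSwap k = 1 :=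
  Equiv.swap_mul_self _ _

@[simp] theorem adjSwap_adjSwap (k : Fin (m - 1)) (a : Fin m) : adjSwap k (adjSwap k a) = a :=
  Equiv.swap_apply_self _ _ _

@[simp] theorem adjSwap_inv (k : Fin (m - 1)) : (adjSwap k)⁻¹ = adjSwap k := Equiv.swap_inv _ _

theorem adjSwap_apply_val (k : Fin (m - 1)) (a : Fin m) :
    ((adjSwap k a : Fin m) : ℕ) = if a.1 = k.1 then k.1 + 1
      else if a.1 = k.1 + 1 then k.1 else a.1 := by
  rw [adjSwap_eq, Equiv.swap_apply_def]
  simp only [lo, hi, Fin.ext_iff]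
  split_ifs <;> rfl

theorem adjSwap_lt {k : Fin (m - 1)} {a b : Fin m} (hab : a < b)
    (h : ¬ (a = lo k ∧ b = hi k)) : adjSwap k a < adjSwap k b := by
  simp only [lo, hi, Fin.lt_def, Fin.ext_iff, adjSwap_apply_val] at *
  split_ifs <;> omega

/-- The number of inversions of a permutation. -/
def invCount (g : Equiv.Perm (Fin m)) : ℕ :=
  (Finset.univ.filter fun p : Fin m × Fin m => p.1 < p.2 ∧ g p.2 < g p.1).card

/-- Precomposing with `adjSwap k` moves the inversions of `g` injectively, and the only new
inversion is `(lo k, hi k)`, the one pair of positions whose order the transposition reverses. -/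
theorem invCount_mul_adjSwap_of_lt {g : Equiv.Perm (Fin m)} {k : Fin (m - 1)}
    (h : g (lo k) < g (hi k)) : invCount (g * adjSwap k) = invCount g + 1 := by
  classical
  have key : (Finset.univ.filter fun p : Fin m × Fin m =>
        p.1 < p.2 ∧ (g * adjSwap k) p.2 < (g * adjSwap k) p.1) =
      insert (lo k, hi k) ((Finset.univ.filter fun p : Fin m × Fin m =>
        p.1 < p.2 ∧ g p.2 < g p.1).map
          (Equiv.prodCongr (adjSwap k) (adjSwap k)).toEmbedding) := by
    ext ⟨a, b⟩
    rw [Finset.mem_filter, Finset.mem_insert, Finset.mem_map]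
    simp only [Finset.mem_filter, Finset.mem_univ, true_and, Equiv.coe_toEmbedding, Prod.exists,
      Equiv.prodCongr_apply, Prod.map_apply, Prod.mk.injEq, Equiv.Perm.mul_apply]
    constructor
    · rintro ⟨hab, hg⟩
      by_cases hk : a = lo k ∧ b = hi k
      · exact Or.inl hk
      · exact Or.inr ⟨adjSwap k a, adjSwap k b, ⟨adjSwap_lt hab hk, hg⟩, by simp⟩
    · rintro (⟨rfl, rfl⟩ | ⟨a, b, ⟨hab, hg⟩, rfl, rfl⟩)
      · exact ⟨lo_lt_hi k, by simpa using h⟩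
      · refine ⟨adjSwap_lt hab ?_, by simpa using hg⟩
        rintro ⟨rfl, rfl⟩
        exact absurd h hg.le.not_gt
  rw [invCount, key, Finset.card_insert_of_notMem, Finset.card_map, invCount]
  simp only [Finset.mem_map, Finset.mem_filter, Finset.mem_univ, true_and, Equiv.coe_toEmbedding,
    Prod.exists, Equiv.prodCongr_apply, Prod.map_apply, Prod.mk.injEq, not_exists, not_and]
  rintro a b ⟨hab, -⟩ ha hb
  have ha' : a = hi k := by rw [← adjSwap_adjSwap k a, ha, adjSwap_lo]
  have hb' : b = lo k := by rw [← adjSwap_adjSwap k b, hb, adjSwap_hi]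
  rw [ha', hb'] at hab
  exact absurd hab (lo_lt_hi k).le.not_gt

theorem invCount_mul_adjSwap_of_gt {g : Equiv.Perm (Fin m)} {k : Fin (m - 1)}
    (h : g (hi k) < g (lo k)) : invCount (g * adjSwap k) + 1 = invCount g := by
  rw [← invCount_mul_adjSwap_of_lt (g := g * adjSwap k) (k := k) (by simpa using h)]
  simp [mul_assoc]

theorem lt_or_gt_apply (g : Equiv.Perm (Fin m)) (k : Fin (m - 1)) :
    g (lo k) < g (hi k) ∨ g (hi k) < g (lo k) :=
  lt_or_gt_of_ne (g.injective.ne (lo_ne_hi k))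

theorem invCount_one : invCount (1 : Equiv.Perm (Fin m)) = 0 := by
  rw [invCount, Finset.card_eq_zero, Finset.filter_eq_empty_iff]
  rintro p - ⟨h, h'⟩
  exact absurd h h'.le.not_gt

theorem invCount_inv (g : Equiv.Perm (Fin m)) : invCount g⁻¹ = invCount g := by
  refine Finset.card_bij' (fun p _ => (g⁻¹ p.2, g⁻¹ p.1)) (fun p _ => (g p.2, g p.1)) ?_ ?_ ?_ ?_ <;>
    simp +contextual

theorem invCount_prod_le (w : List (Fin (m - 1))) : invCount (w.map adjSwap).prod ≤ w.length := by
  induction w using List.reverseRecOn with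
  | nil => simp [invCount_one]
  | append_singleton u k ih =>
    simp only [List.map_append, List.prod_append, List.map_cons, List.map_nil, List.prod_singleton,
      List.length_append, List.length_singleton]
    rcases lt_or_gt_apply (u.map adjSwap).prod k with h | h
    · rw [invCount_mul_adjSwap_of_lt h]; omega
    · have := invCount_mul_adjSwap_of_gt h; omega

/-- Without descents `g` is strictly increasing, and a finite chain has no order automorphism but
the identity. -/
theorem exists_descent {g : Equiv.Perm (Fin m)} (h : g ≠ 1) :
    ∃ k : Fin (m - 1), g (hi k) < g (lo k) := by
  by_contra! hk
  apply h
  rcases m with _ | m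
  · exact Subsingleton.elim _ _
  have hm : StrictMono g := by
    rw [Fin.strictMono_iff_lt_succ]
    intro i
    exact lt_of_le_of_ne (hk i) (g.injective.ne (lo_ne_hi (m := m + 1) i))
  have : (hm.orderIsoOfSurjective g g.surjective) = OrderIso.refl _ := Subsingleton.elim _ _
  ext a
  exact congrArg Fin.val (DFunLike.congr_fun this a)

/-- Bubble sort: removing a descent lowers the number of inversions by exactly one. Together with
`invCount_prod_le` this identifies the minimal word length with the number of inversions. -/
theorem exists_word_inv (g : Equiv.Perm (Fin m)) :
    ∃ w : List (Fin (m - 1)), (w.map adjSwap).prod = g ∧ w.length = invCount g := by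
  induction hN : invCount g using Nat.strong_induction_on generalizing g with
  | _ N ih =>
    by_cases h : g = 1
    · subst h; exact ⟨[], by simp, by simp [← hN, invCount_one]⟩
    · obtain ⟨k, hk⟩ := exists_descent h
      have := invCount_mul_adjSwap_of_gt hk
      obtain ⟨w, hw, hl⟩ := ih (invCount (g * adjSwap k)) (by omega) _ rfl
      exact ⟨w ++ [k], by simp [hw, mul_assoc], by simp [hl]; omega⟩

theorem isReducedWord_iff {w : List (Fin (m - 1))} {g : Equiv.Perm (Fin m)} :
    IsReducedWord w g ↔ (w.map adjSwap).prod = g ∧ w.length = invCount g := by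
  constructor
  · rintro ⟨h, h'⟩
    obtain ⟨v, hv, hl⟩ := exists_word_inv g
    exact ⟨h, le_antisymm (hl ▸ h' v hv) (h ▸ invCount_prod_le w)⟩
  · rintro ⟨h, h'⟩
    exact ⟨h, fun v hv => h' ▸ hv ▸ invCount_prod_le v⟩

theorem isReducedWord_reducedWord (g : Equiv.Perm (Fin m)) : IsReducedWord (reducedWord g) g :=
  (exists_reducedWord g).choose_spec

theorem IsReducedWord.snoc {w : List (Fin (m - 1))} {g : Equiv.Perm (Fin m)} {k : Fin (m - 1)}
    (hw : IsReducedWord w g) (h : g (lo k) < g (hi k)) :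
    IsReducedWord (w ++ [k]) (g * adjSwap k) := by
  rw [isReducedWord_iff] at *
  rw [invCount_mul_adjSwap_of_lt h]
  simp [hw]

theorem IsReducedWord.snoc_of_eq {w : List (Fin (m - 1))} {g g' : Equiv.Perm (Fin m)}
    {k : Fin (m - 1)} (hw : IsReducedWord w g) (hg : g' * adjSwap k = g)
    (h : g' (hi k) < g' (lo k)) : IsReducedWord (w ++ [k]) g' := by
  subst hg
  simpa [mul_assoc] using hw.snoc (k := k) (by simpa using h)

/-- A letter changes the number of inversions by exactly one, so the last letter of a reduced word
must have created one. The induction in `IsBraid.prod_eq` strips letters in this way. -/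
theorem IsReducedWord.of_snoc {w : List (Fin (m - 1))} {g : Equiv.Perm (Fin m)} {k : Fin (m - 1)}
    (hw : IsReducedWord (w ++ [k]) g) :
    IsReducedWord w (g * adjSwap k) ∧ g (hi k) < g (lo k) := by
  rw [isReducedWord_iff] at *
  obtain ⟨rfl, h⟩ := hw
  simp only [List.map_append, List.prod_append, List.map_cons, List.map_nil, List.prod_singleton,
    List.length_append, List.length_singleton, mul_assoc, adjSwap_mul_self, mul_one, true_and,
    Equiv.Perm.mul_apply, adjSwap_lo, adjSwap_hi] at *
  have hle := invCount_prod_le w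
  rcases lt_or_gt_apply (w.map adjSwap).prod k with h' | h'
  · rw [invCount_mul_adjSwap_of_lt h'] at h
    exact ⟨by omega, h'⟩
  · have := invCount_mul_adjSwap_of_gt h'
    omega

theorem IsReducedWord.reverse {w : List (Fin (m - 1))} {g : Equiv.Perm (Fin m)}
    (hw : IsReducedWord w g) : IsReducedWord w.reverse g⁻¹ := by
  rw [isReducedWord_iff] at *
  refine ⟨?_, by rw [invCount_inv, List.length_reverse, hw.2]⟩
  rw [← hw.1, List.prod_inv_reverse, List.map_reverse, List.map_map]
  simp [Function.comp_def]

/-- The braid relations. -/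
structure IsBraid {A : Type*} [Monoid A] (t : Fin (m - 1) → A) : Prop where
  comm : ∀ i j : Fin (m - 1), i.1 + 1 < j.1 → t i * t j = t j * t i
  braid : ∀ i j : Fin (m - 1), j.1 = i.1 + 1 → t i * t j * t i = t j * t i * t j

theorem isBraid_adjSwap : IsBraid (adjSwap : Fin (m - 1) → Equiv.Perm (Fin m)) where
  comm i j h := by
    ext a
    simp only [Equiv.Perm.mul_apply, adjSwap_apply_val]
    split_ifs <;> omega
  braid i j h := by
    ext a
    simp only [Equiv.Perm.mul_apply, adjSwap_apply_val, h]
    split_ifs <;> omega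

/-- Matsumoto's theorem for the symmetric group. -/
theorem IsBraid.prod_eq {A : Type*} [Monoid A] {t : Fin (m - 1) → A} (ht : IsBraid t)
    {w w' : List (Fin (m - 1))} {g : Equiv.Perm (Fin m)} (hw : IsReducedWord w g)
    (hw' : IsReducedWord w' g) : (w.map t).prod = (w'.map t).prod := by
  induction hN : w.length using Nat.strong_induction_on generalizing w w' g with
  | _ N ih =>
    have hlen : w.length = w'.length := by
      rw [(isReducedWord_iff.1 hw).2, (isReducedWord_iff.1 hw').2]
    rcases List.eq_nil_or_concat' w with rfl | ⟨u, i, rfl⟩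
    · rw [List.length_nil] at hlen
      rw [List.length_eq_zero_iff.1 hlen.symm]
    rcases List.eq_nil_or_concat' w' with rfl | ⟨v, j, rfl⟩
    · simp at hlen
    obtain ⟨hu, hi'⟩ := hw.of_snoc
    obtain ⟨hv, hj'⟩ := hw'.of_snoc
    simp only [List.length_append, List.length_singleton] at hN hlen
    -- If the last letters differ, both words are compared with words that pass through a common
    -- shorter permutation. By symmetry only `i < j` is needed.
    have main : ∀ (i j : Fin (m - 1)) (u v : List (Fin (m - 1))), u.length < N → v.length < N →
        IsReducedWord u (g * adjSwap i) → IsReducedWord v (g * adjSwap j) →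
        g (hi i) < g (lo i) → g (hi j) < g (lo j) → i < j →
        (u.map t).prod * t i = (v.map t).prod * t j := by
      intro i j u v huN hvN hu hv hi' hj' hij
      rcases Nat.lt_or_ge (i.1 + 1) j.1 with hfar | hnear
      · have h1 : adjSwap i (lo j) = lo j :=
          adjSwap_of_ne (by simp [lo, Fin.ext_iff]; omega) (by simp [lo, hi, Fin.ext_iff]; omega)
        have h2 : adjSwap i (hi j) = hi j :=
          adjSwap_of_ne (by simp [lo, hi, Fin.ext_iff]; omega) (by simp [hi, Fin.ext_iff]; omega)
        have h3 : adjSwap j (lo i) = lo i :=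
          adjSwap_of_ne (by simp [lo, Fin.ext_iff]; omega) (by simp [lo, hi, Fin.ext_iff]; omega)
        have h4 : adjSwap j (hi i) = hi i :=
          adjSwap_of_ne (by simp [lo, hi, Fin.ext_iff]; omega) (by simp [hi, Fin.ext_iff]; omega)
        -- Both commuting descents can be removed: a reduced word `x` of `g s_i s_j` extends to `x
        -- j` for `g s_i` and to `x i` for `g s_j`. The induction hypothesis applies to both, and `t
        -- i`, `t j` commute.
        have hx := isReducedWord_reducedWord (g * adjSwap i * adjSwap j)
        have hxj := hx.snoc_of_eq (g' := g * adjSwap i) (k := j) rfl (by simpa [h1, h2] using hj')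
        have hxi := hx.snoc_of_eq (g' := g * adjSwap j) (k := i)
          (by rw [mul_assoc, mul_assoc, isBraid_adjSwap.comm i j hfar])
          (by simpa [h3, h4] using hi')
        rw [ih _ huN hu hxj rfl, ih _ hvN hv hxi rfl]
        simp [mul_assoc, ht.comm i j hfar]
      · have hj1 : j.1 = i.1 + 1 := by
          have : i.1 < j.1 := hij
          omega
        have hlj : lo j = hi i := by simp [lo, hi, Fin.ext_iff, hj1]
        have h2 : adjSwap i (hi j) = hi j :=
          adjSwap_of_ne (by simp [lo, hi, Fin.ext_iff]; omega) (by simp [hi, Fin.ext_iff]; omega)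
        have h3 : adjSwap j (lo i) = lo i :=
          adjSwap_of_ne (by simp [lo, Fin.ext_iff]; omega) (by simp [lo, hi, Fin.ext_iff]; omega)
        have h5 : adjSwap j (hi i) = hi j := by rw [← hlj, adjSwap_lo]
        have h6 : adjSwap i (lo j) = lo i := by rw [hlj, adjSwap_hi]
        rw [hlj] at hj'
        -- Adjacent descents mean that `g` reverses three consecutive positions, so the longest
        -- element `s_i s_j s_i` splits off. The word `x` extends to `x i j` for `g s_i` and `x j i`
        -- for `g s_j`, and the braid relation closes the diagram.
        have hx := isReducedWord_reducedWord (g * adjSwap i * adjSwap j * adjSwap i)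
        have hxij := (hx.snoc_of_eq (g' := g * adjSwap i * adjSwap j) (k := i) rfl
          (by simpa [h2, h3, h5] using hj')).snoc_of_eq (g' := g * adjSwap i) (k := j) rfl
          (by simpa [h2, h6, hlj] using hj'.trans hi')
        have hxji := (hx.snoc_of_eq (g' := g * adjSwap j * adjSwap i) (k := j)
          (by simp only [mul_assoc]; rw [← mul_assoc (adjSwap j), ← isBraid_adjSwap.braid i j hj1,
              mul_assoc])
          (by simpa [h2, h6, hlj, h3, h5] using hi')).snoc_of_eq (g' := g * adjSwap j) (k := i) rfl
          (by simpa [h3, h5] using hj'.trans hi')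
        rw [ih _ huN hu hxij rfl, ih _ hvN hv hxji rfl]
        simp only [List.map_append, List.prod_append, List.map_cons, List.map_nil,
          List.prod_singleton, mul_assoc]
        rw [← mul_assoc (t i), ht.braid i j hj1, mul_assoc]
    simp only [List.map_append, List.prod_append, List.map_cons, List.map_nil, List.prod_singleton]
    rcases lt_trichotomy i j with hij | rfl | hij
    · exact main i j u v (by omega) (by omega) hu hv hi' hj' hij
    · rw [ih _ (by omega) hu hv rfl]
    · exact (main j i v u (by omega) (by omega) hv hu hj' hi' hij).symm

section HeckeT

variable {A : Type*} [Monoid A] {t : Fin (m - 1) → A}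

theorem IsBraid.heckeT_eq (ht : IsBraid t) {w : List (Fin (m - 1))} {g : Equiv.Perm (Fin m)}
    (hw : IsReducedWord w g) : heckeT t g = (w.map t).prod :=
  ht.prod_eq (isReducedWord_reducedWord g) hw

theorem IsBraid.heckeT_mul (ht : IsBraid t) {g : Equiv.Perm (Fin m)} {k : Fin (m - 1)}
    (h : g (lo k) < g (hi k)) : heckeT t (g * adjSwap k) = heckeT t g * t k := by
  rw [ht.heckeT_eq ((isReducedWord_reducedWord g).snoc h)]
  simp [heckeT]

theorem IsBraid.heckeT_inv (ht : IsBraid t) (g : Equiv.Perm (Fin m)) :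
    heckeT t g⁻¹ = ((reducedWord g).reverse.map t).prod :=
  ht.heckeT_eq (isReducedWord_reducedWord g).reverse

theorem IsBraid.mul_heckeT (ht : IsBraid t) {g : Equiv.Perm (Fin m)} {k : Fin (m - 1)}
    (h : g⁻¹ (lo k) < g⁻¹ (hi k)) : heckeT t (adjSwap k * g) = t k * heckeT t g := by
  have hw := ((isReducedWord_reducedWord g).reverse.snoc h).reverse
  rw [mul_inv_rev, inv_inv, adjSwap_inv] at hw
  rw [ht.heckeT_eq hw]
  simp [heckeT]

end HeckeT

end Words

/-! ### Hecke relations and sums over the symmetric group. -/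

section Hecke

variable {m : ℕ}

/-- The defining relations of the Hecke algebra. -/
structure IsHecke {A : Type*} [Ring A] [Algebra ℂ A] (h : ℂ) (t : Fin (m - 1) → A) : Prop
    extends IsBraid t where
  sq : ∀ k, t k * t k = h • t k + 1

/-- Left multiplication by `σ_k` is an involution without fixed points that exchanges the
permutations it lengthens with those it shortens, so one member of each pair is enough. -/
theorem sum_eq_zero_of_left {G : Type*} [AddCommGroup G] (k : Fin (m - 1))
    (F : Equiv.Perm (Fin m) → G)
    (hF : ∀ σ : Equiv.Perm (Fin m), σ⁻¹ (lo k) < σ⁻¹ (hi k) → F σ + F (adjSwap k * σ) = 0) :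
    ∑ σ, F σ = 0 := by
  refine Finset.sum_involution (fun σ _ => adjSwap k * σ) ?_ ?_ ?_ ?_
  · intro σ _
    rcases lt_or_gt_apply σ⁻¹ k with h | h
    · exact hF σ h
    · have := hF (adjSwap k * σ) (by simpa using h)
      rwa [← mul_assoc, adjSwap_mul_self, one_mul, add_comm] at this
  · intro σ _ _ h
    have := mul_eq_right.1 h
    have h2 := adjSwap_lo k
    rw [this] at h2
    exact lo_ne_hi k h2
  · simp
  · intro σ _
    rw [← mul_assoc, adjSwap_mul_self, one_mul]

theorem sum_eq_zero_of_right {G : Type*} [AddCommGroup G] (k : Fin (m - 1))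
    (F : Equiv.Perm (Fin m) → G)
    (hF : ∀ σ : Equiv.Perm (Fin m), σ (lo k) < σ (hi k) → F σ + F (σ * adjSwap k) = 0) :
    ∑ σ, F σ = 0 := by
  rw [← Equiv.sum_comp (Equiv.inv (Equiv.Perm (Fin m)))]
  refine sum_eq_zero_of_left k _ fun σ h => ?_
  have := hF σ⁻¹ h
  simpa using this

end Hecke

/-! ### Two-term operators: the common shape of Ř_k on tensors and of Young's form. -/

section TwoTerm

variable {X : Type*} [Fintype X] [DecidableEq X]

/-- The operator `v_F ↦ a(F) v_F + b(F) v_{s F}`. -/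
def twoTerm (s : X → X) (a b : X → ℂ) : Matrix X X ℂ :=
  Matrix.of fun G F => (if G = F then a F else 0) + if G = s F then b F else 0

theorem twoTerm_mulVec_single (s : X → X) (a b : X → ℂ) (F : X) :
    (twoTerm s a b).mulVec (Pi.single F 1) = a F • Pi.single F 1 + b F • Pi.single (s F) 1 := by
  ext G
  simp [twoTerm, Pi.single_apply]

/-- The relation is tested on one basis vector at a time, because Young's form on arbitrary fillings
is needed only at the standard ones. The alternative `b F = 0` covers fixed vectors `s F = F`, where
the two diagonal coefficients need not add up to `h`. -/
theorem twoTerm_sq_at {s : X → X} {a b : X → ℂ} {h : ℂ} {F : X} (hs : s (s F) = F)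
    (h1 : a F * a F + b F * b (s F) = h * a F + 1) (h2 : b F = 0 ∨ a F + a (s F) = h) :
    (twoTerm s a b * twoTerm s a b).mulVec (Pi.single F 1) =
      (h • twoTerm s a b + 1).mulVec (Pi.single F 1) := by
  have h3 : b F * (a F + a (s F)) = h * b F := by
    rcases h2 with h2 | h2 <;> simp [h2, mul_comm]
  simp only [← Matrix.mulVec_mulVec, twoTerm_mulVec_single, Matrix.mulVec_add, Matrix.mulVec_smul,
    hs, Matrix.add_mulVec, Matrix.smul_mulVec, Matrix.one_mulVec]
  ext G
  simp only [Pi.add_apply, Pi.smul_apply, smul_eq_mul]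
  linear_combination h1 * (Pi.single F 1 : X → ℂ) G + h3 * (Pi.single (s F) 1 : X → ℂ) G

theorem twoTerm_comm_at {s s' : X → X} {a b a' b' : X → ℂ} {F : X} (hs : s (s' F) = s' (s F))
    (h1 : a (s' F) = a F) (h2 : b (s' F) = b F) (h3 : a' (s F) = a' F) (h4 : b' (s F) = b' F) :
    (twoTerm s a b * twoTerm s' a' b').mulVec (Pi.single F 1) =
      (twoTerm s' a' b' * twoTerm s a b).mulVec (Pi.single F 1) := by
  simp only [← Matrix.mulVec_mulVec, twoTerm_mulVec_single, Matrix.mulVec_add, Matrix.mulVec_smul,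
    hs, h1, h2, h3, h4]
  ext G
  simp only [Pi.add_apply, Pi.smul_apply, smul_eq_mul]
  ring

/-- Think of `F` as a triple (x, y, z) permuted by `s₁` and `s₂`; then `a₂ (s₁ F)` belongs to the
outer pair (x, z). Both sides spread over the six rearrangements. The coefficients at `F`, `s₁ F`,
`s₂ F` agree by `h1`, `h2`, `h3`, and the other three agree by the symmetry hypotheses. -/
theorem twoTerm_braid_at {s₁ s₂ : X → X} {a₁ b₁ a₂ b₂ : X → ℂ} {F : X}
    (hs₁ : s₁ (s₁ F) = F) (hs₂ : s₂ (s₂ F) = F) (hs : s₁ (s₂ (s₁ F)) = s₂ (s₁ (s₂ F)))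
    (ha : a₁ (s₂ F) = a₂ (s₁ F)) (hb : b₁ (s₂ F) = b₂ (s₁ F))
    (ha₁ : a₁ (s₂ (s₁ F)) = a₂ F) (hb₁ : b₁ (s₂ (s₁ F)) = b₂ F)
    (ha₂ : a₂ (s₁ (s₂ F)) = a₁ F) (hb₂ : b₂ (s₁ (s₂ F)) = b₁ F)
    (h1 : a₁ F ^ 2 * a₂ F + b₁ F * b₁ (s₁ F) * a₂ (s₁ F) =
      a₂ F ^ 2 * a₁ F + b₂ F * b₂ (s₂ F) * a₂ (s₁ F))
    (h2 : b₁ F = 0 ∨ a₁ F * a₂ F + a₂ (s₁ F) * a₁ (s₁ F) = a₂ F * a₂ (s₁ F))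
    (h3 : b₂ F = 0 ∨ a₁ F * a₂ (s₁ F) = a₂ F * a₁ F + a₂ (s₁ F) * a₂ (s₂ F)) :
    (twoTerm s₁ a₁ b₁ * twoTerm s₂ a₂ b₂ * twoTerm s₁ a₁ b₁).mulVec (Pi.single F 1) =
      (twoTerm s₂ a₂ b₂ * twoTerm s₁ a₁ b₁ * twoTerm s₂ a₂ b₂).mulVec (Pi.single F 1) := by
  have h2' : b₁ F * (a₁ F * a₂ F + a₂ (s₁ F) * a₁ (s₁ F)) = b₁ F * (a₂ F * a₂ (s₁ F)) := by
    rcases h2 with h2 | h2 <;> simp [h2]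
  have h3' : b₂ F * (a₁ F * a₂ (s₁ F)) = b₂ F * (a₂ F * a₁ F + a₂ (s₁ F) * a₂ (s₂ F)) := by
    rcases h3 with h3 | h3 <;> simp [h3]
  simp only [← Matrix.mulVec_mulVec, twoTerm_mulVec_single, Matrix.mulVec_add, Matrix.mulVec_smul,
    hs₁, hs₂, ha, hb, ha₁, hb₁, ha₂, hb₂, hs]
  ext G
  simp only [Pi.add_apply, Pi.smul_apply, smul_eq_mul]
  linear_combination h1 * (Pi.single F 1 : X → ℂ) G + h2' * (Pi.single (s₁ F) 1 : X → ℂ) G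
    + h3' * (Pi.single (s₂ F) 1 : X → ℂ) G

theorem matrix_ext_single {Y : Type*} {M N : Matrix Y X ℂ}
    (h : ∀ F, M.mulVec (Pi.single F 1) = N.mulVec (Pi.single F 1)) : M = N :=
  Matrix.ext_of_mulVec_single h

end TwoTerm

/-! ### The matrix Ř and its Hecke relations on tensors. -/

section RMatrix

variable {n : ℕ}

theorem sum_single_diag_apply {C : Type*} [CommRing C] (P : Fin n × Fin n → Prop) [DecidablePred P]
    (a b c d : Fin n) :
    (∑ p : Fin n × Fin n with P p,
      Matrix.single p.1 p.1 (1 : C) ⊗ₖ Matrix.single p.2 p.2 (1 : C)) (a, b) (c, d) =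
      if P (a, b) ∧ a = c ∧ b = d then 1 else 0 := by
  rw [Finset.sum_filter, Matrix.sum_apply, Finset.sum_eq_single (a, b)]
  · by_cases hP : P (a, b)
    · simp [hP, Matrix.single_apply, ← ite_and, and_comm]
    · simp [hP]
  · rintro ⟨i, j⟩ - h
    have : ¬ (i = a ∧ j = b) := fun ⟨h1, h2⟩ => h (by rw [h1, h2])
    split_ifs
    · simp only [Matrix.kroneckerMap_apply, Matrix.single_apply]
      split_ifs <;> simp_all
    · rfl
  · simp

theorem sum_single_flip_apply {C : Type*} [CommRing C] (P : Fin n × Fin n → Prop) [DecidablePred P]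
    (a b c d : Fin n) :
    (∑ p : Fin n × Fin n with P p,
      Matrix.single p.1 p.2 (1 : C) ⊗ₖ Matrix.single p.2 p.1 (1 : C)) (a, b) (c, d) =
      if P (a, b) ∧ b = c ∧ a = d then 1 else 0 := by
  rw [Finset.sum_filter, Matrix.sum_apply, Finset.sum_eq_single (a, b)]
  · by_cases hP : P (a, b)
    · simp [hP, Matrix.single_apply, ← ite_and, and_comm]
    · simp [hP]
  · rintro ⟨i, j⟩ - h
    have : ¬ (i = a ∧ j = b) := fun ⟨h1, h2⟩ => h (by rw [h1, h2])
    split_ifs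
    · simp only [Matrix.kroneckerMap_apply, Matrix.single_apply]
      split_ifs <;> simp_all
    · rfl
  · simp

theorem sum_diag_apply {C : Type*} [CommRing C] (a b c d : Fin n) :
    (∑ i : Fin n, Matrix.single i i (1 : C) ⊗ₖ Matrix.single i i (1 : C)) (a, b) (c, d) =
      if a = b ∧ a = c ∧ a = d then 1 else 0 := by
  rw [Matrix.sum_apply, Finset.sum_eq_single a]
  · simp only [Matrix.kroneckerMap_apply, Matrix.single_apply]
    rcases eq_or_ne a b with rfl | h1
    · simp [← ite_and, and_comm]
    · simp [h1]
  · intro i _ h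
    simp [Matrix.single_apply, h]
  · simp

theorem flipP_apply (a b c d : Fin n) : flipP n (a, b) (c, d) = if b = c ∧ a = d then 1 else 0 := by
  have := sum_single_flip_apply (C := ℂ) (fun _ : Fin n × Fin n => True) a b c d
  simpa [flipP] using this

theorem flipP_mul_apply (M : Matrix (Fin n × Fin n) (Fin n × Fin n) ℂ) (a b : Fin n)
    (x : Fin n × Fin n) : (flipP n * M) (a, b) x = M (b, a) x := by
  rw [Matrix.mul_apply, Finset.sum_eq_single (b, a)]
  · simp [flipP_apply]
  · rintro ⟨i, j⟩ - h
    rw [flipP_apply, if_neg, zero_mul]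
    rintro ⟨rfl, rfl⟩
    exact h rfl
  · simp

/-- The diagonal coefficients of `Ř`. -/
def tDiag (q : ℂ) (c d : Fin n) : ℂ := if c = d then q else if d < c then q - q⁻¹ else 0

/-- The off-diagonal coefficients of `Ř`. -/
def tOff (c d : Fin n) : ℂ := if c = d then 0 else 1

/-- This identity and the following ones are the hypotheses of the two-term lemmas for Ř, checked
for every relative order of the indices. -/
theorem tDiag_braid {q : ℂ} (hq : q ≠ 0) (x y z : Fin n) :
    tDiag q x y ^ 2 * tDiag q y z + tOff x y * tOff y x * tDiag q x z =
      tDiag q y z ^ 2 * tDiag q x y + tOff y z * tOff z y * tDiag q x z := by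
  unfold tDiag tOff
  split_ifs <;> first | ring1 | (exfalso; order) | (field_simp; ring1)

theorem tDiag_left (q : ℂ) (x y z : Fin n) :
    tOff x y = 0 ∨ tDiag q x y * tDiag q y z + tDiag q x z * tDiag q y x =
      tDiag q y z * tDiag q x z := by
  unfold tDiag tOff
  split_ifs <;> first | (exact Or.inl rfl) | (right; ring1) | (exfalso; order)

theorem tDiag_right (q : ℂ) (x y z : Fin n) :
    tOff y z = 0 ∨ tDiag q x y * tDiag q x z =
      tDiag q y z * tDiag q x y + tDiag q x z * tDiag q z y := by
  unfold tDiag tOff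
  split_ifs <;> first | (exact Or.inl rfl) | (right; ring1) | (exfalso; order)

theorem tDiag_sq {q : ℂ} (hq : q ≠ 0) (x y : Fin n) :
    tDiag q x y * tDiag q x y + tOff x y * tOff y x = (q - q⁻¹) * tDiag q x y + 1 := by
  unfold tDiag tOff
  split_ifs <;> first | ring1 | (exfalso; order) | (field_simp; ring1)

theorem tDiag_add (q : ℂ) (x y : Fin n) :
    tOff x y = 0 ∨ tDiag q x y + tDiag q y x = q - q⁻¹ := by
  unfold tDiag tOff
  split_ifs <;> first | (exact Or.inl rfl) | (right; ring1) | (exfalso; order)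

/-- The matrix `Ř = P R`. -/
def Tmat (n : ℕ) (q : ℂ) : Matrix (Fin n × Fin n) (Fin n × Fin n) ℂ :=
  twoTerm Prod.swap (fun p => tDiag q p.1 p.2) (fun p => tOff p.1 p.2)

theorem Tmat_apply (q : ℂ) (a b c d : Fin n) : Tmat n q (a, b) (c, d) =
    (if a = c ∧ b = d then tDiag q c d else 0) + if a = d ∧ b = c then tOff c d else 0 := by
  simp [Tmat, twoTerm]

theorem flipP_mul_Rfin (q : ℂ) : flipP n * Rfin n q = Tmat n q := by
  ext ⟨a, b⟩ ⟨c, d⟩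
  rw [flipP_mul_apply, Rfin, Matrix.add_apply, Matrix.add_apply, Matrix.smul_apply,
    Matrix.smul_apply, sum_diag_apply, sum_single_diag_apply, sum_single_flip_apply, Tmat_apply,
    tDiag, tOff]
  simp only [smul_eq_mul]
  split_ifs <;> first | ring1 | (exfalso; grind)

/-- The matrix `Ř⁻¹ = Ř - (q - q⁻¹)`, with entries indexed as those of `R`. -/
theorem den_mul_Rbar {q : ℂ} (hq : q ≠ 0) (a b c d : Fin n) :
    (PowerSeries.C q - PowerSeries.C q⁻¹ * PowerSeries.X) * Rbar n q (a, b) (c, d) =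
      PowerSeries.C (Tmat n q (b, a) (c, d)) -
        PowerSeries.X * PowerSeries.C ((Tmat n q - (q - q⁻¹) • 1) (b, a) (c, d)) := by
  have hden : (PowerSeries.C q - PowerSeries.C q⁻¹ * PowerSeries.X) *
      (PowerSeries.C q - PowerSeries.C q⁻¹ * PowerSeries.X : ℂ⟦X⟧)⁻¹ = 1 :=
    PowerSeries.mul_inv_cancel _ (by simpa using hq)
  simp only [Rbar, Matrix.add_apply, Matrix.sub_apply, Matrix.smul_apply, sum_diag_apply,
    sum_single_diag_apply, sum_single_flip_apply, Tmat_apply, Matrix.one_apply, Prod.mk.injEq,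
    smul_eq_mul, tDiag, tOff]
  generalize (PowerSeries.C q - PowerSeries.C q⁻¹ * PowerSeries.X : ℂ⟦X⟧)⁻¹ = w at *
  generalize hv : (PowerSeries.X : ℂ⟦X⟧) = X at *
  simp only [apply_ite (PowerSeries.C : ℂ → ℂ⟦X⟧), map_add, map_sub, map_mul, map_one, map_zero]
  split_ifs <;> first | (exfalso; grind) | linear_combination (0 : ℂ⟦X⟧) |
    linear_combination (1 - X) * hden | linear_combination (PowerSeries.C q - PowerSeries.C q⁻¹) * hden |
    linear_combination (PowerSeries.C q - PowerSeries.C q⁻¹) * X * hden 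

/-- Ř_k sends a basis tensor `I` to a combination of `I` and `I ∘ adjSwap k`, with coefficients
depending only on the two entries involved. It is thus a two-term operator, and the `tDiag`
identities give the relations. -/
theorem isHecke_Rcheck (q : ℂ) (hq : q ≠ 0) (m : ℕ) :
    IsHecke (q - q⁻¹) (Rcheck n q (m := m)) := by
  have hR : ∀ k : Fin (m - 1), Rcheck n q k = twoTerm (fun I : Fin m → Fin n => I ∘ adjSwap k)
      (fun I => tDiag q (I (lo k)) (I (hi k))) (fun I => tOff (I (lo k)) (I (hi k))) := by
    intro k
    ext I J
    rw [Rcheck, flipP_mul_Rfin]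
    change (if ∀ c, c ≠ lo k → c ≠ hi k → I c = J c then
      Tmat n q (I (lo k), I (hi k)) (J (lo k), J (hi k)) else 0) = _
    have e1 : I = J ↔ (∀ c, c ≠ lo k → c ≠ hi k → I c = J c) ∧
        (I (lo k) = J (lo k) ∧ I (hi k) = J (hi k)) := by
      refine ⟨by rintro rfl; simp, fun h => funext fun c => ?_⟩
      by_cases h1 : c = lo k
      · rw [h1]; exact h.2.1
      by_cases h2 : c = hi k
      · rw [h2]; exact h.2.2
      exact h.1 c h1 h2
    have e2 : I = J ∘ adjSwap k ↔ (∀ c, c ≠ lo k → c ≠ hi k → I c = J c) ∧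
        (I (lo k) = J (hi k) ∧ I (hi k) = J (lo k)) := by
      constructor
      · rintro rfl
        refine ⟨fun c h1 h2 => by rw [Function.comp_apply, adjSwap_of_ne h1 h2], by simp, by simp⟩
      · refine fun h => funext fun c => ?_
        by_cases h1 : c = lo k
        · rw [h1]; simpa using h.2.1
        by_cases h2 : c = hi k
        · rw [h2]; simpa using h.2.2
        rw [Function.comp_apply, adjSwap_of_ne h1 h2]
        exact h.1 c h1 h2
    simp only [twoTerm, Matrix.of_apply, e1, e2, Tmat_apply]
    by_cases hc : ∀ c, c ≠ lo k → c ≠ hi k → I c = J c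
    · rw [if_pos hc]
      simp only [and_iff_right hc]
    · rw [if_neg hc, if_neg fun h => hc h.1, if_neg fun h => hc h.1, add_zero]
  have hinv : ∀ (k : Fin (m - 1)) (I : Fin m → Fin n), (I ∘ adjSwap k) ∘ adjSwap k = I := by
    intro k I; ext c; simp
  refine ⟨⟨fun i j hij => ?_, fun i j hij => ?_⟩, fun k => ?_⟩
  · rw [hR, hR]
    have n1 : adjSwap i (lo j) = lo j :=
      adjSwap_of_ne (by simp [lo, Fin.ext_iff]; omega) (by simp [lo, hi, Fin.ext_iff]; omega)
    have n2 : adjSwap i (hi j) = hi j :=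
      adjSwap_of_ne (by simp [lo, hi, Fin.ext_iff]; omega) (by simp [hi, Fin.ext_iff]; omega)
    have n3 : adjSwap j (lo i) = lo i :=
      adjSwap_of_ne (by simp [lo, Fin.ext_iff]; omega) (by simp [lo, hi, Fin.ext_iff]; omega)
    have n4 : adjSwap j (hi i) = hi i :=
      adjSwap_of_ne (by simp [lo, hi, Fin.ext_iff]; omega) (by simp [hi, Fin.ext_iff]; omega)
    refine matrix_ext_single fun F => twoTerm_comm_at ?_ ?_ ?_ ?_ ?_
    · have := congrArg (fun g : Equiv.Perm (Fin m) => F ∘ g) (isBraid_adjSwap.comm i j hij)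
      simpa [Function.comp_assoc] using this.symm
    all_goals simp [n1, n2, n3, n4]
  · rw [hR, hR]
    have hlj : lo j = hi i := by simp [lo, hi, hij]
    have n2 : adjSwap i (hi j) = hi j :=
      adjSwap_of_ne (by simp [lo, hi, Fin.ext_iff]; omega) (by simp [hi, Fin.ext_iff]; omega)
    have n3 : adjSwap j (lo i) = lo i :=
      adjSwap_of_ne (by simp [lo, Fin.ext_iff]; omega) (by simp [lo, hi, Fin.ext_iff]; omega)
    have n5 : adjSwap j (hi i) = hi j := by rw [← hlj, adjSwap_lo]
    refine matrix_ext_single fun F => twoTerm_braid_at (hinv _ _) (hinv _ _) ?_ ?_ ?_ ?_ ?_ ?_ ?_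
      ?_ ?_ ?_
    · have := congrArg (fun g : Equiv.Perm (Fin m) => F ∘ g) (isBraid_adjSwap.braid i j hij)
      simpa [Function.comp_assoc] using this
    all_goals
      simp only [Function.comp_apply, hlj, n2, n3, n5, adjSwap_lo, adjSwap_hi]
    · exact tDiag_braid hq _ _ _
    · exact tDiag_left _ _ _ _
    · exact tDiag_right _ _ _ _
  · rw [hR]
    refine matrix_ext_single fun F => twoTerm_sq_at (hinv _ _) ?_ ?_
    all_goals
      simp only [Function.comp_apply, adjSwap_lo, adjSwap_hi]
    · exact tDiag_sq hq _ _
    · exact tDiag_add _ _ _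

end RMatrix

/-! ### Standard tableaux: contents and swaps of entries. -/

section Tableaux

variable {μ : YoungDiagram}

/-- Go along the row of `k` to the column of `l`, then down that column. The corner box belongs to
the diagram because it lies below box `l` in the product order. -/
theorem StdTableau.lt_of_box_le (Λ : StdTableau μ) {k l : Fin μ.card}
    (h : (Λ.box k).1 ≤ (Λ.box l).1) (hkl : k ≠ l) : k < l := by
  have hmem : ((Λ.box k).1.1, (Λ.box l).1.2) ∈ μ.cells :=
    μ.isLowerSet (show ((Λ.box k).1.1, (Λ.box l).1.2) ≤ (Λ.box l).1 from ⟨h.1, le_rfl⟩) (Λ.box l).2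
  obtain ⟨p, hp⟩ := Λ.box.surjective ⟨_, hmem⟩
  have hp1 : (Λ.box p).1.1 = (Λ.box k).1.1 := by rw [hp]
  have hp2 : (Λ.box p).1.2 = (Λ.box l).1.2 := by rw [hp]
  have h1 : k ≤ p := by
    rcases (h.2 : (Λ.box k).1.2 ≤ (Λ.box l).1.2).lt_or_eq with h' | h'
    · exact (Λ.row_lt k p hp1.symm (hp2 ▸ h')).le
    · refine le_of_eq (Λ.box.injective (Subtype.ext (Prod.ext hp1.symm (h'.trans hp2.symm))))
  have h2 : p ≤ l := by
    rcases (h.1 : (Λ.box k).1.1 ≤ (Λ.box l).1.1).lt_or_eq with h' | h'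
    · exact (Λ.col_lt p l hp2 (hp1 ▸ h')).le
    · refine le_of_eq (Λ.box.injective (Subtype.ext (Prod.ext (hp1.trans h') hp2)))
  exact lt_of_le_of_ne (h1.trans h2) hkl

theorem StdTableau.exists_between (Λ : StdTableau μ) {k l : Fin μ.card} {γ : ℕ × ℕ}
    (h1 : (Λ.box k).1 ≤ γ) (h2 : γ ≤ (Λ.box l).1) (h1' : (Λ.box k).1 ≠ γ)
    (h2' : γ ≠ (Λ.box l).1) : ∃ p, k < p ∧ p < l ∧ (Λ.box p).1 = γ := by
  obtain ⟨p, hp⟩ := Λ.box.surjective ⟨γ, μ.isLowerSet h2 (Λ.box l).2⟩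
  have hp' : (Λ.box p).1 = γ := by rw [hp]
  subst hp'
  exact ⟨p, Λ.lt_of_box_le h1 (by rintro rfl; exact h1' rfl),
    Λ.lt_of_box_le h2 (by rintro rfl; exact h2' rfl), rfl⟩

/-- The content of a box. -/
def boxContent (α : μ.cells) : ℤ := (α.1.2 : ℤ) - (α.1.1 : ℤ)

theorem StdTableau.content_eq (Λ : StdTableau μ) (k : Fin μ.card) :
    Λ.content k = boxContent (Λ.box k) := rfl

/-- Of two incomparable boxes one is strictly lower and strictly further left, so their contents
differ by at least two. -/
theorem box_le_or_le {α β : μ.cells} (h : |boxContent α - boxContent β| ≤ 1) :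
    α.1 ≤ β.1 ∨ β.1 ≤ α.1 := by
  obtain ⟨h1, h2⟩ := abs_le.1 h
  simp only [boxContent] at h1 h2
  simp only [Prod.le_def]
  omega

theorem StdTableau.box_le_of_content (Λ : StdTableau μ) {k l : Fin μ.card} (hkl : k < l)
    (h : |Λ.content k - Λ.content l| ≤ 1) : (Λ.box k).1 ≤ (Λ.box l).1 := by
  rcases box_le_or_le h with h | h
  · exact h
  · exact absurd (Λ.lt_of_box_le h hkl.ne') hkl.le.not_gt

/-- On one diagonal the box of `l` lies strictly southeast of the box of `k`, so the neighbours of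
the latter to the right and below carry two distinct intermediate entries. This excludes equal
contents for entries at distance one or two, which keeps the denominators in Young's form nonzero.
-/
theorem StdTableau.exists_between_of_content_eq (Λ : StdTableau μ) {k l : Fin μ.card} (hkl : k < l)
    (h : Λ.content k = Λ.content l) :
    ∃ p p', p ≠ p' ∧ (k < p ∧ p < l) ∧ (k < p' ∧ p' < l) := by
  have hle := Λ.box_le_of_content hkl (by simp [h])
  have hne : (Λ.box k).1 ≠ (Λ.box l).1 := fun e => hkl.ne (Λ.box.injective (Subtype.ext e))
  simp only [StdTableau.content_eq, boxContent] at h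
  have hlt : (Λ.box k).1.1 < (Λ.box l).1.1 ∧ (Λ.box k).1.2 < (Λ.box l).1.2 := by
    rw [Prod.le_def] at hle
    rw [Ne, Prod.ext_iff] at hne
    omega
  obtain ⟨p, hp1, hp2, hp⟩ := Λ.exists_between (k := k) (l := l)
    (γ := ((Λ.box k).1.1 + 1, (Λ.box k).1.2))
    ⟨by simp, by simp⟩ ⟨hlt.1, hlt.2.le⟩ (fun e => by simpa using congrArg Prod.fst e)
    (fun e => hlt.2.ne (by rw [← e]))
  obtain ⟨p', hp1', hp2', hp'⟩ := Λ.exists_between (k := k) (l := l)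
    (γ := ((Λ.box k).1.1, (Λ.box k).1.2 + 1))
    ⟨by simp, by simp⟩ ⟨hlt.1.le, hlt.2⟩ (fun e => by simpa using congrArg Prod.snd e)
    (fun e => hlt.1.ne (by rw [← e]))
  refine ⟨p, p', ?_, ⟨hp1, hp2⟩, ⟨hp1', hp2'⟩⟩
  rintro rfl
  rw [hp] at hp'
  simpa using congrArg Prod.fst hp'

theorem StdTableau.d_eq (Λ : StdTableau μ) (k : Fin (μ.card - 1)) :
    Λ.d k = boxContent (Λ.box (hi k)) - boxContent (Λ.box (lo k)) := rfl

theorem StdTableau.d_ne_zero (Λ : StdTableau μ) (k : Fin (μ.card - 1)) : Λ.d k ≠ 0 := by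
  intro h
  obtain ⟨p, -, -, ⟨h1, h2⟩, -⟩ := Λ.exists_between_of_content_eq (lo_lt_hi k)
    (sub_eq_zero.1 h).symm
  simp only [lo, hi, Fin.lt_def] at h1 h2
  omega

theorem StdTableau.d_add_d_ne_zero (Λ : StdTableau μ) {i j : Fin (μ.card - 1)}
    (hij : j.1 = i.1 + 1) : Λ.d i + Λ.d j ≠ 0 := by
  intro h
  have hlj : lo j = hi i := by simp [lo, hi, hij]
  rw [Λ.d_eq, Λ.d_eq, hlj] at h
  obtain ⟨p, p', hp, ⟨h1, h2⟩, ⟨h3, h4⟩⟩ := Λ.exists_between_of_content_eq (k := lo i) (l := hi j)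
    (by simp [lo, hi, Fin.lt_def]; omega) (by simp only [StdTableau.content_eq]; linarith)
  simp only [lo, hi, Fin.lt_def] at h1 h2 h3 h4
  apply hp
  ext
  omega

/-- Induct on the entry `k`. Its boxes in the two tableaux lie on one diagonal and are comparable.
If they differ, the smaller one carries in the other tableau an entry `p < k`; by induction `p`
occupies the same box in the first tableau, where `k` already sits. -/
theorem StdTableau.content_injective {Λ Γ : StdTableau μ}
    (h : ∀ k, Λ.content k = Γ.content k) : Λ = Γ := by
  apply StdTableau.box_injective
  have key : ∀ N : ℕ, ∀ k : Fin μ.card, k.1 = N → Λ.box k = Γ.box k := by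
    intro N
    induction N using Nat.strong_induction_on with
    | _ N ih =>
      rintro k rfl
      have aux : ∀ (Λ Γ : StdTableau μ), (∀ k, Λ.content k = Γ.content k) →
          (∀ l, l < k → Λ.box l = Γ.box l) → (Λ.box k).1 ≤ (Γ.box k).1 → Λ.box k = Γ.box k := by
        intro Λ Γ h ih hle
        by_contra hne
        obtain ⟨p, hp⟩ := Γ.box.surjective (Λ.box k)
        have hpk : p ≠ k := by
          rintro rfl
          exact hne hp.symm
        have hlt : p < k := Γ.lt_of_box_le (by rw [hp]; exact hle) hpk
        have := ih p hlt
        rw [hp] at this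
        exact hpk (Λ.box.injective this)
      have hc : boxContent (Λ.box k) = boxContent (Γ.box k) := h k
      rcases box_le_or_le (α := Λ.box k) (β := Γ.box k) (by simp [hc]) with hle | hle
      · exact aux Λ Γ h (fun l hl => ih l.1 hl l rfl) hle
      · exact (aux Γ Λ (fun k => (h k).symm) (fun l hl => (ih l.1 hl l rfl).symm) hle).symm
  ext1 k
  exact key k.1 k rfl

/-- The result of swapping the entries `k` and `k + 1`, if it is standard. -/
theorem StdTableau.exists_swap (Λ : StdTableau μ) (k : Fin (μ.card - 1))
    (h : Λ.d k ≠ 1 ∧ Λ.d k ≠ -1) : ∃ Γ : StdTableau μ, Γ.box = (adjSwap k).trans Λ.box := by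
  -- No entry fits between `k` and `k + 1`, so in a common row they would be neighbours with `d =
  -- 1`. In the same way `hcol` uses `d ≠ -1`.
  have hrow : (Λ.box (lo k)).1.1 ≠ (Λ.box (hi k)).1.1 := by
    intro e
    have hne : (Λ.box (lo k)).1.2 ≠ (Λ.box (hi k)).1.2 := fun e' =>
      lo_ne_hi k (Λ.box.injective (Subtype.ext (Prod.ext e e')))
    have hlt : (Λ.box (lo k)).1.2 < (Λ.box (hi k)).1.2 := by
      refine lt_of_le_of_ne (not_lt.1 fun hgt => ?_) hne
      exact (lo_lt_hi k).le.not_gt (Λ.row_lt _ _ e.symm hgt)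
    have h1 := h.1
    rw [Λ.d_eq] at h1
    simp only [boxContent, e] at h1
    obtain ⟨p, h1, h2, -⟩ := Λ.exists_between (k := lo k) (l := hi k)
      (γ := ((Λ.box (lo k)).1.1, (Λ.box (lo k)).1.2 + 1))
      ⟨le_rfl, by simp⟩ ⟨e.le, hlt⟩ (fun e' => by simpa using congrArg Prod.snd e')
      (fun e' => by have := congrArg Prod.snd e'; simp only at this; omega)
    simp only [lo, hi, Fin.lt_def] at h1 h2
    omega
  have hcol : (Λ.box (lo k)).1.2 ≠ (Λ.box (hi k)).1.2 := by
    intro e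
    have hlt : (Λ.box (lo k)).1.1 < (Λ.box (hi k)).1.1 := by
      refine lt_of_le_of_ne (not_lt.1 fun hgt => ?_) hrow
      exact (lo_lt_hi k).le.not_gt (Λ.col_lt _ _ e.symm hgt)
    have h1 := h.2
    rw [Λ.d_eq] at h1
    simp only [boxContent, e] at h1
    obtain ⟨p, h1, h2, -⟩ := Λ.exists_between (k := lo k) (l := hi k)
      (γ := ((Λ.box (lo k)).1.1 + 1, (Λ.box (lo k)).1.2))
      ⟨by simp, le_rfl⟩ ⟨hlt, e.le⟩ (fun e' => by simpa using congrArg Prod.fst e')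
      (fun e' => by have := congrArg Prod.fst e'; simp only at this; omega)
    simp only [lo, hi, Fin.lt_def] at h1 h2
    omega
  have aux : ∀ a b, adjSwap k a < adjSwap k b →
      ¬ (adjSwap k a = lo k ∧ adjSwap k b = hi k) → a < b := by
    intro a b hab hk
    simpa using adjSwap_lt hab hk
  refine ⟨⟨(adjSwap k).trans Λ.box, fun a b h1 h2 => ?_, fun a b h1 h2 => ?_⟩, rfl⟩
  · exact aux a b (Λ.row_lt _ _ h1 h2) fun ⟨ha, hb⟩ => hrow (by
      simp only [Equiv.trans_apply, ha, hb] at h1; exact h1)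
  · exact aux a b (Λ.col_lt _ _ h1 h2) fun ⟨ha, hb⟩ => hcol (by
      simp only [Equiv.trans_apply, ha, hb] at h1; exact h1)

theorem StdTableau.d_swap {Λ Γ : StdTableau μ} {k : Fin (μ.card - 1)}
    (h : Γ.box = (adjSwap k).trans Λ.box) : Γ.d k = -Λ.d k := by
  simp [StdTableau.d_eq, h]

/-- For `d = ±1` the boxes of `k` and `k + 1` are comparable, which fixes the order of their entries
in every standard tableau. -/
theorem StdTableau.d_of_swap {Λ Γ : StdTableau μ} {k : Fin (μ.card - 1)}
    (h : Γ.box = (adjSwap k).trans Λ.box) : Λ.d k ≠ 1 ∧ Λ.d k ≠ -1 := by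
  rw [← not_or]
  intro hd
  have hle := Λ.box_le_of_content (lo_lt_hi k) (by
    have h1 := Λ.d_eq k
    rw [Λ.content_eq, Λ.content_eq, abs_le]
    omega)
  have : hi k < lo k := Γ.lt_of_box_le (by simpa [h] using hle) (lo_ne_hi k).symm
  exact (lo_lt_hi k).le.not_gt this

/-- Swaps connect all standard tableaux of a shape: the permutation carrying `Λ` to `Γ` is sorted by
removing descents. -/
theorem StdTableau.swap_induction {P : StdTableau μ → Prop} (Λ : StdTableau μ) (h0 : P Λ)
    (h : ∀ (Λ Γ : StdTableau μ) (k : Fin (μ.card - 1)), Γ.box = (adjSwap k).trans Λ.box →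
      P Λ → P Γ) (Γ : StdTableau μ) : P Γ := by
  induction hN : invCount (Λ.box.trans Γ.box.symm) using Nat.strong_induction_on generalizing Λ with
  | _ N ih =>
    by_cases h1 : (Λ.box.trans Γ.box.symm : Equiv.Perm (Fin μ.card)) = 1
    · have : Λ = Γ := by
        apply StdTableau.box_injective
        ext1 k
        have := DFunLike.congr_fun h1 k
        simpa [Equiv.symm_apply_eq] using this
      exact this ▸ h0
    · obtain ⟨k, hk⟩ := exists_descent h1
      -- At a descent, `Γ` holds the boxes of `k` and `k + 1` in the opposite order, which
      -- comparable boxes would forbid.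
      obtain ⟨Λ', hΛ'⟩ := Λ.exists_swap k (by
        rw [← not_or]
        intro hd
        have hle := Λ.box_le_of_content (lo_lt_hi k) (by
          have h1 := Λ.d_eq k
          rw [Λ.content_eq, Λ.content_eq, abs_le]
          omega)
        have := Γ.lt_of_box_le (k := Γ.box.symm (Λ.box (lo k))) (l := Γ.box.symm (Λ.box (hi k)))
          (by simpa using hle) (by simpa using lo_ne_hi k)
        exact this.le.not_gt hk)
      have e : (Λ'.box.trans Γ.box.symm : Equiv.Perm (Fin μ.card)) =
          (Λ.box.trans Γ.box.symm : Equiv.Perm (Fin μ.card)) * adjSwap k := by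
        rw [hΛ']; rfl
      have := invCount_mul_adjSwap_of_gt hk
      exact ih (invCount (Λ'.box.trans Γ.box.symm)) (by rw [e]; omega) Λ' (h Λ Λ' k hΛ' h0) rfl

end Tableaux

/-! ### Young's orthonormal form: Hecke relations and Schur's lemma. -/

section YoungForm

variable {q : ℂ}

theorem zpow_ne_one (hq0 : q ≠ 0) (hq : ∀ k : ℕ, 0 < k → q ^ k ≠ 1) {a : ℤ} (ha : a ≠ 0) :
    q ^ a ≠ 1 := by
  intro h
  rcases lt_or_gt_of_ne ha with h' | h'
  · refine hq a.natAbs (by omega) ?_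
    rw [← zpow_natCast, Int.ofNat_natAbs_of_nonpos h'.le, zpow_neg, h, inv_one]
  · refine hq a.natAbs (by omega) ?_
    rw [← zpow_natCast, Int.natAbs_of_nonneg h'.le, h]

theorem sub_inv_ne_zero (hq0 : q ≠ 0) (hq : ∀ k : ℕ, 0 < k → q ^ k ≠ 1) : q - q⁻¹ ≠ 0 := by
  intro h
  refine hq 2 two_pos ?_
  field_simp at h
  linear_combination h

/-- The diagonal coefficient of Young's form. -/
def yDiag (q : ℂ) (d : ℤ) : ℂ := q ^ d / qNum q d

/-- The off-diagonal coefficient of Young's form. -/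
def yOff (q : ℂ) (d : ℤ) : ℂ := (1 - 1 / qNum q d ^ 2) ^ (1 / 2 : ℂ)

theorem qNum_neg (q : ℂ) (d : ℤ) : qNum q (-d) = -qNum q d := by
  simp only [qNum, neg_neg]; ring

/-- The two tableaux of a swap have opposite `d` and so receive the same square root. Apart from
this, only the square of the root is ever used. -/
theorem yOff_neg (q : ℂ) (d : ℤ) : yOff q (-d) = yOff q d := by simp [yOff, qNum_neg]

theorem yOff_mul_self (q : ℂ) (d : ℤ) : yOff q d * yOff q d = 1 - 1 / qNum q d ^ 2 := by
  have := Complex.cpow_nat_inv_pow (1 - 1 / qNum q d ^ 2) two_ne_zero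
  rw [← sq, yOff, one_div (2 : ℂ)]
  exact_mod_cast this

theorem qNum_one (h : q - q⁻¹ ≠ 0) : qNum q 1 = 1 := by simp [qNum, h]

theorem yOff_one (h : q - q⁻¹ ≠ 0) {d : ℤ} (hd : d = 1 ∨ d = -1) : yOff q d = 0 := by
  rcases hd with rfl | rfl
  · simp [yOff, qNum_one h]
  · rw [yOff_neg]; simp [yOff, qNum_one h]

theorem qNum_eq (hq0 : q ≠ 0) (d : ℤ) :
    qNum q d = ((q ^ d) ^ 2 - 1) / (q ^ d * (q - q⁻¹)) := by
  have := zpow_ne_zero d hq0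
  rw [qNum, zpow_neg, ← div_div]
  congr 1
  field_simp

theorem qsq_ne_one (hq0 : q ≠ 0) (hq : ∀ k : ℕ, 0 < k → q ^ k ≠ 1) {d : ℤ} (hd : d ≠ 0) :
    (q ^ d) ^ 2 - 1 ≠ 0 := by
  rw [sq, ← zpow_add₀ hq0, sub_ne_zero]
  exact zpow_ne_one hq0 hq (by omega)

theorem yOff_ne_zero (hq0 : q ≠ 0) (hq : ∀ k : ℕ, 0 < k → q ^ k ≠ 1) {d : ℤ} (h0 : d ≠ 0)
    (h1 : d ≠ 1) (h2 : d ≠ -1) : yOff q d ≠ 0 := by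
  intro h
  have h3 := yOff_mul_self q d
  have hh := sub_inv_ne_zero hq0 hq
  have hd := qsq_ne_one hq0 hq h0
  rw [h, zero_mul, qNum_eq hq0] at h3
  have hp := zpow_ne_zero d hq0
  have e1 := zpow_ne_one hq0 hq (a := 2 * (d - 1)) (by omega)
  have e2 := zpow_ne_one hq0 hq (a := 2 * (d + 1)) (by omega)
  rw [mul_sub, zpow_sub₀ hq0, two_mul, zpow_add₀ hq0] at e1
  rw [mul_add, zpow_add₀ hq0, two_mul, zpow_add₀ hq0] at e2
  generalize q ^ d = Q at *
  -- Vanishing of the root means `[d]_q² = 1`, that is `q^{2d} = q²` or `q^{2d} = q⁻²`; both are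
  -- excluded for `d ≠ ±1`.
  have key : (Q * Q - q ^ 2) * (Q * Q * q ^ 2 - 1) = 0 := by
    field_simp at h3
    linear_combination -h3
  rcases mul_eq_zero.1 key with h | h
  · apply e1
    have : (q : ℂ) ^ (2 * 1 : ℤ) = q ^ 2 := by norm_cast
    rw [this, div_eq_one_iff_eq (pow_ne_zero 2 hq0)]
    linear_combination h
  · apply e2
    have : (q : ℂ) ^ (2 * 1 : ℤ) = q ^ 2 := by norm_cast
    rw [this]
    linear_combination h

theorem yDiag_eq (hq0 : q ≠ 0) (d : ℤ) :
    yDiag q d = (q - q⁻¹) * ((q ^ d) ^ 2) / ((q ^ d) ^ 2 - 1) := by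
  have := zpow_ne_zero d hq0
  rw [yDiag, qNum_eq hq0, div_div_eq_mul_div]
  ring

theorem yDiag_sq (hq0 : q ≠ 0) (hq : ∀ k : ℕ, 0 < k → q ^ k ≠ 1) {d : ℤ} (hd : d ≠ 0) :
    yDiag q d * yDiag q d + yOff q d * yOff q (-d) = (q - q⁻¹) * yDiag q d + 1 := by
  have h1 := qsq_ne_one hq0 hq hd
  have h2 := zpow_ne_zero d hq0
  rw [yOff_neg, yOff_mul_self, qNum_eq hq0, yDiag_eq hq0]
  generalize q - q⁻¹ = h at *
  generalize q ^ d = Q at *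
  field_simp
  ring

theorem yDiag_neg (hq0 : q ≠ 0) (hq : ∀ k : ℕ, 0 < k → q ^ k ≠ 1) {d : ℤ} (hd : d ≠ 0) :
    yDiag q (-d) = -(q - q⁻¹) / ((q ^ d) ^ 2 - 1) := by
  have h1 := qsq_ne_one hq0 hq hd
  have h1' := qsq_ne_one hq0 hq (neg_ne_zero.2 hd)
  have h2 := zpow_ne_zero d hq0
  rw [yDiag_eq hq0, div_eq_div_iff h1' h1, zpow_neg]
  field_simp
  ring

theorem yDiag_add (hq0 : q ≠ 0) (hq : ∀ k : ℕ, 0 < k → q ^ k ≠ 1) {d : ℤ} (hd : d ≠ 0) : yDiag q d + yDiag q (-d) = q - q⁻¹ := by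
  have h1 := qsq_ne_one hq0 hq hd
  rw [yDiag_eq hq0, yDiag_neg hq0 hq hd]
  generalize q - q⁻¹ = h at *
  field_simp
  ring

/-- Together with `yDiag_right` and `yDiag_braid` these are the coefficient conditions of
`twoTerm_braid_at` for three entries with successive content differences `d` and `e`, the outer pair
having difference `d + e`. By `yDiag_eq` they are rational identities in `q^d` and `q^e`. -/
theorem yDiag_left (hq0 : q ≠ 0) (hq : ∀ k : ℕ, 0 < k → q ^ k ≠ 1) {d e : ℤ} (hd : d ≠ 0) (he : e ≠ 0) (hde : d + e ≠ 0) :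
    yDiag q d * yDiag q e + yDiag q (d + e) * yDiag q (-d) = yDiag q e * yDiag q (d + e) := by
  have h1 := qsq_ne_one hq0 hq hd
  have h2 := qsq_ne_one hq0 hq he
  have h3 := qsq_ne_one hq0 hq hde
  rw [yDiag_neg hq0 hq hd, yDiag_eq hq0, yDiag_eq hq0, yDiag_eq hq0]
  rw [zpow_add₀ hq0] at *
  generalize q - q⁻¹ = h at *
  generalize q ^ d = Q at *
  generalize q ^ e = P at *
  rw [mul_pow] at *
  field_simp
  ring

theorem yDiag_right (hq0 : q ≠ 0) (hq : ∀ k : ℕ, 0 < k → q ^ k ≠ 1) {d e : ℤ} (hd : d ≠ 0) (he : e ≠ 0) (hde : d + e ≠ 0) :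
    yDiag q d * yDiag q (d + e) = yDiag q e * yDiag q d + yDiag q (d + e) * yDiag q (-e) := by
  have h1 := qsq_ne_one hq0 hq hd
  have h2 := qsq_ne_one hq0 hq he
  have h3 := qsq_ne_one hq0 hq hde
  rw [yDiag_neg hq0 hq he, yDiag_eq hq0, yDiag_eq hq0, yDiag_eq hq0]
  rw [zpow_add₀ hq0] at *
  generalize q - q⁻¹ = h at *
  generalize q ^ d = Q at *
  generalize q ^ e = P at *
  rw [mul_pow] at *
  field_simp
  ring

theorem yDiag_braid (hq0 : q ≠ 0) (hq : ∀ k : ℕ, 0 < k → q ^ k ≠ 1) {d e : ℤ} (hd : d ≠ 0) (he : e ≠ 0) (hde : d + e ≠ 0) :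
    yDiag q d ^ 2 * yDiag q e + yOff q d * yOff q (-d) * yDiag q (d + e) =
      yDiag q e ^ 2 * yDiag q d + yOff q e * yOff q (-e) * yDiag q (d + e) := by
  have h1 := qsq_ne_one hq0 hq hd
  have h2 := qsq_ne_one hq0 hq he
  have h3 := qsq_ne_one hq0 hq hde
  rw [yOff_neg, yOff_neg, yOff_mul_self, yOff_mul_self, qNum_eq hq0, qNum_eq hq0, yDiag_eq hq0,
    yDiag_eq hq0, yDiag_eq hq0]
  rw [zpow_add₀ hq0] at *
  have h4 := zpow_ne_zero d hq0
  have h5 := zpow_ne_zero e hq0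
  generalize q - q⁻¹ = h at *
  generalize q ^ d = Q at *
  generalize q ^ e = P at *
  rw [mul_pow] at *
  field_simp
  ring

variable {μ : YoungDiagram}

open Classical in
/-- Young's form on arbitrary fillings. -/
def fullYoung (q : ℂ) (μ : YoungDiagram) (k : Fin (μ.card - 1)) :
    Matrix (Fin μ.card ≃ μ.cells) (Fin μ.card ≃ μ.cells) ℂ :=
  twoTerm (fun F => (adjSwap k).trans F)
    (fun F => yDiag q (boxContent (F (hi k)) - boxContent (F (lo k))))
    (fun F => yOff q (boxContent (F (hi k)) - boxContent (F (lo k))))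

open Classical in
/-- The inclusion of the standard tableaux into the fillings. -/
def stdIncl (μ : YoungDiagram) : Matrix (Fin μ.card ≃ μ.cells) (StdTableau μ) ℂ :=
  Matrix.of fun F Λ => if F = Λ.box then 1 else 0

open Classical in
theorem stdIncl_transpose_mul (μ : YoungDiagram) : (stdIncl μ).transpose * stdIncl μ = 1 := by
  ext Λ Γ
  simp [Matrix.mul_apply, stdIncl, Matrix.one_apply, StdTableau.box_injective.eq_iff, eq_comm]

open Classical in
theorem mul_stdIncl_ext {M N : Matrix (Fin μ.card ≃ μ.cells) (Fin μ.card ≃ μ.cells) ℂ}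
    (h : ∀ Λ : StdTableau μ, M.mulVec (Pi.single Λ.box 1) = N.mulVec (Pi.single Λ.box 1)) :
    M * stdIncl μ = N * stdIncl μ := by
  refine matrix_ext_single fun Λ => ?_
  have e : (stdIncl μ).mulVec (Pi.single Λ 1) = Pi.single Λ.box 1 := by
    ext F
    simp [stdIncl, Pi.single_apply]
  rw [← Matrix.mulVec_mulVec, ← Matrix.mulVec_mulVec, e, h]

theorem swap_box_ne (F : Fin μ.card ≃ μ.cells) (k : Fin (μ.card - 1)) :
    (adjSwap k).trans F ≠ F := by
  intro h
  have := DFunLike.congr_fun h (lo k)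
  simp only [Equiv.trans_apply, adjSwap_lo, F.injective.eq_iff] at this
  exact lo_ne_hi k this.symm

open Classical in
theorem youngMatrix_apply (Γ Λ : StdTableau μ) (k : Fin (μ.card - 1)) :
    youngMatrix q μ k Γ Λ = (if Γ = Λ then yDiag q (Λ.d k) else 0) +
      if Γ.box = (adjSwap k).trans Λ.box then yOff q (Λ.d k) else 0 := by
  by_cases h : Γ = Λ
  · subst h
    rw [if_neg (swap_box_ne _ k).symm]
    simp [youngMatrix, yDiag]
  · simp [youngMatrix, h, yOff]

-- The span of the standard tableaux is stable: a swap leaves it only when `d = ±1`, and there the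
-- off-diagonal coefficient vanishes.
open Classical in
theorem fullYoung_mul_stdIncl (h : q - q⁻¹ ≠ 0) (k : Fin (μ.card - 1)) :
    fullYoung q μ k * stdIncl μ = stdIncl μ * youngMatrix q μ k := by
  ext F Λ
  have h1 : (fullYoung q μ k * stdIncl μ) F Λ = fullYoung q μ k F Λ.box := by
    simp [Matrix.mul_apply, stdIncl]
  rw [h1]
  by_cases hF : ∃ Γ : StdTableau μ, F = Γ.box
  · obtain ⟨Γ, rfl⟩ := hF
    have h2 : (stdIncl μ * youngMatrix q μ k) Γ.box Λ = youngMatrix q μ k Γ Λ := by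
      simp [Matrix.mul_apply, stdIncl, StdTableau.box_injective.eq_iff]
    rw [h2, youngMatrix_apply]
    simp [fullYoung, twoTerm, StdTableau.box_injective.eq_iff, StdTableau.d_eq]
  · have h2 : (stdIncl μ * youngMatrix q μ k) F Λ = 0 := by
      rw [Matrix.mul_apply]
      refine Finset.sum_eq_zero fun Γ _ => ?_
      simp [stdIncl, not_exists.1 hF Γ]
    rw [h2]
    have h3 : ¬ F = Λ.box := not_exists.1 hF Λ
    by_cases h4 : F = (adjSwap k).trans Λ.box
    · have h5 : Λ.d k = 1 ∨ Λ.d k = -1 := by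
        by_contra hd
        rw [not_or] at hd
        obtain ⟨Γ, hΓ⟩ := Λ.exists_swap k hd
        exact hF ⟨Γ, h4.trans hΓ.symm⟩
      have h6 := yOff_one h h5
      rw [Λ.d_eq] at h6
      simp [fullYoung, twoTerm, h3, h6]
    · simp [fullYoung, twoTerm, h3, h4]

theorem swap_swap_box (F : Fin μ.card ≃ μ.cells) (k : Fin (μ.card - 1)) :
    (adjSwap k).trans ((adjSwap k).trans F) = F := by
  ext1 a; simp

/-- On arbitrary fillings the swaps are always defined, so the two-term lemmas apply. They are used
only at standard tableaux, where no denominator vanishes, and the relations are carried back along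
the injective `stdIncl`. -/
theorem isHecke_youngMatrix (hq0 : q ≠ 0) (hq : ∀ k : ℕ, 0 < k → q ^ k ≠ 1) (μ : YoungDiagram) :
    IsHecke (q - q⁻¹) (youngMatrix q μ) := by
  classical
  have hh := sub_inv_ne_zero hq0 hq
  have hι := fullYoung_mul_stdIncl (μ := μ) hh
  have cancel : ∀ M N : Matrix (StdTableau μ) (StdTableau μ) ℂ,
      stdIncl μ * M = stdIncl μ * N → M = N := by
    intro M N h
    rw [← Matrix.one_mul M, ← stdIncl_transpose_mul, Matrix.mul_assoc, h, ← Matrix.mul_assoc,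
      stdIncl_transpose_mul, Matrix.one_mul]
  have h2 : ∀ i j, stdIncl μ * (youngMatrix q μ i * youngMatrix q μ j) =
      fullYoung q μ i * fullYoung q μ j * stdIncl μ := by
    intro i j
    rw [← Matrix.mul_assoc, ← hι, Matrix.mul_assoc, ← hι, ← Matrix.mul_assoc]
  have h3 : ∀ i j k, stdIncl μ * (youngMatrix q μ i * youngMatrix q μ j * youngMatrix q μ k) =
      fullYoung q μ i * fullYoung q μ j * fullYoung q μ k * stdIncl μ := by
    intro i j k
    rw [← Matrix.mul_assoc, h2, Matrix.mul_assoc, ← hι, ← Matrix.mul_assoc]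
  refine ⟨⟨fun i j hij => cancel _ _ ?_, fun i j hij => cancel _ _ ?_⟩, fun k => cancel _ _ ?_⟩
  · rw [h2, h2]
    refine mul_stdIncl_ext fun Λ => twoTerm_comm_at ?_ ?_ ?_ ?_ ?_
    · have := congrArg (fun g : Equiv.Perm (Fin μ.card) => g.trans Λ.box)
        (isBraid_adjSwap.comm i j hij)
      exact this.symm
    all_goals
      simp only [Equiv.trans_apply]
      congr 1
      congr 1 <;> congr 2 <;> apply adjSwap_of_ne <;> simp [lo, hi, Fin.ext_iff] <;> omega
  · have hlj : lo j = hi i := by simp [lo, hi, hij]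
    have n2 : adjSwap i (hi j) = hi j :=
      adjSwap_of_ne (by simp [lo, hi, Fin.ext_iff]; omega) (by simp [hi, Fin.ext_iff]; omega)
    have n3 : adjSwap j (lo i) = lo i :=
      adjSwap_of_ne (by simp [lo, Fin.ext_iff]; omega) (by simp [lo, hi, Fin.ext_iff]; omega)
    have n5 : adjSwap j (hi i) = hi j := by rw [← hlj, adjSwap_lo]
    rw [h3, h3]
    refine mul_stdIncl_ext fun Λ => ?_
    have hd := Λ.d_ne_zero i
    have he := Λ.d_ne_zero j
    have hde := Λ.d_add_d_ne_zero hij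
    simp only [Λ.d_eq, hlj] at hd he hde
    have e1 : boxContent (Λ.box (lo i)) - boxContent (Λ.box (hi i)) =
      -(boxContent (Λ.box (hi i)) - boxContent (Λ.box (lo i))) := by ring
    have e2 : boxContent (Λ.box (hi i)) - boxContent (Λ.box (hi j)) =
      -(boxContent (Λ.box (hi j)) - boxContent (Λ.box (hi i))) := by ring
    have e3 : boxContent (Λ.box (hi j)) - boxContent (Λ.box (lo i)) =
      (boxContent (Λ.box (hi i)) - boxContent (Λ.box (lo i))) +
      (boxContent (Λ.box (hi j)) - boxContent (Λ.box (hi i))) := by ring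
    refine twoTerm_braid_at (swap_swap_box _ _) (swap_swap_box _ _) ?_ ?_ ?_ ?_ ?_ ?_ ?_ ?_ ?_ ?_
    · have := congrArg (fun g : Equiv.Perm (Fin μ.card) => g.trans Λ.box)
        (isBraid_adjSwap.braid i j hij)
      exact this
    all_goals simp only [Equiv.trans_apply, hlj, n2, n3, n5, adjSwap_lo, adjSwap_hi]
    · rw [e1, e2, e3]; exact yDiag_braid hq0 hq hd he hde
    · rw [e1, e3]; exact Or.inr (yDiag_left hq0 hq hd he hde)
    · rw [e2, e3]; exact Or.inr (yDiag_right hq0 hq hd he hde)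
  · have : stdIncl μ * ((q - q⁻¹) • youngMatrix q μ k + 1) =
        ((q - q⁻¹) • fullYoung q μ k + 1) * stdIncl μ := by
      rw [Matrix.mul_add, Matrix.add_mul, Matrix.mul_smul, Matrix.smul_mul, hι, Matrix.mul_one,
        Matrix.one_mul]
    rw [h2, this]
    refine mul_stdIncl_ext fun Λ => ?_
    have hd := Λ.d_ne_zero k
    rw [Λ.d_eq] at hd
    have e1 : boxContent (Λ.box (lo k)) - boxContent (Λ.box (hi k)) =
      -(boxContent (Λ.box (hi k)) - boxContent (Λ.box (lo k))) := by ring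
    refine twoTerm_sq_at (swap_swap_box _ _) ?_ ?_
    all_goals simp only [Equiv.trans_apply, adjSwap_lo, adjSwap_hi]
    · rw [e1]; exact yDiag_sq hq0 hq hd
    · rw [e1]; exact Or.inr (yDiag_add hq0 hq hd)

theorem youngMatrix_transpose (k : Fin (μ.card - 1)) :
    (youngMatrix q μ k).transpose = youngMatrix q μ k := by
  ext Γ Λ
  rw [Matrix.transpose_apply, youngMatrix_apply, youngMatrix_apply]
  congr 1
  · by_cases h : Γ = Λ
    · subst h; simp
    · simp [h, Ne.symm h]
  · by_cases h : Γ.box = (adjSwap k).trans Λ.box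
    · rw [if_pos h, if_pos (by rw [h, swap_swap_box]), StdTableau.d_swap h, yOff_neg]
    · rw [if_neg h, if_neg fun h' => h (by rw [h', swap_swap_box])]

/-- A matrix commuting with Young's form is scalar. -/
theorem scalar_of_commute_youngMatrix (hq0 : q ≠ 0) (hq : ∀ k : ℕ, 0 < k → q ^ k ≠ 1)
    {B : Type*} [Ring B] [Algebra ℂ B] {M : Matrix (StdTableau μ) (StdTableau μ) B}
    (h : ∀ k, (youngMatrix q μ k).map (algebraMap ℂ B) * M =
      M * (youngMatrix q μ k).map (algebraMap ℂ B)) :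
    (∀ Λ Γ, Λ ≠ Γ → M Λ Γ = 0) ∧ ∀ Λ Γ, M Λ Λ = M Γ Γ := by
  classical
  let f : Matrix (StdTableau μ) (StdTableau μ) ℂ →+* Matrix (StdTableau μ) (StdTableau μ) B :=
    (algebraMap ℂ B).mapMatrix
  -- The Jucys–Murphy elements, diagonal in Young's basis with eigenvalues `q^{2c_a(Λ)}`.
  let Y : Fin μ.card → Matrix (StdTableau μ) (StdTableau μ) ℂ := fun a =>
    Matrix.diagonal fun Λ => q ^ (2 * Λ.content a)
  have hY : ∀ k : Fin (μ.card - 1), Y (hi k) = youngMatrix q μ k * Y (lo k) * youngMatrix q μ k := by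
    intro k
    have hT := (isHecke_youngMatrix hq0 hq μ).sq k
    -- By the quadratic relation `T_k - (q - q⁻¹)` is the inverse of `T_k`, so this is the recursion
    -- `Y_{k+1} = T_k Y_k T_k` in another form.
    have h1 : youngMatrix q μ k * Y (lo k) = Y (hi k) * (youngMatrix q μ k - (q - q⁻¹) • 1) := by
      ext Γ Λ
      rw [Matrix.mul_diagonal, Matrix.diagonal_mul, Matrix.sub_apply, Matrix.smul_apply,
        youngMatrix_apply, Matrix.one_apply]
      by_cases e : Γ = Λ
      · subst e
        have hd := Γ.d_ne_zero k
        have hc : Γ.content (hi k) = Γ.content (lo k) + Γ.d k := by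
          rw [StdTableau.d_eq, StdTableau.content_eq, StdTableau.content_eq]; ring
        have h1 := qsq_ne_one hq0 hq hd
        have h2 := zpow_ne_zero (Γ.d k) hq0
        have h3 := zpow_ne_zero (Γ.content (lo k)) hq0
        rw [if_neg (swap_box_ne _ k).symm, hc, yDiag_eq hq0, mul_add, zpow_add₀ hq0, two_mul (Γ.d k),
          zpow_add₀ hq0 (Γ.d k)]
        simp only [if_true, smul_eq_mul]
        generalize q - q⁻¹ = h at *
        generalize q ^ Γ.d k = Q at *
        field_simp
        ring
      · by_cases e' : Γ.box = (adjSwap k).trans Λ.box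
        · have : Γ.content (hi k) = Λ.content (lo k) := by simp [StdTableau.content_eq, e']
          simp [e, e', this, mul_comm]
        · simp [e, e']
    rw [h1, Matrix.mul_assoc, sub_mul, hT, smul_mul_assoc, one_mul, add_sub_cancel_left, mul_one]
  -- The entry `0` sits in the corner box of content zero, so the first `Y` is `1`, and the
  -- recursion makes every `Y a` a product of the `T_k`.
  have hcomm : ∀ N : ℕ, ∀ a : Fin μ.card, a.1 = N → f (Y a) * M = M * f (Y a) := by
    intro N
    induction N with
    | zero =>
      intro a ha
      have : Y a = 1 := by
        rw [← Matrix.diagonal_one]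
        refine congrArg Matrix.diagonal (funext fun Λ => ?_)
        have hc : Λ.content a = 0 := by
          have hz : (0, 0) ∈ μ.cells := μ.isLowerSet
            (show ((0, 0) : ℕ × ℕ) ≤ (Λ.box a).1 from ⟨Nat.zero_le _, Nat.zero_le _⟩) (Λ.box a).2
          obtain ⟨p, hp⟩ := Λ.box.surjective ⟨_, hz⟩
          have hpa : p = a := by
            by_contra hne
            have : p < a := Λ.lt_of_box_le
              (by rw [hp]; exact ⟨Nat.zero_le _, Nat.zero_le _⟩) hne
            rw [Fin.lt_def] at this
            omega
          rw [← hpa, StdTableau.content_eq, hp]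
          simp [boxContent]
        simp [hc]
      rw [this, map_one, one_mul, mul_one]
    | succ N ih =>
      intro a ha
      have hk : N < μ.card - 1 := by have := a.2; omega
      have e1 : a = hi ⟨N, hk⟩ := by ext; simp [hi, ha]
      have h0 := ih (lo ⟨N, hk⟩) rfl
      have h1 : f (youngMatrix q μ ⟨N, hk⟩) * M = M * f (youngMatrix q μ ⟨N, hk⟩) := h ⟨N, hk⟩
      rw [e1, hY, map_mul, map_mul, mul_assoc, h1, ← mul_assoc, mul_assoc (f _) (f _) M, h0,
        ← mul_assoc, h1]
      simp only [mul_assoc]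
  -- Contents separate tableaux and `q` is not a root of unity, so the joint eigenvalues of the `Y
  -- a` are distinct.
  have hoff : ∀ Λ Γ, Λ ≠ Γ → M Λ Γ = 0 := by
    intro Λ Γ hne
    obtain ⟨a, ha⟩ : ∃ a, Λ.content a ≠ Γ.content a := by
      by_contra! hc
      exact hne (StdTableau.content_injective hc)
    have h1 := congrFun (congrFun (hcomm a.1 a rfl) Λ) Γ
    have e : f (Y a) = Matrix.diagonal fun Λ => algebraMap ℂ B (q ^ (2 * Λ.content a)) := by
      simp [f, Y, Matrix.diagonal_map]
    rw [e, Matrix.diagonal_mul, Matrix.mul_diagonal, ← Algebra.commutes, ← sub_eq_zero, ← sub_mul,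
      ← map_sub, ← Algebra.smul_def, smul_eq_zero_iff_right] at h1
    · exact h1
    · rw [sub_ne_zero]
      intro h2
      apply zpow_ne_one hq0 hq (a := 2 * (Λ.content a - Γ.content a)) (by omega)
      rw [mul_sub, zpow_sub₀ hq0, h2, div_self (zpow_ne_zero _ hq0)]
  refine ⟨hoff, fun Λ Γ => ?_⟩
  refine StdTableau.swap_induction (P := fun Γ => M Λ Λ = M Γ Γ) Λ rfl ?_ Γ
  intro Θ Γ k hΓ ih
  rw [ih]
  -- As `M` is diagonal, the entry at `(Γ, Θ)` compares `M Θ Θ` with `M Γ Γ`, both multiplied by a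
  -- nonzero off-diagonal coefficient.
  have h1 := congrFun (congrFun (h k) Γ) Θ
  have hne : Γ ≠ Θ := by
    rintro rfl
    exact swap_box_ne _ _ hΓ.symm
  rw [Matrix.mul_apply, Matrix.mul_apply, Finset.sum_eq_single Θ, Finset.sum_eq_single Γ] at h1
  · rw [Matrix.map_apply, youngMatrix_apply, if_neg hne, if_pos hΓ, zero_add, ← Algebra.commutes,
      ← Algebra.smul_def, ← Algebra.smul_def] at h1
    have hd := StdTableau.d_of_swap hΓ
    exact smul_right_injective B (yOff_ne_zero hq0 hq (Θ.d_ne_zero k) hd.1 hd.2) h1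
  · intro Θ' _ h'
    rw [hoff _ _ h'.symm, zero_mul]
  · simp
  · intro Θ' _ h'
    rw [hoff _ _ h', mul_zero]
  · simp

end YoungForm

/-! ### Operators in single tensor factors over a noncommutative ring. -/

section Sites

variable {m n : ℕ} {C : Type*} [Ring C]

/-- Only tuples differing from `I` in the place `a` alone contribute, so a product over `m`-tuples
becomes a sum over one index. -/
theorem at1_mul_apply (a : Fin m) (M : Matrix (Fin n) (Fin n) C)
    (N : Matrix (Fin m → Fin n) (Fin m → Fin n) C) (I J : Fin m → Fin n) :
    (at1 a M * N) I J = ∑ c, M (I a) c * N (Function.update I a c) J := by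
  rw [Matrix.mul_apply]
  symm
  refine Finset.sum_of_injOn (fun c => Function.update I a c)
    (Function.update_injective I a).injOn (by simp) ?_ ?_
  · intro K _ hK
    rw [at1, Matrix.of_apply, if_neg, zero_mul]
    intro h
    apply hK
    refine ⟨K a, by simp, ?_⟩
    ext1 b
    by_cases hb : b = a
    · subst hb; simp
    · simp [hb, h b hb]
  · intro c _
    rw [at1, Matrix.of_apply, if_pos, Function.update_self]
    intro b hb
    rw [Function.update_of_ne hb]

theorem at2_mul_apply {a b : Fin m} (hab : a ≠ b)
    (M : Matrix (Fin n × Fin n) (Fin n × Fin n) C)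
    (N : Matrix (Fin m → Fin n) (Fin m → Fin n) C) (I J : Fin m → Fin n) :
    (at2 a b M * N) I J =
      ∑ p, M (I a, I b) p * N (Function.update (Function.update I a p.1) b p.2) J := by
  rw [Matrix.mul_apply]
  symm
  refine Finset.sum_of_injOn (fun p => Function.update (Function.update I a p.1) b p.2)
    ?_ (by simp) ?_ ?_
  · rintro ⟨c, d⟩ - ⟨c', d'⟩ - h
    have h1 := congrFun h a
    have h2 := congrFun h b
    simp only [Function.update_self, Function.update_of_ne hab] at h1 h2
    rw [h1, h2]
  · intro K _ hK
    rw [at2, Matrix.of_apply, if_neg, zero_mul]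
    intro h
    apply hK
    refine ⟨(K a, K b), by simp, ?_⟩
    ext1 c
    by_cases hb : c = b
    · subst hb; simp
    by_cases ha : c = a
    · subst ha; simp [hb]
    · simp [hb, ha, h c ha hb]
  · intro p _
    rw [at2, Matrix.of_apply, if_pos, Function.update_self, Function.update_of_ne hab,
      Function.update_self]
    intro c ha hb
    rw [Function.update_of_ne hb, Function.update_of_ne ha]

theorem at1_apply (a : Fin m) (M : Matrix (Fin n) (Fin n) C) (I J : Fin m → Fin n) :
    at1 a M I J = if ∀ b, b ≠ a → I b = J b then M (I a) (J a) else 0 := rfl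

theorem at2_apply (a b : Fin m) (M : Matrix (Fin n × Fin n) (Fin n × Fin n) C)
    (I J : Fin m → Fin n) : at2 a b M I J =
      if ∀ c, c ≠ a → c ≠ b → I c = J c then M (I a, I b) (J a, J b) else 0 := rfl

theorem at1_mul (a : Fin m) (M N : Matrix (Fin n) (Fin n) C) :
    at1 a (M * N) = at1 a M * at1 a N := by
  ext I J
  rw [at1_mul_apply]
  simp only [at1_apply, Function.update_self]
  have : ∀ c, (∀ b, b ≠ a → Function.update I a c b = J b) ↔ ∀ b, b ≠ a → I b = J b :=
    fun c => forall_congr' fun b => forall_congr' fun hb => by rw [Function.update_of_ne hb]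
  simp only [this]
  split_ifs <;> simp [Matrix.mul_apply]

theorem at1_one (a : Fin m) : at1 a (1 : Matrix (Fin n) (Fin n) C) = 1 := by
  ext I J
  rw [at1_apply, Matrix.one_apply, Matrix.one_apply, ← ite_and]
  refine if_congr ⟨fun h => funext fun b => ?_, by rintro rfl; simp⟩ rfl rfl
  by_cases hb : b = a
  · rw [hb]; exact h.2
  · exact h.1 b hb

theorem at1_add (a : Fin m) (M N : Matrix (Fin n) (Fin n) C) :
    at1 a (M + N) = at1 a M + at1 a N := by
  ext I J
  simp only [at1_apply, Matrix.add_apply]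
  split_ifs <;> simp

theorem at2_add (a b : Fin m) (M N : Matrix (Fin n × Fin n) (Fin n × Fin n) C) :
    at2 a b (M + N) = at2 a b M + at2 a b N := by
  ext I J
  simp only [at2_apply, Matrix.add_apply]
  split_ifs <;> simp

theorem at2_one (a b : Fin m) : at2 a b (1 : Matrix (Fin n × Fin n) (Fin n × Fin n) C) = 1 := by
  ext I J
  rw [at2_apply, Matrix.one_apply, Matrix.one_apply, ← ite_and]
  refine if_congr ⟨fun h => funext fun c => ?_, by rintro rfl; simp⟩ rfl rfl
  obtain ⟨h1, h2⟩ := h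
  rw [Prod.mk.injEq] at h2
  by_cases hb : c = b
  · rw [hb]; exact h2.2
  by_cases ha : c = a
  · rw [ha]; exact h2.1
  · exact h1 c ha hb

theorem at2_mul {a b : Fin m} (hab : a ≠ b) (M N : Matrix (Fin n × Fin n) (Fin n × Fin n) C) :
    at2 a b (M * N) = at2 a b M * at2 a b N := by
  ext I J
  rw [at2_mul_apply hab]
  simp only [at2_apply, Function.update_self, Function.update_of_ne hab]
  have : ∀ p : Fin n × Fin n, (∀ c, c ≠ a → c ≠ b →
      Function.update (Function.update I a p.1) b p.2 c = J c) ↔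
      ∀ c, c ≠ a → c ≠ b → I c = J c :=
    fun p => forall_congr' fun c => forall_congr' fun ha => forall_congr' fun hb => by
      rw [Function.update_of_ne hb, Function.update_of_ne ha]
  simp only [this]
  split_ifs <;> simp [Matrix.mul_apply]

theorem at1_map {C' : Type*} [Ring C'] (f : C →+* C') (a : Fin m) (M : Matrix (Fin n) (Fin n) C) :
    (at1 a M).map f = at1 a (M.map f) := by
  ext I J
  simp only [Matrix.map_apply, at1_apply]
  split_ifs <;> simp

theorem at2_map {C' : Type*} [Ring C'] (f : C →+* C') (a b : Fin m)
    (M : Matrix (Fin n × Fin n) (Fin n × Fin n) C) :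
    (at2 a b M).map f = at2 a b (M.map f) := by
  ext I J
  simp only [Matrix.map_apply, at2_apply]
  split_ifs <;> simp

/-- The matrix `X_1 Y_2`, with the factors of the entries in this order. -/
def tmul (M N : Matrix (Fin n) (Fin n) C) : Matrix (Fin n × Fin n) (Fin n × Fin n) C :=
  Matrix.of fun p p' => M p.1 p'.1 * N p.2 p'.2

theorem forall_update_iff {a b : Fin m} (hab : a ≠ b) (I J : Fin m → Fin n) (c : Fin n) :
    (∀ d, d ≠ b → Function.update I a c d = J d) ↔
      c = J a ∧ ∀ d, d ≠ a → d ≠ b → I d = J d := by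
  constructor
  · intro h
    refine ⟨by simpa using h a hab, fun d ha hb => by simpa [ha] using h d hb⟩
  · rintro ⟨rfl, h⟩ d hb
    by_cases ha : d = a
    · subst ha; simp
    · simp [ha, h d ha hb]

theorem at1_mul_at1 {a b : Fin m} (hab : a ≠ b) (M N : Matrix (Fin n) (Fin n) C) :
    at1 a M * at1 b N = at2 a b (tmul M N) := by
  ext I J
  rw [at1_mul_apply]
  simp only [at1_apply, at2_apply, forall_update_iff hab, Function.update_of_ne hab.symm, ite_and]
  simp [tmul]

/-- The matrix `Y_2 X_1`, with the factors of the entries in this order. -/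
def tmulRev (M N : Matrix (Fin n) (Fin n) C) : Matrix (Fin n × Fin n) (Fin n × Fin n) C :=
  Matrix.of fun p p' => N p.2 p'.2 * M p.1 p'.1

theorem at1_mul_at1_rev {a b : Fin m} (hab : a ≠ b) (M N : Matrix (Fin n) (Fin n) C) :
    at1 b N * at1 a M = at2 a b (tmulRev M N) := by
  ext I J
  rw [at1_mul_apply]
  simp only [at1_apply, at2_apply, forall_update_iff hab.symm, Function.update_of_ne hab, ite_and]
  simp [tmulRev, imp.swap]

theorem at1_commute {a b : Fin m} (hab : a ≠ b) {M N : Matrix (Fin n) (Fin n) C}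
    (h : ∀ i j k l, Commute (M i j) (N k l)) : Commute (at1 a M) (at1 b N) := by
  rw [Commute, SemiconjBy, at1_mul_at1 hab, at1_mul_at1_rev hab]
  congr 1
  ext p p'
  exact h _ _ _ _

theorem at2_commute_at1 {a b c : Fin m} (hab : a ≠ b) (hca : c ≠ a) (hcb : c ≠ b)
    {M : Matrix (Fin n × Fin n) (Fin n × Fin n) C} {N : Matrix (Fin n) (Fin n) C}
    (h : ∀ i j k l, Commute (M i j) (N k l)) : Commute (at2 a b M) (at1 c N) := by
  ext I J
  rw [at2_mul_apply hab, at1_mul_apply]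
  simp only [at1_apply, at2_apply, Function.update_of_ne hca, Function.update_of_ne hcb,
    Function.update_of_ne hca.symm, Function.update_of_ne hcb.symm]
  have e1 : ∀ p : Fin n × Fin n, (∀ d, d ≠ c →
      Function.update (Function.update I a p.1) b p.2 d = J d) ↔
      p = (J a, J b) ∧ ∀ d, d ≠ a → d ≠ b → d ≠ c → I d = J d := by
    intro p
    constructor
    · intro h
      refine ⟨Prod.ext (by simpa [hab] using h a hca.symm) (by simpa using h b hcb.symm),
        fun d h1 h2 h3 => by simpa [h1, h2] using h d h3⟩
    · rintro ⟨rfl, h⟩ d h3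
      by_cases h2 : d = b
      · subst h2; simp
      by_cases h1 : d = a
      · subst h1; simp [h2]
      simpa [h1, h2] using h d h1 h2 h3
  have e2 : ∀ x : Fin n, (∀ d, d ≠ a → d ≠ b → Function.update I c x d = J d) ↔
      x = J c ∧ ∀ d, d ≠ a → d ≠ b → d ≠ c → I d = J d := by
    intro x
    constructor
    · intro h
      refine ⟨by simpa using h c hca hcb, fun d h1 h2 h3 => by simpa [h3] using h d h1 h2⟩
    · rintro ⟨rfl, h⟩ d h1 h2
      by_cases h3 : d = c
      · subst h3; simp
      simpa [h3] using h d h1 h2 h3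
  simp only [e1, e2, ite_and, mul_ite, mul_zero, Finset.sum_ite_eq', Finset.sum_ite_eq,
    Finset.mem_univ, if_true]
  split_ifs
  · exact h _ _ _ _
  · rfl

/-- The ordered product `C_1 … C_m` of matrices in the successive tensor factors. -/
def sprod (f : Fin m → Matrix (Fin n) (Fin n) C) : Matrix (Fin m → Fin n) (Fin m → Fin n) C :=
  (List.ofFn fun a => at1 a (f a)).prod

end Sites

/-- `t` passes the factors one at a time, turning `f` into `g`, except that the factors `p` and `p +
1` are crossed together by `h2`. -/
theorem mul_prod_ofFn_eq {A : Type*} [Monoid A] {m : ℕ} (t : A) (f g : Fin m → A) (p : ℕ)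
    (hp : p + 1 < m) (h1 : ∀ a : Fin m, a.1 ≠ p → a.1 ≠ p + 1 → t * f a = g a * t)
    (h2 : t * (f ⟨p, by omega⟩ * f ⟨p + 1, hp⟩) = g ⟨p, by omega⟩ * g ⟨p + 1, hp⟩ * t) :
    t * (List.ofFn f).prod = (List.ofFn g).prod * t := by
  have h0 : ∀ (m : ℕ) (f g : Fin m → A), (∀ a, t * f a = g a * t) →
      t * (List.ofFn f).prod = (List.ofFn g).prod * t := by
    intro m
    induction m with
    | zero => simp
    | succ m ih =>
      intro f g h
      rw [List.ofFn_succ, List.ofFn_succ, List.prod_cons, List.prod_cons, ← mul_assoc, h, mul_assoc,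
        ih _ (fun a => g a.succ) fun a => h a.succ, mul_assoc]
  induction m generalizing p with
  | zero => omega
  | succ m ih =>
    rcases p with _ | p
    · obtain ⟨m, rfl⟩ : ∃ m', m = m' + 1 := ⟨m - 1, by omega⟩
      rw [List.ofFn_succ, List.ofFn_succ, List.ofFn_succ, List.ofFn_succ]
      simp only [List.prod_cons]
      rw [← mul_assoc, ← mul_assoc, mul_assoc t]
      have h2' : t * (f 0 * f (Fin.succ 0)) = g 0 * g (Fin.succ 0) * t := h2
      rw [h2', mul_assoc, h0 _ _ (fun a => g a.succ.succ)]
      · simp only [mul_assoc]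
      · intro a
        exact h1 _ (by simp) (by simp)
    · have := ih (fun a => f a.succ) (fun a => g a.succ) p (by omega)
        (fun a ha hb => h1 a.succ (by simpa using ha) (by simpa using hb)) h2
      rw [List.ofFn_succ, List.ofFn_succ, List.prod_cons, List.prod_cons, ← mul_assoc,
        h1 0 (by simp) (by simp), mul_assoc, this, mul_assoc]

section Exchange

variable {m n : ℕ} {C : Type*} [Ring C]

/-- A relation in two neighbouring slots extends to the whole ordered product: the entries of `t`
commute with everything, so `t` passes freely through the other slots. -/
theorem at2_mul_sprod {k : Fin (m - 1)} {t : Matrix (Fin n × Fin n) (Fin n × Fin n) C}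
    (ht : ∀ p p' x, Commute (t p p') x) {f g : Fin m → Matrix (Fin n) (Fin n) C}
    (hfg : ∀ a, a ≠ lo k → a ≠ hi k → f a = g a)
    (h : t * tmul (f (lo k)) (f (hi k)) = tmul (g (lo k)) (g (hi k)) * t) :
    at2 (lo k) (hi k) t * sprod f = sprod g * at2 (lo k) (hi k) t := by
  refine mul_prod_ofFn_eq _ _ _ k.1 (by have := k.2; omega) (fun a h1 h2 => ?_) ?_
  · have h1' : a ≠ lo k := fun e => h1 (congrArg Fin.val e)
    have h2' : a ≠ hi k := fun e => h2 (congrArg Fin.val e)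
    rw [hfg a h1' h2']
    exact at2_commute_at1 (lo_ne_hi k) h1' h2' fun i j _ _ => ht i j _
  · change at2 (lo k) (hi k) t * (at1 (lo k) (f (lo k)) * at1 (hi k) (f (hi k))) =
      at1 (lo k) (g (lo k)) * at1 (hi k) (g (hi k)) * at2 (lo k) (hi k) t
    rw [at1_mul_at1 (lo_ne_hi k), at1_mul_at1 (lo_ne_hi k), ← at2_mul (lo_ne_hi k), h,
      at2_mul (lo_ne_hi k)]

end Exchange

/-! ### Projections onto joint kernels -/

/-- `e` is a projection onto the joint kernel of the `δ_k`. -/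
structure IsKerProj {R ι : Type*} [Ring R] [Fintype ι] (δ : ι → R) (e : R) : Prop where
  mul_eq_zero : ∀ k, δ k * e = 0
  exists_sub : ∃ C : ι → R, 1 - e = ∑ k, C k * δ k

namespace IsKerProj

variable {R ι : Type*} [Ring R] [Fintype ι] {δ : ι → R} {e : R}

theorem map {S : Type*} [Ring S] (h : IsKerProj δ e) (f : R →+* S) :
    IsKerProj (fun k => f (δ k)) (f e) where
  mul_eq_zero k := by rw [← map_mul, h.mul_eq_zero, map_zero]
  exists_sub := by
    obtain ⟨C, hC⟩ := h.exists_sub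
    exact ⟨fun k => f (C k), by rw [← map_one f, ← map_sub, hC, map_sum]; simp⟩

theorem mul_eq_self (h : IsKerProj δ e) {Y : R} (hY : ∀ k, δ k * Y = 0) : e * Y = Y := by
  obtain ⟨C, hC⟩ := h.exists_sub
  have : (1 - e) * Y = 0 := by
    rw [hC, Finset.sum_mul]
    exact Finset.sum_eq_zero fun k _ => by rw [mul_assoc, hY, mul_zero]
  rw [sub_mul, one_mul, sub_eq_zero] at this
  exact this.symm

/-- The hypothesis says that `Y` preserves the joint kernel, so `Y e` still takes values there and
is fixed by `e`. -/
theorem mul_mul_eq (h : IsKerProj δ e) {Y : R} (hY : ∀ k, ∃ Y', δ k * Y = Y' * δ k) :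
    e * (Y * e) = Y * e := by
  refine h.mul_eq_self fun k => ?_
  obtain ⟨Y', hY'⟩ := hY k
  rw [← mul_assoc, hY', mul_assoc, h.mul_eq_zero, mul_zero]

end IsKerProj

/-- `G` is a linear section of `F` over its range, extended to the whole space. -/
theorem exists_quasi_inverse {K I J : Type*} [Field K] [Fintype I] [Fintype J] [DecidableEq I]
    [DecidableEq J] (F : Matrix I J K) : ∃ G : Matrix J I K, F * G * F = F := by
  obtain ⟨s, hs⟩ := (Matrix.toLin' F).rangeRestrict.exists_rightInverse_of_surjective
    (LinearMap.range_rangeRestrict _)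
  obtain ⟨g, hg⟩ := LinearMap.exists_extend s
  refine ⟨LinearMap.toMatrix' g, ?_⟩
  apply Matrix.toLin'.injective
  rw [Matrix.toLin'_mul, Matrix.toLin'_mul, Matrix.toLin'_toMatrix']
  refine LinearMap.ext fun v => ?_
  have h1 : g (Matrix.toLin' F v) = s ((Matrix.toLin' F).rangeRestrict v) := by
    rw [← hg]; rfl
  have h2 := congrArg Subtype.val (LinearMap.congr_fun hs ((Matrix.toLin' F).rangeRestrict v))
  rw [LinearMap.comp_apply, LinearMap.comp_apply, h1]
  exact h2

/-- Stack the `δ_k` into one rectangular matrix `F` and take `1 - G F` for a quasi-inverse `G`. The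
certificate for `1 - e` is a matrix identity, so it survives extension to noncommutative
coefficients. -/
theorem exists_isKerProj {K U ι : Type*} [Field K] [Fintype U] [DecidableEq U] [Fintype ι]
    [DecidableEq ι] (δ : ι → Matrix U U K) : ∃ e, IsKerProj δ e := by
  let F : Matrix (ι × U) U K := Matrix.of fun p v => δ p.1 p.2 v
  obtain ⟨G, hG⟩ := exists_quasi_inverse F
  refine ⟨1 - G * F, fun k => ?_, fun k => Matrix.of fun u v => G u (k, v), ?_⟩
  · have : F * (1 - G * F) = 0 := by rw [Matrix.mul_sub, Matrix.mul_one, ← Matrix.mul_assoc, hG, sub_self]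
    ext u v
    exact congrFun (congrFun this (k, u)) v
  · rw [sub_sub_cancel]
    ext u v
    rw [Matrix.mul_apply, Matrix.sum_apply, Fintype.sum_prod_type]
    rfl

/-! ### Scalar matrices over an algebra -/

section Hat

variable {U : Type*} [Fintype U] [DecidableEq U] {B : Type*} [Ring B] [Algebra ℂ B]

/-- A scalar matrix, as a matrix over a `ℂ`-algebra. -/
abbrev hat (B : Type*) [Ring B] [Algebra ℂ B] : Matrix U U ℂ →+* Matrix U U B :=
  (algebraMap ℂ B).mapMatrix

theorem hat_apply (M : Matrix U U ℂ) (i j : U) : hat B M i j = algebraMap ℂ B (M i j) := rfl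

theorem hat_smul (c : ℂ) (M : Matrix U U ℂ) : hat B (c • M) = c • hat B M := by
  ext i j
  rw [hat_apply, Matrix.smul_apply, Matrix.smul_apply, hat_apply, smul_eq_mul, map_mul,
    ← Algebra.smul_def]

theorem trace_hat_mul_comm (M : Matrix U U ℂ) (N : Matrix U U B) :
    (hat B M * N).trace = (N * hat B M).trace := by
  simp only [Matrix.trace, Matrix.diag, Matrix.mul_apply, hat_apply]
  rw [Finset.sum_comm]
  exact Finset.sum_congr rfl fun i _ => Finset.sum_congr rfl fun j _ => Algebra.commutes _ _

end Hat

/-! ### Intertwining two representations of the Hecke algebra -/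

section Intertwine

variable {ι X Θ : Type*} [Fintype X] [DecidableEq X] [Fintype Θ] [DecidableEq Θ]

/-- `T_k ⊗ 1 - 1 ⊗ ρ_k`. -/
def delta (T : ι → Matrix X X ℂ) (ρ : ι → Matrix Θ Θ ℂ) (k : ι) :
    Matrix (X × Θ) (X × Θ) ℂ := T k ⊗ₖ 1 - 1 ⊗ₖ ρ k

variable {B : Type*} [Ring B] [Algebra ℂ B]

/-- The partial trace over the first factor. -/
def ptr (N : Matrix (X × Θ) (X × Θ) B) : Matrix Θ Θ B :=
  Matrix.of fun Γ Λ => ∑ x, N (x, Γ) (x, Λ)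

theorem hat_kronecker_one_mul_apply (t : Matrix X X ℂ) (N : Matrix (X × Θ) (X × Θ) B)
    (p p' : X × Θ) : (hat B (t ⊗ₖ 1) * N : Matrix (X × Θ) (X × Θ) B) p p' = ∑ x, algebraMap ℂ B (t p.1 x) * N (x, p.2) p' := by
  rw [Matrix.mul_apply, Fintype.sum_prod_type]
  refine Finset.sum_congr rfl fun x _ => ?_
  rw [Finset.sum_eq_single p.2]
  · simp
  · intro b _ hb
    simp [Matrix.one_apply_ne hb.symm]
  · simp

theorem hat_one_kronecker_mul_apply (r : Matrix Θ Θ ℂ) (N : Matrix (X × Θ) (X × Θ) B)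
    (p p' : X × Θ) : (hat B (1 ⊗ₖ r) * N : Matrix (X × Θ) (X × Θ) B) p p' = ∑ x, algebraMap ℂ B (r p.2 x) * N (p.1, x) p' := by
  rw [Matrix.mul_apply, Fintype.sum_prod_type, Finset.sum_eq_single p.1]
  · simp
  · intro b _ hb
    simp [Matrix.one_apply_ne hb.symm]
  · simp

theorem mul_hat_kronecker_one_apply (t : Matrix X X ℂ) (N : Matrix (X × Θ) (X × Θ) B)
    (p p' : X × Θ) : (N * hat B (t ⊗ₖ 1) : Matrix (X × Θ) (X × Θ) B) p p' =
      ∑ x, N p (x, p'.2) * algebraMap ℂ B (t x p'.1) := by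
  rw [Matrix.mul_apply, Fintype.sum_prod_type]
  refine Finset.sum_congr rfl fun x _ => ?_
  rw [Finset.sum_eq_single p'.2]
  · simp
  · intro b _ hb
    simp [Matrix.one_apply_ne hb]
  · simp

theorem mul_hat_one_kronecker_apply (r : Matrix Θ Θ ℂ) (N : Matrix (X × Θ) (X × Θ) B)
    (p p' : X × Θ) : (N * hat B (1 ⊗ₖ r) : Matrix (X × Θ) (X × Θ) B) p p' =
      ∑ x, N p (p'.1, x) * algebraMap ℂ B (r x p'.2) := by
  rw [Matrix.mul_apply, Fintype.sum_prod_type, Finset.sum_eq_single p'.1]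
  · simp
  · intro b _ hb
    simp [Matrix.one_apply_ne hb]
  · simp

/-- Next to `N`, on either side, `ρ_k` may be replaced by `T_k`, and the trace over the first factor
is cyclic in the scalar matrix `T_k`. -/
theorem ptr_commute {T : ι → Matrix X X ℂ} {ρ : ι → Matrix Θ Θ ℂ} {k : ι}
    {N : Matrix (X × Θ) (X × Θ) B} (h1 : hat B (delta T ρ k) * N = 0)
    (h2 : N * hat B (delta T ρ k) = 0) :
    (ρ k).map (algebraMap ℂ B) * ptr N = ptr N * (ρ k).map (algebraMap ℂ B) := by
  rw [delta, map_sub, sub_mul, sub_eq_zero] at h1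
  rw [delta, map_sub, mul_sub, sub_eq_zero] at h2
  ext Γ Λ
  have e1 : ((ρ k).map (algebraMap ℂ B) * ptr N) Γ Λ =
      ∑ x, (hat B (1 ⊗ₖ ρ k) * N : Matrix (X × Θ) (X × Θ) B) (x, Γ) (x, Λ) := by
    simp only [hat_one_kronecker_mul_apply]
    simp only [Matrix.mul_apply, ptr, Matrix.of_apply, Matrix.map_apply, Finset.mul_sum]
    rw [Finset.sum_comm]
  have e2 : (ptr N * (ρ k).map (algebraMap ℂ B)) Γ Λ =
      ∑ x, (N * hat B (1 ⊗ₖ ρ k) : Matrix (X × Θ) (X × Θ) B) (x, Γ) (x, Λ) := by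
    simp only [mul_hat_one_kronecker_apply]
    simp only [Matrix.mul_apply, ptr, Matrix.of_apply, Matrix.map_apply, Finset.sum_mul]
    rw [Finset.sum_comm]
  rw [e1, e2, ← h1, ← h2]
  simp only [hat_kronecker_one_mul_apply, mul_hat_kronecker_one_apply]
  rw [Finset.sum_comm]
  exact Finset.sum_congr rfl fun _ _ => Finset.sum_congr rfl fun _ _ => Algebra.commutes _ _

/-- The family of matrices `M_Λ` is compatible with the intertwiners of `T` and `ρ`. -/
def Exchanges (T : ι → Matrix X X ℂ) (ρ : ι → Matrix Θ Θ ℂ) (M : Θ → Matrix X X B) : Prop :=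
  ∀ k, ∃ M' : Θ → Matrix X X B,
    (∀ Λ, hat B (T k - ρ k Λ Λ • 1) * M Λ = M' Λ * hat B (T k - ρ k Λ Λ • 1)) ∧
      ∀ Γ Λ, Γ ≠ Λ → ρ k Γ Λ ≠ 0 → M' Γ = M Λ

/-- The diagonal blocks are `h1`. An off-diagonal block contains only the number `ρ_k(Γ, Λ)`, so it
compares `M' Γ` with `M Λ` exactly where that number is nonzero. -/
theorem delta_mul_blockDiagonal {T : ι → Matrix X X ℂ} {ρ : ι → Matrix Θ Θ ℂ}
    {M M' : Θ → Matrix X X B} {k : ι}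
    (h1 : ∀ Λ, hat B (T k - ρ k Λ Λ • 1) * M Λ = M' Λ * hat B (T k - ρ k Λ Λ • 1))
    (h2 : ∀ Γ Λ, Γ ≠ Λ → ρ k Γ Λ ≠ 0 → M' Γ = M Λ) :
    hat B (delta T ρ k) * Matrix.blockDiagonal M =
      Matrix.blockDiagonal M' * hat B (delta T ρ k) := by
  rw [delta, map_sub, sub_mul, mul_sub]
  ext ⟨x, Γ⟩ ⟨y, Λ⟩
  rw [Matrix.sub_apply, Matrix.sub_apply, hat_kronecker_one_mul_apply, hat_one_kronecker_mul_apply,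
    mul_hat_kronecker_one_apply, mul_hat_one_kronecker_apply]
  simp only [Matrix.blockDiagonal_apply, mul_ite, ite_mul, mul_zero, zero_mul, Finset.sum_ite_eq',
    Finset.sum_ite_eq, Finset.mem_univ, if_true]
  by_cases e : Γ = Λ
  · subst e
    have := h1 Γ
    rw [map_sub, hat_smul, map_one, sub_mul, mul_sub, smul_mul_assoc, mul_smul_comm, one_mul,
      mul_one] at this
    have := congrFun (congrFun this x) y
    simp only [Matrix.sub_apply, Matrix.smul_apply, Matrix.mul_apply, hat_apply] at this
    simp only [if_true]
    rw [← Algebra.commutes (ρ k Γ Γ) (M' Γ x y), ← Algebra.smul_def, ← Algebra.smul_def]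
    exact this
  · simp only [if_neg e, Finset.sum_const_zero, zero_sub]
    by_cases hr : ρ k Γ Λ = 0
    · simp [hr]
    · rw [h2 Γ Λ e hr, Algebra.commutes]

theorem Exchanges.delta_mul {T : ι → Matrix X X ℂ} {ρ : ι → Matrix Θ Θ ℂ}
    {M : Θ → Matrix X X B} (h : Exchanges T ρ M) (k : ι) :
    ∃ Y, hat B (delta T ρ k) * Matrix.blockDiagonal M = Y * hat B (delta T ρ k) := by
  obtain ⟨M', h1, h2⟩ := h k
  exact ⟨_, delta_mul_blockDiagonal h1 h2⟩

theorem Exchanges.mul_right {T : ι → Matrix X X ℂ} {ρ : ι → Matrix Θ Θ ℂ}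
    {M : Θ → Matrix X X B} (h : Exchanges T ρ M) {D : Matrix X X B}
    (hD : ∀ k, Commute (hat B (T k)) D) : Exchanges T ρ fun Λ => M Λ * D := by
  intro k
  obtain ⟨M', h1, h2⟩ := h k
  refine ⟨fun Λ => M' Λ * D, fun Λ => ?_, fun Γ Λ e hr => by simp only [h2 Γ Λ e hr]⟩
  have : Commute (hat B (T k - ρ k Λ Λ • 1)) D := by
    rw [map_sub, hat_smul, map_one]
    exact (hD k).sub_left ((Commute.one_left _).smul_left _)
  rw [← mul_assoc, h1, mul_assoc, mul_assoc, this.eq]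

/-- `∑_σ T_σ ⊗ ρ_σ`. -/
def symSum {m : ℕ} (T : Fin (m - 1) → Matrix X X ℂ) (ρ : Fin (m - 1) → Matrix Θ Θ ℂ) :
    Matrix (X × Θ) (X × Θ) ℂ := ∑ σ, heckeT T σ ⊗ₖ heckeT ρ σ

variable {m : ℕ} {h : ℂ} {T : Fin (m - 1) → Matrix X X ℂ} {ρ : Fin (m - 1) → Matrix Θ Θ ℂ}

/-- The terms of σ and σ_k σ cancel together because `T` and `ρ` satisfy the same quadratic
relation. Thus `symSum` takes values in the joint kernel. -/
theorem delta_mul_symSum (hT : IsHecke h T) (hρ : IsHecke h ρ) (k : Fin (m - 1)) :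
    delta T ρ k * symSum T ρ = 0 := by
  rw [symSum, Finset.mul_sum]
  refine sum_eq_zero_of_left k _ fun σ hσ => ?_
  rw [hT.mul_heckeT hσ, hρ.mul_heckeT hσ]
  simp only [delta, sub_mul, ← Matrix.mul_kronecker_mul, one_mul]
  rw [← mul_assoc, ← mul_assoc, hT.sq, hρ.sq]
  simp only [add_mul, one_mul, Matrix.add_kronecker, Matrix.kronecker_add, smul_mul_assoc,
    Matrix.smul_kronecker, Matrix.kronecker_smul]
  abel

theorem symSum_mul_delta (hT : IsHecke h T) (hρ : IsHecke h ρ) (k : Fin (m - 1)) :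
    symSum T ρ * delta T ρ k = 0 := by
  rw [symSum, Finset.sum_mul]
  refine sum_eq_zero_of_right k _ fun σ hσ => ?_
  rw [hT.heckeT_mul hσ, hρ.heckeT_mul hσ]
  simp only [delta, mul_sub, ← Matrix.mul_kronecker_mul, mul_one]
  rw [mul_assoc, mul_assoc, hT.sq, hρ.sq]
  simp only [mul_add, mul_one, Matrix.add_kronecker, Matrix.kronecker_add, mul_smul_comm,
    Matrix.smul_kronecker, Matrix.kronecker_smul]
  abel

/-- On the joint kernel each `T_k` may be traded for `ρ_k`. Since `ρ_k` acts on the other factor,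
the letters come out in reverse order. -/
theorem prod_kronecker_one_mul {e : Matrix (X × Θ) (X × Θ) ℂ} (he : ∀ k, delta T ρ k * e = 0)
    (w : List (Fin (m - 1))) :
    ((w.map T).prod ⊗ₖ 1) * e = (1 ⊗ₖ (w.reverse.map ρ).prod) * e := by
  induction w with
  | nil => rfl
  | cons k w ih =>
    have hk : (T k ⊗ₖ 1) * e = (1 ⊗ₖ ρ k) * e := by
      have := he k
      rwa [delta, sub_mul, sub_eq_zero] at this
    have c : ∀ (a : Matrix X X ℂ) (b : Matrix Θ Θ ℂ),
        (a ⊗ₖ (1 : Matrix Θ Θ ℂ)) * (1 ⊗ₖ b) = (1 ⊗ₖ b) * (a ⊗ₖ 1) := by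
      intro a b
      rw [← Matrix.mul_kronecker_mul, ← Matrix.mul_kronecker_mul]
      simp
    have s1 : ((List.map T (k :: w)).prod ⊗ₖ (1 : Matrix Θ Θ ℂ)) =
        (T k ⊗ₖ 1) * ((w.map T).prod ⊗ₖ 1) := by
      rw [← Matrix.mul_kronecker_mul]; simp
    have s2 : ((1 : Matrix X X ℂ) ⊗ₖ (List.map ρ (k :: w).reverse).prod) =
        (1 ⊗ₖ (w.reverse.map ρ).prod) * (1 ⊗ₖ ρ k) := by
      rw [← Matrix.mul_kronecker_mul]; simp
    rw [s1, s2, mul_assoc, ih, ← mul_assoc, c, mul_assoc, hk, mul_assoc]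

/-- The Casimir element `∑ T_σ T_{σ⁻¹}` is central: its commutator with `T_k` cancels over each pair
σ, σ_k σ. -/
theorem commute_sum_heckeT_mul_inv (hρ : IsHecke h ρ) (k : Fin (m - 1)) :
    ρ k * ∑ σ, heckeT ρ σ * heckeT ρ σ⁻¹ = (∑ σ, heckeT ρ σ * heckeT ρ σ⁻¹) * ρ k := by
  rw [← sub_eq_zero, Finset.mul_sum, Finset.sum_mul, ← Finset.sum_sub_distrib]
  refine sum_eq_zero_of_left k _ fun σ hσ => ?_
  have e : (adjSwap k * σ)⁻¹ = σ⁻¹ * adjSwap k := by rw [mul_inv_rev, adjSwap_inv]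
  rw [e, hρ.mul_heckeT hσ, hρ.heckeT_mul hσ]
  generalize heckeT ρ σ = a
  generalize heckeT ρ σ⁻¹ = b
  have h1 : ρ k * (ρ k * a * (b * ρ k)) = (ρ k * ρ k) * (a * b * ρ k) := by
    simp only [mul_assoc]
  have h2 : ρ k * a * (b * ρ k) * ρ k = (ρ k * a * b) * (ρ k * ρ k) := by
    simp only [mul_assoc]
  rw [h1, h2, hρ.sq]
  simp only [add_mul, mul_add, one_mul, mul_one, smul_mul_assoc, mul_smul_comm, mul_assoc]
  abel

/-- Trading every letter of `T_σ` for `ρ` turns `symSum` on the joint kernel into the Casimir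
element of the second factor. -/
theorem symSum_mul (hρ : IsHecke h ρ) {e : Matrix (X × Θ) (X × Θ) ℂ}
    (he : ∀ k, delta T ρ k * e = 0) :
    symSum T ρ * e = (1 ⊗ₖ ∑ σ, heckeT ρ σ * heckeT ρ σ⁻¹) * e := by
  have : ∀ b : Equiv.Perm (Fin m) → Matrix Θ Θ ℂ,
      ((1 : Matrix X X ℂ) ⊗ₖ ∑ σ, b σ) = ∑ σ, (1 : Matrix X X ℂ) ⊗ₖ b σ := by
    intro b
    ext p p'
    simp [Matrix.kroneckerMap_apply, Matrix.sum_apply, Finset.mul_sum]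
  rw [symSum, this, Finset.sum_mul, Finset.sum_mul]
  refine Finset.sum_congr rfl fun σ _ => ?_
  have h1 : heckeT T σ ⊗ₖ heckeT ρ σ = (1 ⊗ₖ heckeT ρ σ) * (heckeT T σ ⊗ₖ 1) := by
    rw [← Matrix.mul_kronecker_mul]; simp
  have h2 : (1 : Matrix X X ℂ) ⊗ₖ (heckeT ρ σ * heckeT ρ σ⁻¹) =
      (1 ⊗ₖ heckeT ρ σ) * (1 ⊗ₖ heckeT ρ σ⁻¹) := by
    rw [← Matrix.mul_kronecker_mul]; simp
  rw [h1, h2, mul_assoc, mul_assoc]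
  congr 1
  rw [hρ.heckeT_inv]
  exact prod_kronecker_one_mul he _

theorem heckeT_inv_apply_self (hρ : IsHecke h ρ) (hs : ∀ k, (ρ k).transpose = ρ k)
    (σ : Equiv.Perm (Fin m)) (Λ : Θ) : heckeT ρ σ⁻¹ Λ Λ = heckeT ρ σ Λ Λ := by
  have : (heckeT ρ σ).transpose = heckeT ρ σ⁻¹ := by
    rw [hρ.heckeT_inv, heckeT, Matrix.transpose_list_prod, List.map_map,
      show Matrix.transpose ∘ ρ = ρ from funext hs, List.map_reverse]
  rw [← this, Matrix.transpose_apply]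

/-- Symmetry of `ρ` makes the coefficient `⟨T_{σ⁻¹} v_Λ, v_Λ⟩` the diagonal entry of `ρ_σ`. The
traces for all tableaux are then the diagonal entries of a single partial trace. -/
theorem trace_mul_sum_eq_ptr (hρ : IsHecke h ρ) (hs : ∀ k, (ρ k).transpose = ρ k)
    (M : Θ → Matrix X X B) (Λ : Θ) :
    (M Λ * hat B (∑ σ, heckeT ρ σ⁻¹ Λ Λ • heckeT T σ)).trace =
      ptr (Matrix.blockDiagonal M * hat B (symSum T ρ)) Λ Λ := by
  simp only [symSum, map_sum, Finset.mul_sum, ptr, Matrix.of_apply, Matrix.trace, Matrix.diag,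
    Matrix.sum_apply]
  refine Finset.sum_congr rfl fun x _ => Finset.sum_congr rfl fun σ _ => ?_
  rw [heckeT_inv_apply_self hρ hs, Matrix.mul_apply, Matrix.mul_apply, Fintype.sum_prod_type]
  refine Finset.sum_congr rfl fun y _ => ?_
  rw [Finset.sum_eq_single Λ]
  · simp [hat_apply, Matrix.blockDiagonal_apply, Matrix.kroneckerMap_apply, mul_comm]
  · intro Γ _ e
    simp [Matrix.blockDiagonal_apply, e.symm]
  · simp

end Intertwine

/-! ### Independence of the tableau -/

section Young

variable {q : ℂ} (hq0 : q ≠ 0) (hq : ∀ k : ℕ, 0 < k → q ^ k ≠ 1) {μ : YoungDiagram}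
  {X : Type*} [Fintype X] [DecidableEq X] {T : Fin (μ.card - 1) → Matrix X X ℂ}
  {B : Type*} [Ring B] [Algebra ℂ B]

include hq0 hq

/-- `M` preserves the joint kernel and `symSum` is annihilated by `delta` on both sides, so the
partial trace commutes with Young's form and Schur's lemma applies. -/
theorem ptr_scalar (hT : IsHecke (q - q⁻¹) T) {M : StdTableau μ → Matrix X X B}
    (hM : Exchanges T (youngMatrix q μ) M) (Λ Γ : StdTableau μ) :
    ptr (Matrix.blockDiagonal M * hat B (symSum T (youngMatrix q μ))) Λ Λ =
      ptr (Matrix.blockDiagonal M * hat B (symSum T (youngMatrix q μ))) Γ Γ := by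
  have hρ := isHecke_youngMatrix hq0 hq μ
  refine (scalar_of_commute_youngMatrix hq0 hq fun k => ptr_commute (T := T) (k := k) ?_ ?_).2 Λ Γ
  · obtain ⟨Y, hY⟩ := hM.delta_mul k
    rw [← mul_assoc, hY, mul_assoc, ← map_mul, delta_mul_symSum hT hρ, map_zero, mul_zero]
  · rw [mul_assoc, ← map_mul, symSum_mul_delta hT hρ, map_zero, mul_zero]

theorem trace_mul_sum_eq (hT : IsHecke (q - q⁻¹) T) {M : StdTableau μ → Matrix X X B}
    (hM : Exchanges T (youngMatrix q μ) M) (Λ Γ : StdTableau μ) :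
    (M Λ * hat B (∑ σ, heckeT (youngMatrix q μ) σ⁻¹ Λ Λ • heckeT T σ)).trace =
      (M Γ * hat B (∑ σ, heckeT (youngMatrix q μ) σ⁻¹ Γ Γ • heckeT T σ)).trace := by
  have hρ := isHecke_youngMatrix hq0 hq μ
  rw [trace_mul_sum_eq_ptr hρ (youngMatrix_transpose (q := q)),
    trace_mul_sum_eq_ptr hρ (youngMatrix_transpose (q := q)), ptr_scalar hq0 hq hT hM]

end Young

/-- The diagonal entries of the partial trace coincide, so each is the full trace divided by the
number of tableaux. That trace lives on the joint kernel, where `symSum` acts by the Casimir scalar.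
The constant depends neither on the ring `B` nor on `M`. -/
theorem exists_trace_eq {q : ℂ} (hq0 : q ≠ 0) (hq : ∀ k : ℕ, 0 < k → q ^ k ≠ 1)
    {μ : YoungDiagram} {X : Type} [Fintype X] [DecidableEq X]
    {T : Fin (μ.card - 1) → Matrix X X ℂ} (hT : IsHecke (q - q⁻¹) T)
    {e : Matrix (X × StdTableau μ) (X × StdTableau μ) ℂ}
    (he : IsKerProj (delta T (youngMatrix q μ)) e) :
    ∃ κ : ℂ, ∀ (B : Type) [Ring B] [Algebra ℂ B] (M : StdTableau μ → Matrix X X B),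
      Exchanges T (youngMatrix q μ) M → ∀ Λ,
        (M Λ * hat B (∑ σ, heckeT (youngMatrix q μ) σ⁻¹ Λ Λ • heckeT T σ)).trace =
          κ • (Matrix.blockDiagonal M * hat B e).trace := by
  have hρ := isHecke_youngMatrix hq0 hq μ
  rcases isEmpty_or_nonempty (StdTableau μ) with hE | ⟨⟨Λ₀⟩⟩
  · exact ⟨0, fun _ _ _ _ _ Λ => (hE.false Λ).elim⟩
  set ρ := youngMatrix q μ with hρdef
  -- The Casimir element commutes with Young's form, hence is a scalar there.
  obtain ⟨hZ1, hZ2⟩ := scalar_of_commute_youngMatrix hq0 hq (μ := μ) (B := ℂ)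
    (M := ∑ σ, heckeT ρ σ * heckeT ρ σ⁻¹) (fun k => by
      have : (youngMatrix q μ k).map (algebraMap ℂ ℂ) = ρ k := by ext; rfl
      rw [this]
      exact commute_sum_heckeT_mul_inv hρ k)
  set Z := ∑ σ, heckeT ρ σ * heckeT ρ σ⁻¹ with hZ
  set κ := Z Λ₀ Λ₀ with hκ
  have hZs : Z = κ • 1 := by
    ext Λ Γ
    by_cases hΛ : Λ = Γ
    · subst hΛ
      simp [hZ2 Λ Λ₀, hκ]
    · simp [hZ1 Λ Γ hΛ, hΛ]
  have hS : symSum T ρ * e = κ • e := by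
    rw [symSum_mul hρ he.mul_eq_zero, ← hZ, hZs, Matrix.kronecker_smul, Matrix.one_kronecker_one,
      smul_mul_assoc, one_mul]
  have hcard : (Fintype.card (StdTableau μ) : ℂ) ≠ 0 := by
    exact_mod_cast (Fintype.card_pos_iff.2 ⟨Λ₀⟩).ne'
  refine ⟨(Fintype.card (StdTableau μ) : ℂ)⁻¹ * κ, fun B _ _ M hM Λ => ?_⟩
  rw [trace_mul_sum_eq_ptr hρ (youngMatrix_transpose (q := q)), mul_smul, eq_inv_smul_iff₀ hcard]
  have h1 : (Matrix.blockDiagonal M * hat B (symSum T ρ)).trace =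
      (Fintype.card (StdTableau μ) : ℂ) •
        ptr (Matrix.blockDiagonal M * hat B (symSum T ρ)) Λ Λ := by
    have : ∀ N : Matrix (X × StdTableau μ) (X × StdTableau μ) B, N.trace = ∑ Γ, ptr N Γ Γ := by
      intro N
      rw [Matrix.trace, Fintype.sum_prod_type, Finset.sum_comm]
      rfl
    rw [this, Finset.sum_congr rfl fun Γ _ => ptr_scalar hq0 hq hT hM Γ Λ, Finset.sum_const,
      Finset.card_univ, Nat.cast_smul_eq_nsmul]
  rw [← h1]
  have heh : IsKerProj (fun k => hat B (delta T ρ k)) (hat B e) := he.map _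
  have h2 : e * symSum T ρ = symSum T ρ := he.mul_eq_self fun k => delta_mul_symSum hT hρ k
  have h3 := heh.mul_mul_eq fun k => hM.delta_mul k
  -- Since `symSum` has its image in the joint kernel, `e` can be inserted to its left. Its entries
  -- are scalars, so it may be rotated to the front, where it meets `M e = e M e`.
  calc (Matrix.blockDiagonal M * hat B (symSum T ρ)).trace
      = ((Matrix.blockDiagonal M * hat B e) * hat B (symSum T ρ)).trace := by
        rw [mul_assoc, ← map_mul, h2]
    _ = (hat B (symSum T ρ) * (Matrix.blockDiagonal M * hat B e)).trace :=
        (trace_hat_mul_comm _ _).symm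
    _ = (κ • (Matrix.blockDiagonal M * hat B e)).trace := by
        rw [← h3, ← mul_assoc, ← map_mul, hS, hat_smul, smul_mul_assoc]
    _ = κ • (Matrix.blockDiagonal M * hat B e).trace := Matrix.trace_smul _ _

/-! ### The `RLL` relations at the critical level -/

theorem kronecker_one_mul {n : ℕ} {C : Type*} [Ring C] (M N : Matrix (Fin n) (Fin n) C) :
    (M ⊗ₖ (1 : Matrix (Fin n) (Fin n) C)) * ((1 : Matrix (Fin n) (Fin n) C) ⊗ₖ N) = tmul M N := by
  ext p p'
  rw [Matrix.mul_apply, Fintype.sum_prod_type, Finset.sum_eq_single p'.1]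
  · rw [Finset.sum_eq_single p.2]
    · simp [tmul]
    · intro b _ hb
      simp [Matrix.one_apply_ne hb.symm]
    · simp
  · intro b _ hb
    simp [Matrix.one_apply_ne hb]
  · simp

theorem one_kronecker_mul {n : ℕ} {C : Type*} [Ring C] (M N : Matrix (Fin n) (Fin n) C) :
    ((1 : Matrix (Fin n) (Fin n) C) ⊗ₖ N) * (M ⊗ₖ (1 : Matrix (Fin n) (Fin n) C)) =
      tmulRev M N := by
  ext p p'
  rw [Matrix.mul_apply, Fintype.sum_prod_type, Finset.sum_eq_single p.1]
  · rw [Finset.sum_eq_single p'.2]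
    · simp [tmulRev]
    · intro b _ hb
      simp [Matrix.one_apply_ne hb]
    · simp
  · intro b _ hb
    simp [Matrix.one_apply_ne hb.symm]
  · simp

section RLL

variable {n : ℕ} {q : ℂ} {A A' : Type*} [Ring A] [Algebra ℂ A] [Ring A'] [Algebra ℂ A']

theorem plusMode_map (φ : A →ₐ[ℂ] A') (x : Fin n → Fin n → ℕ → A) (s : ℤ) :
    (plusMode x s).map φ = plusMode (fun i j r => φ (x i j r)) s := by
  ext i j
  simp only [plusMode, Matrix.map_apply, Matrix.of_apply]
  split_ifs <;> simp

theorem minusMode_map (φ : A →ₐ[ℂ] A') (x : Fin n → Fin n → ℕ → A) (s : ℤ) :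
    (minusMode x s).map φ = minusMode (fun i j r => φ (x i j r)) s := by
  ext i j
  simp only [minusMode, Matrix.map_apply, Matrix.of_apply]
  split_ifs <;> simp

theorem rllLeft_apply (γ : A) (X Y : ℤ → Matrix (Fin n) (Fin n) A) (s t : ℤ)
    (I J : Fin n × Fin n) : rllLeft q γ X Y s t I J =
      ∑ k ∈ Finset.range (s.natAbs + t.natAbs + 1), ∑ K, γ ^ k * (algebraMap ℂ A (Rcoeff n q k I K) *
        (X (s - k) K.1 J.1 * Y (t + k) K.2 J.2)) := by
  simp only [rllLeft, kronecker_one_mul, Matrix.sum_apply, Matrix.smul_apply, Matrix.mul_apply,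
    Matrix.map_apply, tmul, Matrix.of_apply, smul_eq_mul, Finset.mul_sum]

theorem rllRight_apply (γ : A) (X Y : ℤ → Matrix (Fin n) (Fin n) A) (s t : ℤ)
    (I J : Fin n × Fin n) : rllRight q γ X Y s t I J =
      ∑ k ∈ Finset.range (s.natAbs + t.natAbs + 1), ∑ K, γ ^ k *
        (Y (t + k) I.2 K.2 * X (s - k) I.1 K.1 * algebraMap ℂ A (Rcoeff n q k K J)) := by
  simp only [rllRight, one_kronecker_mul, Matrix.sum_apply, Matrix.smul_apply, Matrix.mul_apply,
    Matrix.map_apply, tmulRev, Matrix.of_apply, smul_eq_mul, Finset.mul_sum]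

theorem map_rllLeft (φ : A →ₐ[ℂ] A') (γ : A) (X Y : ℤ → Matrix (Fin n) (Fin n) A) (s t : ℤ)
    (I J : Fin n × Fin n) : φ (rllLeft q γ X Y s t I J) =
      rllLeft q (φ γ) (fun s => (X s).map φ) (fun s => (Y s).map φ) s t I J := by
  simp [rllLeft_apply]

theorem map_rllRight (φ : A →ₐ[ℂ] A') (γ : A) (X Y : ℤ → Matrix (Fin n) (Fin n) A) (s t : ℤ)
    (I J : Fin n × Fin n) : φ (rllRight q γ X Y s t I J) =
      rllRight q (φ γ) (fun s => (X s).map φ) (fun s => (Y s).map φ) s t I J := by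
  simp [rllRight_apply]

theorem toCrit_rel {x y : FreeAlgebra ℂ (Gen n)} (h : Rel n q x y) :
    toCrit n q x = toCrit n q y := by
  rw [toCrit, AlgHom.comp_apply, AlgHom.comp_apply, toUq_rel h]

theorem toCrit_freeQc : toCrit n q (freeQc n) = algebraMap ℂ _ (q ^ (-(n : ℤ))) := by
  rw [toCrit, AlgHom.comp_apply, ← AlgHom.commutes (UqToCrit n q)]
  exact RingQuot.mkAlgHom_rel ℂ CritRel.crit

theorem toCrit_freeQcInv (hq0 : q ≠ 0) :
    toCrit n q (freeQcInv n) = algebraMap ℂ _ (q ^ n) := by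
  have h := toCrit_rel (q := q) (n := n) Rel.qc_qcInv
  rw [map_mul, map_one, toCrit_freeQc] at h
  calc toCrit n q (freeQcInv n) = algebraMap ℂ _ (q ^ n * q ^ (-(n : ℤ))) *
        toCrit n q (freeQcInv n) := by
        rw [zpow_neg, zpow_natCast, mul_inv_cancel₀ (pow_ne_zero _ hq0), map_one, one_mul]
    _ = _ := by rw [map_mul, mul_assoc, h, mul_one]

theorem rll_plus_crit (s t : ℤ) (I J : Fin n × Fin n) :
    rllLeft q 1 (plusMode (lPlus n q)) (plusMode (lPlus n q)) s t I J =
      rllRight q 1 (plusMode (lPlus n q)) (plusMode (lPlus n q)) s t I J := by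
  have h := toCrit_rel (Rel.rll_plus (q := q) s t I J)
  simp only [map_rllLeft, map_rllRight, plusMode_map, map_one] at h
  exact h

theorem rll_mixed_crit (hq0 : q ≠ 0) (s t : ℤ) (I J : Fin n × Fin n) :
    rllLeft q (algebraMap ℂ _ (q ^ n)) (plusMode (lPlus n q)) (minusMode (lMinus n q)) s t I J =
      rllRight q (algebraMap ℂ _ (q ^ (-(n : ℤ)))) (plusMode (lPlus n q))
        (minusMode (lMinus n q)) s t I J := by
  have h := toCrit_rel (Rel.rll_mixed (q := q) s t I J)
  simp only [map_rllLeft, map_rllRight, plusMode_map, minusMode_map, toCrit_freeQc,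
    toCrit_freeQcInv hq0] at h
  exact h

end RLL

/-- The `R`-matrix `R(x)` as a matrix of power series. -/
def Rser (n : ℕ) (q : ℂ) : Matrix (Fin n × Fin n) (Fin n × Fin n) ℂ⟦X⟧ := fSeries n q • Rbar n q

theorem coeff_Rser (n : ℕ) (q : ℂ) (k : ℕ) (I J : Fin n × Fin n) :
    PowerSeries.coeff k (Rser n q I J) = Rcoeff n q k I J := rfl

/-- Scalar power series, as power series over a `ℂ`-algebra. -/
abbrev serHat (A : Type*) [Ring A] [Algebra ℂ A] : ℂ⟦X⟧ →+* A⟦X⟧ :=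
  PowerSeries.map (algebraMap ℂ A)

section PlusPlus

variable {n : ℕ} {q : ℂ}

/-- The homogeneous component of degree `N` of `L⁺_1(x y) L⁺_2(y)` in `y`. -/
def plusPlus (n : ℕ) (q : ℂ) (N : ℕ) :
    Matrix (Fin n × Fin n) (Fin n × Fin n) (UqCrit n q)⟦X⟧ :=
  Matrix.of fun p p' => PowerSeries.mk fun s =>
    if s ≤ N then lPlus n q p.1 p'.1 s * lPlus n q p.2 p'.2 (N - s) else 0

/-- The homogeneous component of degree `N` of `L⁺_2(y) L⁺_1(x y)` in `y`. -/
def plusPlusRev (n : ℕ) (q : ℂ) (N : ℕ) :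
    Matrix (Fin n × Fin n) (Fin n × Fin n) (UqCrit n q)⟦X⟧ :=
  Matrix.of fun p p' => PowerSeries.mk fun s =>
    if s ≤ N then lPlus n q p.2 p'.2 (N - s) * lPlus n q p.1 p'.1 s else 0

theorem sum_range_natAbs {M : Type*} [AddCommMonoid M] (s t : ℤ) (N : ℕ)
    (hN : N ≤ s.natAbs + t.natAbs) (F : ℕ → M) (hF : ∀ k, N < k → F k = 0) :
    ∑ k ∈ Finset.range (s.natAbs + t.natAbs + 1), F k = ∑ k ∈ Finset.range (N + 1), F k := by
  symm
  refine Finset.sum_subset (Finset.range_mono (by omega)) fun k _ hk => hF k ?_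
  simpa using hk

/-- Put `x = u/v` and fix the total degree `N` in `u` and `v`. The products of two `L⁺` become
polynomials in `x`, which can be multiplied by the power series `R(x)`. -/
theorem Rser_mul_plusPlus (N : ℕ) :
    (Rser n q).map (serHat (UqCrit n q)) * plusPlus n q N =
      plusPlusRev n q N * (Rser n q).map (serHat (UqCrit n q)) := by
  ext I J s
  -- The exponent `N - s` of `v` may be negative; these relations supply the coefficients of `x^s`
  -- with `s > N`.
  have h := rll_plus_crit (q := q) (s : ℤ) ((N : ℤ) - s) I J
  rw [rllLeft_apply, rllRight_apply] at h
  have hz : ∀ k : ℕ, s < k → plusMode (lPlus n q) ((s : ℤ) - k) = 0 := by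
    intro k hk
    ext i j
    simp only [plusMode, Matrix.of_apply, Matrix.zero_apply]
    rw [if_neg (by omega)]
  rw [sum_range_natAbs _ _ s (by simp) _ (fun k hk => by simp [hz k hk]),
    sum_range_natAbs _ _ s (by simp) _ (fun k hk => by simp [hz k hk])] at h
  have e1 : ∀ k ≤ s, ∀ i j, plusMode (lPlus n q) ((s : ℤ) - k) i j = lPlus n q i j (s - k) := by
    intro k hk i j
    simp only [plusMode, Matrix.of_apply]
    rw [if_pos (by omega)]
    congr 1
    omega
  have e2 : ∀ k ≤ s, ∀ i j, plusMode (lPlus n q) ((N : ℤ) - s + k) i j =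
      if s - k ≤ N then lPlus n q i j (N - (s - k)) else 0 := by
    intro k hk i j
    simp only [plusMode, Matrix.of_apply]
    refine if_ctx_congr (by omega) (fun hh => ?_) fun _ => rfl
    congr 1
    omega
  simp only [Matrix.mul_apply, map_sum, PowerSeries.coeff_mul, Matrix.map_apply,
    PowerSeries.coeff_map, coeff_Rser]
  calc _ = ∑ k ∈ Finset.range (s + 1), ∑ K, algebraMap ℂ (UqCrit n q) (Rcoeff n q k I K) *
        PowerSeries.coeff (s - k) (plusPlus n q N K J) := by
        rw [Finset.sum_comm]
        exact Finset.Nat.sum_antidiagonal_eq_sum_range_succ (fun i j => ∑ K,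
          algebraMap ℂ (UqCrit n q) (Rcoeff n q i I K) *
            PowerSeries.coeff j (plusPlus n q N K J)) s
    _ = _ := Eq.trans (Finset.sum_congr rfl fun k hk => Finset.sum_congr rfl fun K _ => by
        have hk' : k ≤ s := by simpa [Nat.lt_succ_iff] using hk
        rw [e1 k hk', e2 k hk', one_pow, one_mul]
        simp [plusPlus]) h
    _ = ∑ k ∈ Finset.range (s + 1), ∑ K, PowerSeries.coeff (s - k) (plusPlusRev n q N I K) *
          algebraMap ℂ (UqCrit n q) (Rcoeff n q k K J) := by
        refine Finset.sum_congr rfl fun k hk => Finset.sum_congr rfl fun K _ => ?_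
        have hk' : k ≤ s := by simpa [Nat.lt_succ_iff] using hk
        rw [e1 k hk', e2 k hk', one_pow, one_mul]
        simp [plusPlusRev]
    _ = _ := by
        rw [Finset.sum_comm]
        refine Finset.sum_congr rfl fun K _ => ?_
        rw [← Finset.Nat.sum_antidiagonal_swap]
        exact (Finset.Nat.sum_antidiagonal_eq_sum_range_succ (fun i j =>
          PowerSeries.coeff j (plusPlusRev n q N I K) *
            algebraMap ℂ (UqCrit n q) (Rcoeff n q i K J)) s).symm

end PlusPlus

/-! ### Baxterization and families satisfying the `RLL` relation -/

/-- The Yang–Baxter equation for the baxterized generators `(v - u) T + u h`: after expansion only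
the braid and quadratic relations are needed. -/
theorem yangBaxter {K S : Type*} [CommRing K] [Ring S] [Algebra K S] {s t : S} {h : K}
    (hst : t * (s * t) = s * (t * s)) (hs : s * s = h • s + 1) (ht : t * t = h • t + 1)
    (a b x w : K) :
    ((b - a) • t + (a * h) • 1) * (((w - x * a) • s + (x * a * h) • 1) *
        ((w - x * b) • t + (x * b * h) • 1)) =
      ((w - x * b) • s + (x * b * h) • 1) * (((w - x * a) • t + (x * a * h) • 1) *
        ((b - a) • s + (a * h) • 1)) := by
  simp only [add_mul, mul_add, smul_mul_assoc, mul_smul_comm, one_mul, mul_one, hst, hs, ht,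
    smul_add, smul_smul]
  module

section Baxter

variable {n : ℕ} {q : ℂ} {K : Type*} [CommRing K] [Algebra ℂ K]

/-- The baxterized `Ř`-matrix `(v - u) Ř + u (q - q⁻¹)`. -/
def TB (n : ℕ) (q : ℂ) {K : Type*} [CommRing K] [Algebra ℂ K] (u v : K) :
    Matrix (Fin n × Fin n) (Fin n × Fin n) K :=
  (v - u) • (Tmat n q).map (algebraMap ℂ K) + (u * algebraMap ℂ K (q - q⁻¹)) • 1

theorem at2_smul {m : ℕ} (a b : Fin m) (c : K) (M : Matrix (Fin n × Fin n) (Fin n × Fin n) K) :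
    at2 a b (c • M) = c • at2 a b M := by
  ext I J
  simp only [at2_apply, Matrix.smul_apply]
  split_ifs <;> simp

theorem Rcheck_eq {m : ℕ} (k : Fin (m - 1)) :
    Rcheck n q k = at2 (lo k) (hi k) (Tmat n q) := by
  rw [← flipP_mul_Rfin]; rfl

theorem hat_Rcheck {B : Type*} [Ring B] [Algebra ℂ B] {m : ℕ} (k : Fin (m - 1)) :
    hat B (Rcheck n q k) = at2 (lo k) (hi k) ((Tmat n q).map (algebraMap ℂ B)) := by
  rw [Rcheck_eq, ← at2_map]; rfl

theorem at2_TB {m : ℕ} (k : Fin (m - 1)) (u v : K) :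
    at2 (lo k) (hi k) (TB n q u v) =
      (v - u) • hat K (Rcheck n q k) + (u * algebraMap ℂ K (q - q⁻¹)) • 1 := by
  rw [TB, at2_add, at2_smul, at2_smul, at2_one, hat_Rcheck]

theorem hat_sq {B : Type*} [CommRing B] [Algebra ℂ B] (hq0 : q ≠ 0) {m : ℕ} (k : Fin (m - 1)) :
    hat B (Rcheck n q k) * hat B (Rcheck n q k) =
      algebraMap ℂ B (q - q⁻¹) • hat B (Rcheck n q k) + 1 := by
  rw [← map_mul, (isHecke_Rcheck q hq0 m).sq, map_add, map_one, hat_smul]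
  congr 1
  rw [algebraMap_smul]

theorem TB_yangBaxter (hq0 : q ≠ 0) (a b x w : K) :
    at2 (1 : Fin 3) 2 (TB n q a b) * (at2 (0 : Fin 3) 1 (TB n q (x * a) w) *
        at2 (1 : Fin 3) 2 (TB n q (x * b) w)) =
      at2 (0 : Fin 3) 1 (TB n q (x * b) w) * (at2 (1 : Fin 3) 2 (TB n q (x * a) w) *
        at2 (0 : Fin 3) 1 (TB n q a b)) := by
  have e0 := fun u v : K => at2_TB (n := n) (q := q) (0 : Fin (3 - 1)) u v
  have e1 := fun u v : K => at2_TB (n := n) (q := q) (1 : Fin (3 - 1)) u v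
  change ∀ u v : K, at2 (0 : Fin 3) 1 (TB n q u v) = _ at e0
  change ∀ u v : K, at2 (1 : Fin 3) 2 (TB n q u v) = _ at e1
  rw [e0, e0, e0, e1, e1, e1]
  refine yangBaxter ?_ (hat_sq hq0 _) (hat_sq hq0 _) a b x w
  rw [← map_mul, ← map_mul, ← map_mul, ← map_mul, ← mul_assoc, ← mul_assoc,
    (isHecke_Rcheck q hq0 3).braid 0 1 rfl]

/-- The matrix with matrix entries `S(u, w)_{αβ} = [TB(u, w)_{iα, βj}]`. -/
def Smat (n : ℕ) (q : ℂ) {K : Type*} [CommRing K] [Algebra ℂ K] (u w : K) :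
    Matrix (Fin n) (Fin n) (Matrix (Fin n) (Fin n) K) :=
  Matrix.of fun α β => Matrix.of fun i j => TB n q u w (i, α) (β, j)

/-- The `RLL` relation `TB(a, b) F_1(a) F_2(b) = F_1(b) F_2(a) TB(a, b)`. -/
def ExchRel (q : ℂ) {n : ℕ} {C : Type*} [Ring C] [Algebra ℂ C] (F : ℂ → Matrix (Fin n) (Fin n) C) :
    Prop := ∀ a b : ℂ, a ≠ 0 → b ≠ 0 →
  hat C (TB n q a b) * tmul (F a) (F b) = tmul (F b) (F a) * hat C (TB n q a b)

theorem update_vec_one_two (i α β c d : Fin n) :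
    Function.update (Function.update ![i, α, β] 1 c) 2 d = ![i, c, d] := by
  ext1 k; fin_cases k <;> rfl

theorem update_vec_zero_one (i α β c d : Fin n) :
    Function.update (Function.update ![i, α, β] 0 c) 1 d = ![c, d, β] := by
  ext1 k; fin_cases k <;> rfl

theorem at2_one_two_apply (M : Matrix (Fin n × Fin n) (Fin n × Fin n) K) (i α β i' α' β' : Fin n) :
    at2 (1 : Fin 3) 2 M ![i, α, β] ![i', α', β'] = if i = i' then M (α, β) (α', β') else 0 := by
  rw [at2_apply]
  refine if_congr ⟨fun h => h 0 (by decide) (by decide), fun h c h1 h2 => ?_⟩ rfl rfl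
  fin_cases c
  · exact h
  · exact (h1 rfl).elim
  · exact (h2 rfl).elim

theorem at2_zero_one_apply (M : Matrix (Fin n × Fin n) (Fin n × Fin n) K)
    (i α β i' α' β' : Fin n) :
    at2 (0 : Fin 3) 1 M ![i, α, β] ![i', α', β'] = if β = β' then M (i, α) (i', α') else 0 := by
  rw [at2_apply]
  refine if_congr ⟨fun h => h 2 (by decide) (by decide), fun h c h1 h2 => ?_⟩ rfl rfl
  fin_cases c
  · exact (h1 rfl).elim
  · exact (h2 rfl).elim
  · exact h

theorem hat_TB (a b : ℂ) : (TB n q a b).map (algebraMap ℂ K) =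
    TB n q (algebraMap ℂ K a) (algebraMap ℂ K b) := by
  ext p p'
  simp only [TB, Matrix.map_apply, Matrix.add_apply, Matrix.smul_apply, Matrix.one_apply,
    smul_eq_mul, map_add, map_mul, map_sub, Algebra.algebraMap_self_apply]
  split_ifs <;> simp

/-- In the Yang–Baxter equation on three slots, the incoming index of the first slot and the
outgoing index of the last are read as matrix entries. What remains is an RLL relation, so the
R-matrix itself is a solution. -/
theorem Smat_exch (hq0 : q ≠ 0) (x w : K) :
    ExchRel q fun a => Smat n q (x * algebraMap ℂ K a) w := by
  intro a b _ _
  ext ⟨α, β⟩ ⟨α', β'⟩ i j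
  have h := congrFun (congrFun (TB_yangBaxter (n := n) hq0 (algebraMap ℂ K a) (algebraMap ℂ K b)
    x w) ![i, α, β]) ![α', β', j]
  rw [at2_mul_apply (by decide), at2_mul_apply (by decide)] at h
  simp only [at2_mul_apply (show (0 : Fin 3) ≠ 1 by decide),
    at2_mul_apply (show (1 : Fin 3) ≠ 2 by decide)] at h
  simp only [Matrix.cons_val_zero, Matrix.cons_val_one, Matrix.cons_val, update_vec_one_two,
    update_vec_zero_one, at2_one_two_apply, at2_zero_one_apply, ← hat_TB, Matrix.map_apply] at h
  simp only [Matrix.mul_apply, Matrix.sum_apply, hat_apply, ← Algebra.commutes (_ : ℂ)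
    (_ : Matrix (Fin n) (Fin n) K), ← Algebra.smul_def, Matrix.smul_apply, tmul, Smat,
    Matrix.of_apply]
  simp only [Algebra.smul_def]
  refine Eq.trans ?_ (h.trans ?_)
  · refine Finset.sum_congr rfl fun p _ => ?_
    congr 1
    simp only [mul_ite, mul_zero]
    symm
    rw [Fintype.sum_prod_type, Finset.sum_eq_single α']
    · simp
    · intro c _ hc
      simp [hc]
    · simp
  · simp only [Fintype.sum_prod_type, mul_ite, mul_zero, Finset.sum_ite_eq', Finset.mem_univ,
      if_true, Finset.mul_sum]
    refine Finset.sum_congr rfl fun c _ => ?_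
    rw [Finset.sum_comm]
    refine Finset.sum_congr rfl fun d _ => Finset.sum_congr rfl fun e _ => ?_
    ring

end Baxter

section Families

variable {n : ℕ} {q : ℂ} {C C' : Type*} [Ring C] [Algebra ℂ C] [Ring C'] [Algebra ℂ C']

theorem tmul_map (φ : C →+* C') (M N : Matrix (Fin n) (Fin n) C) :
    (tmul M N).map φ = tmul (M.map φ) (N.map φ) := by
  ext p p'
  simp [tmul]

theorem hat_map {U : Type*} [Fintype U] [DecidableEq U] (φ : C →ₐ[ℂ] C') (M : Matrix U U ℂ) :
    (hat C M).map φ = hat C' M := by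
  ext i j
  simp [hat_apply]

theorem ExchRel.map {F : ℂ → Matrix (Fin n) (Fin n) C} (hF : ExchRel q F) (φ : C →ₐ[ℂ] C') :
    ExchRel q fun a => (F a).map φ := by
  intro a b ha hb
  have h := congrArg (fun M => M.map φ) (hF a b ha hb)
  simp only [Matrix.map_mul, hat_map] at h
  change _ * (tmul (F a) (F b)).map (φ : C →+* C') =
    (tmul (F b) (F a)).map (φ : C →+* C') * _ at h
  rwa [tmul_map, tmul_map] at h

theorem ExchRel.smul {K : Type*} [CommRing K] [Algebra K C] {F : ℂ → Matrix (Fin n) (Fin n) C}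
    (hF : ExchRel q F) (g : ℂ → K) : ExchRel q fun a => g a • F a := by
  intro a b ha hb
  have h : ∀ a b, tmul (g a • F a) (g b • F b) = (g a * g b) • tmul (F a) (F b) := by
    intro a b
    ext p p'
    simp only [tmul, Matrix.of_apply, Matrix.smul_apply, smul_mul_assoc, mul_smul_comm, smul_smul,
      mul_comm]
  rw [h, h, mul_smul_comm, smul_mul_assoc, hF a b ha hb, mul_comm (g a)]

/-- Entries of the two families commute, so the product regroups as `F_1 F_2` times `G_1 G_2` and
the matrix `TB` passes both. -/
theorem ExchRel.mul {F G : ℂ → Matrix (Fin n) (Fin n) C} (hF : ExchRel q F) (hG : ExchRel q G)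
    (h : ∀ a b i j k l, Commute (F a i j) (G b k l)) : ExchRel q fun a => F a * G a := by
  have e : ∀ a b, tmul (F a * G a) (F b * G b) = tmul (F a) (F b) * tmul (G a) (G b) := by
    intro a b
    ext p p'
    simp only [tmul, Matrix.of_apply, Matrix.mul_apply, Fintype.sum_prod_type, Finset.sum_mul,
      Finset.mul_sum]
    rw [Finset.sum_comm]
    refine Finset.sum_congr rfl fun c _ => Finset.sum_congr rfl fun d _ => ?_
    rw [mul_assoc, mul_assoc, ← mul_assoc (G a _ _), ← (h b a _ _ _ _).eq, mul_assoc]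
  intro a b ha hb
  rw [e, e, ← mul_assoc, hF a b ha hb, mul_assoc, hG a b ha hb, mul_assoc]

theorem TB_eq_smul {a b : ℂ} (hab : b - a ≠ 0) :
    TB n q a b = (b - a) • (Tmat n q + (a * (q - q⁻¹) / (b - a)) • 1) := by
  have : (Tmat n q).map (algebraMap ℂ ℂ) = Tmat n q := by ext; rfl
  rw [TB, this, smul_add, smul_smul, mul_div_cancel₀ _ hab]
  rfl

theorem youngMatrix_self {μ : YoungDiagram} (Λ : StdTableau μ) (k : Fin (μ.card - 1)) :
    youngMatrix q μ k Λ Λ = yDiag q (Λ.d k) := by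
  rw [youngMatrix_apply, if_pos rfl, if_neg (swap_box_ne _ k).symm, add_zero]

/-- The link between tableaux and spectral parameters: the ratio of `q^{-2c_k}` to `q^{-2c_{k+1}}`
is `q^{2d}`, and the diagonal coefficient of Young's form at `d` is exactly the constant in the
baxterized Ř at this ratio. -/
theorem Rcheck_sub_eq (hq0 : q ≠ 0) (hq : ∀ k : ℕ, 0 < k → q ^ k ≠ 1) {μ : YoungDiagram}
    (Λ : StdTableau μ) (k : Fin (μ.card - 1)) : ∃ c : ℂ, c ≠ 0 ∧
      Rcheck n q k - youngMatrix q μ k Λ Λ • 1 = c • at2 (lo k) (hi k)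
        (TB n q (q ^ (-2 * Λ.content (lo k))) (q ^ (-2 * Λ.content (hi k)))) := by
  set a := q ^ (-2 * Λ.content (lo k)) with ha
  set b := q ^ (-2 * Λ.content (hi k)) with hb
  have ha0 : a ≠ 0 := zpow_ne_zero _ hq0
  have hb0 : b ≠ 0 := zpow_ne_zero _ hq0
  have hd : Λ.d k = Λ.content (hi k) - Λ.content (lo k) := rfl
  have hx := qsq_ne_one hq0 hq (Λ.d_ne_zero k)
  have hab : a = b * (q ^ Λ.d k) ^ 2 := by
    rw [ha, hb, hd, ← zpow_natCast, ← zpow_mul, ← zpow_add₀ hq0]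
    congr 1
    push_cast
    ring
  have hba : b - a ≠ 0 := by
    rw [hab]
    intro h
    apply hx
    have : b * ((q ^ Λ.d k) ^ 2 - 1) = 0 := by linear_combination -h
    exact (mul_eq_zero.1 this).resolve_left hb0
  refine ⟨(b - a)⁻¹, inv_ne_zero hba, ?_⟩
  rw [TB_eq_smul hba, at2_smul, smul_smul, inv_mul_cancel₀ hba, one_smul, at2_add, at2_smul,
    at2_one, Rcheck_eq, youngMatrix_self, yDiag_eq hq0, sub_eq_add_neg, ← neg_smul]
  congr 2
  rw [hab] at hba ⊢
  rw [← neg_div, div_eq_div_iff hx hba]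
  ring

/-- On the diagonal the RLL relation exchanges the parameters of `k` and `k + 1`. Off the diagonal
Young's matrix links only tableaux that differ by this swap, and their content sequences are
permuted accordingly. -/
theorem ExchRel.delta_mul (hq0 : q ≠ 0) (hq : ∀ k : ℕ, 0 < k → q ^ k ≠ 1)
    {F : ℂ → Matrix (Fin n) (Fin n) C} (hF : ExchRel q F) (μ : YoungDiagram)
    (k : Fin (μ.card - 1)) :
    (∀ Λ : StdTableau μ, hat C (Rcheck n q k - youngMatrix q μ k Λ Λ • 1) *
        sprod (fun a => F (q ^ (-2 * Λ.content a))) =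
      sprod (fun a => F (q ^ (-2 * Λ.content (adjSwap k a)))) *
        hat C (Rcheck n q k - youngMatrix q μ k Λ Λ • 1)) ∧
    ∀ Γ Λ : StdTableau μ, Γ ≠ Λ → youngMatrix q μ k Γ Λ ≠ 0 →
      sprod (fun a => F (q ^ (-2 * Γ.content (adjSwap k a)))) =
        sprod (fun a => F (q ^ (-2 * Λ.content a))) := by
  constructor
  · intro Λ
    obtain ⟨c, -, hc⟩ := Rcheck_sub_eq (n := n) hq0 hq Λ k
    rw [hc, hat_smul, smul_mul_assoc, mul_smul_comm]
    congr 1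
    change (at2 (lo k) (hi k) _).map (algebraMap ℂ C) * _ =
      _ * (at2 (lo k) (hi k) _).map (algebraMap ℂ C)
    rw [at2_map]
    refine at2_mul_sprod (fun p p' x => Algebra.commutes _ _) (fun a h1 h2 => ?_) ?_
    · rw [adjSwap_of_ne h1 h2]
    · rw [adjSwap_lo, adjSwap_hi]
      exact hF _ _ (zpow_ne_zero _ hq0) (zpow_ne_zero _ hq0)
  · intro Γ Λ hne h
    rw [youngMatrix_apply, if_neg hne, zero_add] at h
    have hb : Γ.box = (adjSwap k).trans Λ.box := by
      by_contra hb
      exact h (if_neg hb)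
    congr 1
    funext a
    rw [StdTableau.content, hb]
    simp [StdTableau.content]

theorem ExchRel.exchanges (hq0 : q ≠ 0) (hq : ∀ k : ℕ, 0 < k → q ^ k ≠ 1)
    {F : ℂ → Matrix (Fin n) (Fin n) C} (hF : ExchRel q F) (μ : YoungDiagram) :
    Exchanges (Rcheck n q) (youngMatrix q μ) fun Λ => sprod fun a => F (q ^ (-2 * Λ.content a)) :=
  fun k => ⟨_, (hF.delta_mul hq0 hq μ k).1, (hF.delta_mul hq0 hq μ k).2⟩

end Families

theorem serHat_commute {A : Type*} [Ring A] [Algebra ℂ A] (f : ℂ⟦X⟧) (g : A⟦X⟧) :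
    Commute (serHat A f) g := by
  ext s
  rw [PowerSeries.coeff_mul, PowerSeries.coeff_mul, ← Finset.Nat.sum_antidiagonal_swap]
  refine Finset.sum_congr rfl fun p _ => ?_
  simp [Algebra.commutes]

/-! ### The RLL relation for L⁺ at numerical parameters. -/

section Series

variable {n : ℕ} {q : ℂ}

/-- The scalar factor `f(x) / (q - q⁻¹ x)`. -/
def rFactor (n : ℕ) (q : ℂ) : ℂ⟦X⟧ :=
  fSeries n q * (PowerSeries.C q - PowerSeries.C q⁻¹ * PowerSeries.X)⁻¹

theorem constantCoeff_fSeries : PowerSeries.constantCoeff (fSeries n q) = 1 := by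
  rw [← PowerSeries.coeff_zero_eq_constantCoeff_apply, fSeries, PowerSeries.coeff_mk, fCoeff]

theorem constantCoeff_rFactor : PowerSeries.constantCoeff (rFactor n q) = q⁻¹ := by
  simp [rFactor, constantCoeff_fSeries]

theorem rFactor_mul_inv (hq0 : q ≠ 0) : rFactor n q * (rFactor n q)⁻¹ = 1 :=
  PowerSeries.mul_inv_cancel _ (by rw [constantCoeff_rFactor]; exact inv_ne_zero hq0)

theorem den_mul_inv (hq0 : q ≠ 0) : (PowerSeries.C q - PowerSeries.C q⁻¹ * PowerSeries.X) *
    (PowerSeries.C q - PowerSeries.C q⁻¹ * PowerSeries.X : ℂ⟦X⟧)⁻¹ = 1 :=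
  PowerSeries.mul_inv_cancel _ (by simpa using hq0)

theorem TB_X_one_apply (p p' : Fin n × Fin n) :
    TB n q (PowerSeries.X : ℂ⟦X⟧) 1 p p' = PowerSeries.C (Tmat n q p p') -
        PowerSeries.X * PowerSeries.C ((Tmat n q - (q - q⁻¹) • 1) p p') := by
  have : ∀ c : ℂ, algebraMap ℂ ℂ⟦X⟧ c = PowerSeries.C c := fun _ => rfl
  simp only [TB, Matrix.add_apply, Matrix.smul_apply, Matrix.map_apply, Matrix.sub_apply,
    smul_eq_mul, this, map_sub, map_mul]
  rw [Matrix.one_apply, Matrix.one_apply]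
  split_ifs <;> simp <;> ring

theorem Rser_apply (hq0 : q ≠ 0) (a b c d : Fin n) :
    Rser n q (a, b) (c, d) = rFactor n q * TB n q (PowerSeries.X : ℂ⟦X⟧) 1 (b, a) (c, d) := by
  rw [TB_X_one_apply, ← den_mul_Rbar hq0, rFactor, Rser, Matrix.smul_apply, smul_eq_mul]
  linear_combination (-fSeries n q * Rbar n q (a, b) (c, d)) * den_mul_inv hq0

/-- The homogeneous component of degree `N` of `L⁺_1(y) L⁺_2(x y)` in `y`. -/
def plusPlusSwap (n : ℕ) (q : ℂ) (N : ℕ) :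
    Matrix (Fin n × Fin n) (Fin n × Fin n) (UqCrit n q)⟦X⟧ :=
  Matrix.of fun p p' => PowerSeries.mk fun s =>
    if s ≤ N then lPlus n q p.1 p'.1 (N - s) * lPlus n q p.2 p'.2 s else 0

/-- The scalar factor between `R(x)` and `P TB(x, 1)` has constant term `q⁻¹`, so it is invertible
and cancels. The remaining permutation `P` exchanges the two slots. -/
theorem TB_mul_plusPlus (hq0 : q ≠ 0) (N : ℕ) :
    (TB n q (PowerSeries.X : ℂ⟦X⟧) 1).map (serHat (UqCrit n q)) * plusPlus n q N =
      plusPlusSwap n q N * (TB n q (PowerSeries.X : ℂ⟦X⟧) 1).map (serHat (UqCrit n q)) := by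
  ext1 ⟨a, b⟩ J
  have h := congrFun (congrFun (Rser_mul_plusPlus (n := n) (q := q) N) (b, a)) J
  simp only [Matrix.mul_apply, Matrix.map_apply] at h ⊢
  have e1 : ∀ K J : Fin n × Fin n, serHat (UqCrit n q) (Rser n q K J) =
      serHat (UqCrit n q) (rFactor n q) *
        serHat (UqCrit n q) (TB n q (PowerSeries.X : ℂ⟦X⟧) 1 K.swap J) := by
    rintro ⟨k, l⟩ ⟨c, d⟩
    rw [Rser_apply hq0, map_mul]
    rfl
  simp only [e1] at h
  have e2 := congrArg (fun y => serHat (UqCrit n q) (rFactor n q)⁻¹ * y) h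
  simp only [Finset.mul_sum] at e2
  have e3 : serHat (UqCrit n q) (rFactor n q)⁻¹ * serHat (UqCrit n q) (rFactor n q) = 1 := by
    rw [← map_mul, mul_comm, rFactor_mul_inv hq0, map_one]
  have e4 : ∀ x y : (UqCrit n q)⟦X⟧, serHat (UqCrit n q) (rFactor n q)⁻¹ *
      (x * (serHat (UqCrit n q) (rFactor n q) * y)) = x * y := by
    intro x y
    rw [← mul_assoc x, ← (serHat_commute (rFactor n q) x).eq, ← mul_assoc, ← mul_assoc, e3,
      one_mul]
  simp only [e4] at e2
  simp only [mul_assoc, ← mul_assoc (serHat (UqCrit n q) (rFactor n q)⁻¹), e3, one_mul] at e2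
  refine e2.trans ?_
  refine Fintype.sum_equiv (Equiv.prodComm _ _) _ _ ?_
  rintro ⟨c, d⟩
  rfl

/-- The value at `x = a`, homogenized by `b`, of a polynomial in `x`. -/
def homEval {A : Type*} [Ring A] [Algebra ℂ A] (N : ℕ) (a b : ℂ) (g : A⟦X⟧) : A :=
  ∑ s ∈ Finset.range (N + 2), (a ^ s * b ^ (N + 1 - s)) • PowerSeries.coeff s g

theorem homEval_of_le {A : Type*} [Ring A] [Algebra ℂ A] {N : ℕ} (a b : ℂ) (F : ℕ → A) :
    homEval N a b (PowerSeries.mk fun s => if s ≤ N then F s else 0) =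
      b • ∑ s ∈ Finset.range (N + 1), (a ^ s * b ^ (N - s)) • F s := by
  rw [homEval, Finset.sum_range_succ, PowerSeries.coeff_mk, if_neg (by omega), smul_zero, add_zero,
    Finset.smul_sum]
  refine Finset.sum_congr rfl fun s hs => ?_
  have hs' : s ≤ N := by simpa [Nat.lt_succ_iff] using hs
  rw [PowerSeries.coeff_mk, if_pos hs', smul_smul, Nat.succ_sub hs', pow_succ]
  congr 1
  ring

theorem homEval_X_mul_of_le {A : Type*} [Ring A] [Algebra ℂ A] {N : ℕ} (a b : ℂ) (F : ℕ → A) :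
    homEval N a b (PowerSeries.X * PowerSeries.mk fun s => if s ≤ N then F s else 0) =
      a • ∑ s ∈ Finset.range (N + 1), (a ^ s * b ^ (N - s)) • F s := by
  rw [homEval, Finset.sum_range_succ', PowerSeries.coeff_zero_X_mul, smul_zero, add_zero,
    Finset.smul_sum]
  refine Finset.sum_congr rfl fun s hs => ?_
  have hs' : s ≤ N := by simpa [Nat.lt_succ_iff] using hs
  rw [PowerSeries.coeff_succ_X_mul, PowerSeries.coeff_mk, if_pos hs', smul_smul,
    Nat.add_sub_add_right, pow_succ]
  congr 1
  ring

/-- The entries of `TB(x, 1)` are linear and the `L⁺ L⁺` part has degree `N`, so evaluation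
homogenized to degree `N + 1` factors into the two homogenized parts. -/
theorem homEval_linear {A : Type*} [Ring A] [Algebra ℂ A] {N : ℕ} (a b c d : ℂ) (F : ℕ → A) :
    homEval N a b (serHat A (PowerSeries.C c - PowerSeries.X * PowerSeries.C d) *
        PowerSeries.mk fun s => if s ≤ N then F s else 0) =
      (b * c - a * d) • ∑ s ∈ Finset.range (N + 1), (a ^ s * b ^ (N - s)) • F s := by
  have hlin : ∀ (c d : ℂ) (f g : A⟦X⟧), homEval N a b (PowerSeries.C (algebraMap ℂ A c) * f -
      PowerSeries.C (algebraMap ℂ A d) * g) = c • homEval N a b f - d • homEval N a b g := by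
    intro c d f g
    simp only [homEval, map_sub, PowerSeries.coeff_C_mul, smul_sub, Finset.smul_sum,
      ← Algebra.smul_def, Finset.sum_sub_distrib]
    congr 1 <;> exact Finset.sum_congr rfl fun s _ => smul_comm _ _ _
  have e : serHat A (PowerSeries.C c - PowerSeries.X * PowerSeries.C d) =
      PowerSeries.C (algebraMap ℂ A c) - PowerSeries.C (algebraMap ℂ A d) * PowerSeries.X := by
    rw [mul_comm]
    simp
  rw [e, sub_mul, mul_assoc, hlin, homEval_of_le, homEval_X_mul_of_le, smul_smul, smul_smul,
    ← sub_smul]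
  congr 1
  ring

/-- The coefficient of `z^N` in a product of entries of `L⁺(za)` and `L⁺(zb)` is the homogeneous
evaluation at `(a, b)` of the component of degree `N`. No division by `b` or by `b - a` is involved.
-/
theorem LPlus_exch (hq0 : q ≠ 0) : ExchRel q (LPlus n q) := by
  intro a b _ _
  ext1 I J
  refine PowerSeries.ext fun N => ?_
  have h := congrArg (homEval N a b)
    (congrFun (congrFun (TB_mul_plusPlus (n := n) (q := q) hq0 N) I) J)
  have hsum : ∀ (F : Fin n × Fin n → (UqCrit n q)⟦X⟧),
      homEval N a b (∑ K, F K) = ∑ K, homEval N a b (F K) := by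
    intro F
    simp only [homEval, map_sum, Finset.smul_sum]
    exact Finset.sum_comm
  have hc : ∀ f g, PowerSeries.mk f * serHat (UqCrit n q) g = serHat (UqCrit n q) g *
      PowerSeries.mk f := fun f g => (serHat_commute g (PowerSeries.mk f)).eq.symm
  have hT : ∀ p p', TB n q a b p p' =
      b * Tmat n q p p' - a * (Tmat n q - (q - q⁻¹) • 1) p p' := by
    intro p p'
    simp only [TB, Matrix.add_apply, Matrix.smul_apply, Matrix.map_apply, Matrix.sub_apply,
      smul_eq_mul, Algebra.algebraMap_self_apply]
    ring
  simp only [Matrix.mul_apply, Matrix.map_apply, hsum, plusPlus, plusPlusSwap, Matrix.of_apply, hc,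
    TB_X_one_apply, homEval_linear, ← hT] at h
  have hco : ∀ i j k l, PowerSeries.coeff N (LPlus n q a i j * LPlus n q b k l) =
      ∑ s ∈ Finset.range (N + 1), (a ^ s * b ^ (N - s)) • (lPlus n q i j s * lPlus n q k l (N - s)) := by
    intro i j k l
    rw [PowerSeries.coeff_mul]
    simp only [LPlus, Matrix.of_apply, PowerSeries.coeff_mk, smul_mul_smul_comm]
    exact Finset.Nat.sum_antidiagonal_eq_sum_range_succ (fun s t => (a ^ s * b ^ t) •
      (lPlus n q i j s * lPlus n q k l t)) N
  have hco' : ∀ i j k l, PowerSeries.coeff N (LPlus n q b i j * LPlus n q a k l) =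
      ∑ s ∈ Finset.range (N + 1), (a ^ s * b ^ (N - s)) • (lPlus n q i j (N - s) * lPlus n q k l s) := by
    intro i j k l
    rw [PowerSeries.coeff_mul, ← Finset.Nat.sum_antidiagonal_swap]
    simp only [LPlus, Matrix.of_apply, PowerSeries.coeff_mk, smul_mul_smul_comm, Prod.fst_swap,
      Prod.snd_swap, mul_comm (b ^ _)]
    exact Finset.Nat.sum_antidiagonal_eq_sum_range_succ (fun s t => (a ^ s * b ^ t) •
      (lPlus n q i j t * lPlus n q k l s)) N
  simp only [Matrix.mul_apply, map_sum, tmul, Matrix.of_apply, hat_apply,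
    ← Algebra.commutes (_ : ℂ) (_ : (UqCrit n q)⟦X⟧), ← Algebra.smul_def, PowerSeries.coeff_smul,
    hco, hco']
  exact h

end Series

/-! ### The series in terms of traces -/

theorem at1_commute_Tmat {n m : ℕ} {q : ℂ} (k : Fin (m - 1)) {D : Matrix (Fin n) (Fin n) ℂ}
    (h : Commute (Tmat n q) (tmul D D)) :
    Commute (Rcheck n q k) (sprod fun _ : Fin m => D) := by
  rw [Rcheck_eq]
  exact at2_mul_sprod (fun _ _ _ => Commute.all _ _) (fun _ _ _ => rfl) h

theorem tmul_Dmat (n : ℕ) (q : ℂ) : tmul (Dmat n q) (Dmat n q) =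
    Matrix.diagonal fun p : Fin n × Fin n =>
      q ^ ((n : ℤ) - 1 - 2 * (p.1 : ℤ)) * q ^ ((n : ℤ) - 1 - 2 * (p.2 : ℤ)) := by
  ext ⟨a, b⟩ ⟨c, d⟩
  simp only [tmul, Dmat, Matrix.of_apply, Matrix.diagonal_apply, Prod.mk.injEq]
  split_ifs <;> simp_all

/-- Ř mixes only the tensors `(a, b)` and `(b, a)`, on which `D ⊗ D` has the same eigenvalue. -/
theorem Tmat_commute_Dmat (n : ℕ) (q : ℂ) :
    Commute (Tmat n q) (tmul (Dmat n q) (Dmat n q)) := by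
  rw [tmul_Dmat]
  ext ⟨a, b⟩ ⟨c, d⟩
  rw [Matrix.mul_diagonal, Matrix.diagonal_mul, Tmat_apply]
  by_cases h1 : a = c ∧ b = d
  · obtain ⟨rfl, rfl⟩ := h1
    ring
  by_cases h2 : a = d ∧ b = c
  · obtain ⟨rfl, rfl⟩ := h2
    ring
  rw [if_neg h1, if_neg h2]
  ring

/-- `D_1 … D_m`. -/
def Dprod (n m : ℕ) (q : ℂ) : Matrix (Fin m → Fin n) (Fin m → Fin n) ℂ :=
  sprod fun _ => Dmat n q

theorem Rcheck_commute_Dprod {n m : ℕ} {q : ℂ} (k : Fin (m - 1)) :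
    Commute (Rcheck n q k) (Dprod n m q) := at1_commute_Tmat k (Tmat_commute_Dmat n q)

section Main

variable {n : ℕ} {q : ℂ} {μ : YoungDiagram}

/-- `L⁺_1(z q^{-2c_1(Λ)}) … L⁺_m(z q^{-2c_m(Λ)}) D_1 … D_m`. -/
def LDprod (n : ℕ) (q : ℂ) {μ : YoungDiagram} (Λ : StdTableau μ) :
    Matrix (Fin μ.card → Fin n) (Fin μ.card → Fin n) (UqCrit n q)⟦X⟧ :=
  sprod (fun a => LPlus n q (q ^ (-2 * Λ.content a))) * hat _ (Dprod n μ.card q)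

theorem Sbar_eq (Λ : StdTableau μ) : Sbar n q Λ = (schurElement q μ)⁻¹ •
    (LDprod n q Λ * hat _ (∑ σ, heckeT (youngMatrix q μ) σ⁻¹ Λ Λ • heckeT (Rcheck n q) σ)).trace := by
  rw [Sbar, idempotentOp, idempotent, Matrix.mul_smul, LDprod, ← Matrix.trace_smul]
  congr 1
  change _ * hat (UqCrit n q)⟦X⟧ (_ • (Dprod n μ.card q * _)) = _
  rw [hat_smul, map_mul, mul_smul_comm, ← mul_assoc]
  rfl

theorem LDprod_exchanges (hq0 : q ≠ 0) (hq : ∀ k : ℕ, 0 < k → q ^ k ≠ 1) (μ : YoungDiagram) :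
    Exchanges (Rcheck n q) (youngMatrix q μ) (LDprod n q : StdTableau μ → _) :=
  ((LPlus_exch hq0).exchanges hq0 hq μ).mul_right fun k => (Rcheck_commute_Dprod k).map (hat _)

/-- The equality already holds in the algebra itself, without the vacuum vector. -/
theorem Sbar_eq_Sbar (hq0 : q ≠ 0) (hq : ∀ k : ℕ, 0 < k → q ^ k ≠ 1) (Λ Γ : StdTableau μ) :
    Sbar n q Λ = Sbar n q Γ := by
  rw [Sbar_eq, Sbar_eq, trace_mul_sum_eq hq0 hq (isHecke_Rcheck q hq0 _)
    (LDprod_exchanges hq0 hq μ) Λ Γ]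

theorem exists_Sbar_eq (hq0 : q ≠ 0) (hq : ∀ k : ℕ, 0 < k → q ^ k ≠ 1)
    {e : Matrix ((Fin μ.card → Fin n) × StdTableau μ) ((Fin μ.card → Fin n) × StdTableau μ) ℂ}
    (he : IsKerProj (delta (Rcheck n q) (youngMatrix q μ)) e) : ∃ κ : ℂ, ∀ Λ : StdTableau μ,
      Sbar n q Λ = κ • (Matrix.blockDiagonal (LDprod n q) * hat _ e).trace := by
  obtain ⟨κ, hκ⟩ := exists_trace_eq hq0 hq (isHecke_Rcheck q hq0 _) he
  exact ⟨(schurElement q μ)⁻¹ * κ, fun Λ => by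
    rw [Sbar_eq, hκ _ _ (LDprod_exchanges hq0 hq μ), smul_smul]⟩

end Main

/-! ### The `R`-matrix with matrix entries, its inverse and crossing symmetry -/

section RSeries

variable {n : ℕ} {q : ℂ}

theorem Tmat_sq (hq0 : q ≠ 0) : Tmat n q * Tmat n q = (q - q⁻¹) • Tmat n q + 1 :=
  matrix_ext_single fun F => twoTerm_sq_at (Prod.swap_swap F) (tDiag_sq hq0 F.1 F.2)
    (tDiag_add q F.1 F.2)

/-- Unitarity: by the quadratic relation the terms linear in Ř cancel. This provides the inverse of
the R-matrix. -/
theorem TB_mul_TB {K : Type*} [CommRing K] [Algebra ℂ K] (hq0 : q ≠ 0) (u v : K) :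
    TB n q u v * TB n q v u =
      (u * v * algebraMap ℂ K (q - q⁻¹) ^ 2 - (v - u) ^ 2) • 1 := by
  have h : (Tmat n q).map (algebraMap ℂ K) * (Tmat n q).map (algebraMap ℂ K) =
      algebraMap ℂ K (q - q⁻¹) • (Tmat n q).map (algebraMap ℂ K) + 1 := by
    change hat K (Tmat n q) * hat K (Tmat n q) = _ • hat K (Tmat n q) + 1
    rw [← map_mul, Tmat_sq hq0, map_add, map_one, hat_smul, algebraMap_smul]
  simp only [TB, add_mul, mul_add, smul_mul_assoc, mul_smul_comm, one_mul, mul_one, h, smul_add,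
    smul_smul]
  module

theorem TB_map {K K' : Type*} [CommRing K] [Algebra ℂ K] [CommRing K'] [Algebra ℂ K']
    (φ : K →+* K') (hφ : ∀ c, φ (algebraMap ℂ K c) = algebraMap ℂ K' c) (u v : K)
    (p p' : Fin n × Fin n) : φ (TB n q u v p p') = TB n q (φ u) (φ v) p p' := by
  simp only [TB, Matrix.add_apply, Matrix.smul_apply, Matrix.map_apply, smul_eq_mul, map_add,
    map_sub, map_mul, hφ, Matrix.one_apply]
  split_ifs <;> simp

/-- The matrix `R(t x)`, with matrix entries. -/
def Rs (n : ℕ) (q t : ℂ) : Matrix (Fin n) (Fin n) (Matrix (Fin n) (Fin n) ℂ⟦X⟧) :=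
  PowerSeries.rescale t (rFactor n q) • Smat n q (PowerSeries.X * algebraMap ℂ ℂ⟦X⟧ t) 1

theorem rescale_algebraMap (t c : ℂ) :
    PowerSeries.rescale t (algebraMap ℂ ℂ⟦X⟧ c) = algebraMap ℂ ℂ⟦X⟧ c := by
  change PowerSeries.rescale t (PowerSeries.C c) = PowerSeries.C c
  ext k
  rw [PowerSeries.coeff_rescale, PowerSeries.coeff_C]
  split_ifs with h
  · simp [h]
  · simp

theorem rescale_X_eq (t : ℂ) :
    PowerSeries.rescale t (PowerSeries.X : ℂ⟦X⟧) = PowerSeries.X * algebraMap ℂ ℂ⟦X⟧ t := by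
  rw [PowerSeries.rescale_X, mul_comm]
  rfl

theorem Rs_apply (hq0 : q ≠ 0) (t : ℂ) (α β i j : Fin n) :
    Rs n q t α β i j = PowerSeries.rescale t (Rser n q (α, i) (β, j)) := by
  rw [Rser_apply hq0, map_mul, TB_map _ (rescale_algebraMap t), rescale_X_eq, map_one]
  rfl

theorem Rs_exch (hq0 : q ≠ 0) (s : ℂ) : ExchRel q fun a => Rs n q (s * a) := by
  have h := (Smat_exch (n := n) hq0 (PowerSeries.X * algebraMap ℂ ℂ⟦X⟧ s) 1).smul
    (fun a => PowerSeries.rescale (s * a) (rFactor n q))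
  simp only [mul_assoc, ← map_mul] at h
  exact h

/-- The scalar factor of the inverse `R`-matrix. -/
def qFactor (n : ℕ) (q : ℂ) : ℂ⟦X⟧ :=
  (rFactor n q * (PowerSeries.X * PowerSeries.C (q - q⁻¹) ^ 2 - (1 - PowerSeries.X) ^ 2))⁻¹

theorem mul_qFactor (hq0 : q ≠ 0) : rFactor n q *
    (PowerSeries.X * PowerSeries.C (q - q⁻¹) ^ 2 - (1 - PowerSeries.X) ^ 2) * qFactor n q = 1 :=
  PowerSeries.mul_inv_cancel _ (by simp [constantCoeff_rFactor, hq0])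

/-- The transposed form of the inverse of `R(t x)`. -/
def QsSwap (n : ℕ) (q t : ℂ) : Matrix (Fin n) (Fin n) (Matrix (Fin n) (Fin n) ℂ⟦X⟧) :=
  PowerSeries.rescale t (qFactor n q) • Smat n q 1 (PowerSeries.X * algebraMap ℂ ℂ⟦X⟧ t)

/-- The inverse of the matrix `R(t x)`. -/
def Qs (n : ℕ) (q t : ℂ) : Matrix (Fin n) (Fin n) (Matrix (Fin n) (Fin n) ℂ⟦X⟧) :=
  Matrix.of fun α β => Matrix.of fun i j => QsSwap n q t i j α β

/-- `TB` is homogeneous of degree one, so `TB(1, s a⁻¹ x) = a⁻¹ TB(a, s x)`. Up to a scalar, the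
inverse R-matrix at `s/a` is therefore a solution of the RLL relation in the variable `a`. -/
theorem QsSwap_exch (hq0 : q ≠ 0) (s : ℂ) : ExchRel q fun a => QsSwap n q (s * a⁻¹) := by
  have h := (Smat_exch (n := n) hq0 1 (PowerSeries.X * algebraMap ℂ ℂ⟦X⟧ s)).smul
    (fun a => PowerSeries.rescale (s * a⁻¹) (qFactor n q) * algebraMap ℂ ℂ⟦X⟧ a⁻¹)
  have e : ∀ a : ℂ, a ≠ 0 → QsSwap n q (s * a⁻¹) =
      (PowerSeries.rescale (s * a⁻¹) (qFactor n q) * algebraMap ℂ ℂ⟦X⟧ a⁻¹) •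
        Smat n q (1 * algebraMap ℂ ℂ⟦X⟧ a) (PowerSeries.X * algebraMap ℂ ℂ⟦X⟧ s) := by
    intro a ha
    have ha' : algebraMap ℂ ℂ⟦X⟧ a * algebraMap ℂ ℂ⟦X⟧ a⁻¹ = 1 := by
      rw [← map_mul, mul_inv_cancel₀ ha, map_one]
    rw [QsSwap, mul_smul]
    congr 1
    ext1 α β
    ext1 i j
    simp only [Smat, TB, Matrix.smul_apply, Matrix.of_apply, Matrix.add_apply, smul_eq_mul, map_mul]
    linear_combination (-1 + (Tmat n q).map (algebraMap ℂ ℂ⟦X⟧) (i, α) (β, j)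
      - algebraMap ℂ ℂ⟦X⟧ (q - q⁻¹) * (1 : Matrix _ _ ℂ⟦X⟧) (i, α) (β, j) + 1) * ha'
  intro a b ha hb
  have := h a b ha hb
  simp only [← e a ha, ← e b hb] at this
  exact this

theorem Rs_mul_Qs (hq0 : q ≠ 0) (t : ℂ) : Rs n q t * Qs n q t = 1 := by
  have h1 := TB_mul_TB (n := n) hq0 (PowerSeries.X * algebraMap ℂ ℂ⟦X⟧ t) 1
  have h2 := congrArg (PowerSeries.rescale t) (mul_qFactor (n := n) hq0)
  simp only [map_mul, map_sub, map_pow, map_one, rescale_X_eq] at h2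
  rw [show PowerSeries.rescale t (PowerSeries.C q) = algebraMap ℂ ℂ⟦X⟧ q from
      rescale_algebraMap t q, show PowerSeries.rescale t (PowerSeries.C q⁻¹) =
      algebraMap ℂ ℂ⟦X⟧ q⁻¹ from rescale_algebraMap t q⁻¹, ← map_sub] at h2
  ext1 α β
  ext1 i j
  have h3 := congrFun (congrFun h1 (i, α)) (j, β)
  rw [Matrix.mul_apply, Matrix.smul_apply, smul_eq_mul] at h3
  have h4 : (Rs n q t * Qs n q t) α β i j = PowerSeries.rescale t (rFactor n q) *
      PowerSeries.rescale t (qFactor n q) *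
        ∑ p, TB n q (PowerSeries.X * algebraMap ℂ ℂ⟦X⟧ t) 1 (i, α) p *
          TB n q 1 (PowerSeries.X * algebraMap ℂ ℂ⟦X⟧ t) p (j, β) := by
    rw [Matrix.mul_apply, Matrix.sum_apply, Finset.mul_sum, Fintype.sum_prod_type]
    refine Finset.sum_congr rfl fun γ _ => ?_
    rw [Matrix.mul_apply]
    refine Finset.sum_congr rfl fun c _ => ?_
    simp only [Rs, Qs, QsSwap, Smat, Matrix.smul_apply, Matrix.of_apply, smul_eq_mul]
    ring
  rw [h4, h3]
  have h5 : (1 : Matrix (Fin n) (Fin n) (Matrix (Fin n) (Fin n) ℂ⟦X⟧)) α β i j =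
      (1 : Matrix (Fin n × Fin n) (Fin n × Fin n) ℂ⟦X⟧) (i, α) (j, β) := by
    simp only [Matrix.one_apply, Prod.mk.injEq]
    by_cases ha : α = β <;> by_cases hi : i = j <;> simp [ha, hi, Matrix.one_apply]
  rw [h5]
  generalize (1 : Matrix (Fin n × Fin n) (Fin n × Fin n) ℂ⟦X⟧) (i, α) (j, β) = o
  linear_combination o * h2

theorem TB_apply_diag {K : Type*} [CommRing K] [Algebra ℂ K] (u v : K) (a b : Fin n) :
    TB n q u v (a, b) (a, b) =
      if a = b then v * algebraMap ℂ K q - u * algebraMap ℂ K q⁻¹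
      else if b < a then v * algebraMap ℂ K (q - q⁻¹) else u * algebraMap ℂ K (q - q⁻¹) := by
  simp only [TB, Matrix.add_apply, Matrix.smul_apply, Matrix.map_apply, Tmat_apply, tDiag, tOff,
    Matrix.one_apply_eq, smul_eq_mul]
  by_cases h : a = b
  · subst h
    simp only [and_self, if_true, add_zero, map_sub]
    ring
  · have h' : ¬(a = b ∧ b = a) := fun hh => h hh.1
    rw [if_pos (by simp), if_neg h, if_neg h', if_neg h, add_zero]
    split_ifs
    · ring
    · rw [map_zero]; ring

theorem TB_apply_swap {K : Type*} [CommRing K] [Algebra ℂ K] (u v : K) {a b : Fin n}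
    (h : a ≠ b) : TB n q u v (a, b) (b, a) = v - u := by
  simp [TB, Tmat_apply, tOff, h, h.symm]

theorem TB_apply_of_ne {K : Type*} [CommRing K] [Algebra ℂ K] (u v : K) {a b c d : Fin n}
    (h1 : ¬(a = c ∧ b = d)) (h2 : ¬(a = d ∧ b = c)) : TB n q u v (a, b) (c, d) = 0 := by
  simp only [TB, Matrix.add_apply, Matrix.smul_apply, Matrix.map_apply, Tmat_apply, if_neg h1,
    if_neg h2, Matrix.one_apply, Prod.mk.injEq]
  simp

/-- Each term is `(q - q⁻¹)(W b - W (b + 1))`, plus the main term when `b = i = j`. The sum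
telescopes, and the hypothesis `hx`, which encodes the critical level, makes the boundary terms
cancel. -/
theorem sum_TB_diag_mul {K : Type*} [CommRing K] [Algebra ℂ K] (hq0 : q ≠ 0) {xm xp : K}
    (hx : xm * algebraMap ℂ K (q ^ n) = xp * algebraMap ℂ K (q ^ (-(n : ℤ)))) (i j : Fin n) :
    ∑ b, TB n q 1 xm (j, b) (j, b) * algebraMap ℂ K (q ^ ((n : ℤ) - 1 - 2 * (b : ℤ))) *
        TB n q xp 1 (i, b) (i, b) =
      if i = j then (xm - 1) * (1 - xp) * algebraMap ℂ K (q ^ ((n : ℤ) - 1 - 2 * (i : ℤ)))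
        else 0 := by
  -- `G b` and `G (b + 1)` are the `b`-th entry of `D` times `q` and `q⁻¹`. The factors of `W`
  -- switch as `b` passes `j` and `i`, following the cases of `TB_apply_diag`.
  let G : ℕ → K := fun b => algebraMap ℂ K (q ^ ((n : ℤ) - 2 * (b : ℤ)))
  let W : ℕ → K := fun b => (if b ≤ j.1 then xm else 1) * (if b ≤ i.1 then 1 else xp) * G b
  have hQ : algebraMap ℂ K q * algebraMap ℂ K q⁻¹ = 1 := by
    rw [← map_mul, mul_inv_cancel₀ hq0, map_one]
  have hG0 : ∀ b : ℕ, G b = algebraMap ℂ K (q ^ ((n : ℤ) - 1 - 2 * (b : ℤ))) * algebraMap ℂ K q := by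
    intro b
    rw [← map_mul, ← zpow_add_one₀ hq0]
    simp only [G]
    congr 2
    ring
  have hG1 : ∀ b : ℕ, G (b + 1) =
      algebraMap ℂ K (q ^ ((n : ℤ) - 1 - 2 * (b : ℤ))) * algebraMap ℂ K q⁻¹ := by
    intro b
    rw [← map_mul, ← zpow_sub_one₀ hq0]
    simp only [G]
    congr 2
    push_cast
    ring
  have hterm : ∀ b : Fin n, TB n q 1 xm (j, b) (j, b) *
      algebraMap ℂ K (q ^ ((n : ℤ) - 1 - 2 * (b : ℤ))) * TB n q xp 1 (i, b) (i, b) =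
      algebraMap ℂ K (q - q⁻¹) * (W b - W (b + 1)) + if b = i then if i = j then
        (xm - 1) * (1 - xp) * algebraMap ℂ K (q ^ ((n : ℤ) - 1 - 2 * (i : ℤ))) else 0 else 0 := by
    intro b
    simp only [W]
    rw [TB_apply_diag, TB_apply_diag, hG0, hG1, map_sub]
    rcases lt_trichotomy b i with h1 | rfl | h1 <;> rcases lt_trichotomy b j with h2 | rfl | h2
    · rw [if_neg h2.ne', if_pos h2, if_neg h1.ne', if_pos h1, if_neg h1.ne,
        if_pos (Fin.le_def.1 h2.le), if_pos (Fin.le_def.1 h1.le), if_pos (Nat.succ_le_of_lt h2),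
        if_pos (Nat.succ_le_of_lt h1)]
      ring
    · rw [if_pos rfl, if_neg h1.ne', if_pos h1, if_neg h1.ne,
        if_pos le_rfl, if_pos (Fin.le_def.1 h1.le), if_neg (Nat.not_succ_le_self _),
        if_pos (Nat.succ_le_of_lt h1)]
      ring
    · rw [if_neg h2.ne, if_neg h2.not_gt, if_neg h1.ne', if_pos h1, if_neg h1.ne,
        if_neg (by have := Fin.lt_def.1 h2; omega), if_pos (Fin.le_def.1 h1.le), if_neg (by have := Fin.lt_def.1 h2; omega),
        if_pos (Nat.succ_le_of_lt h1)]
      ring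
    · rw [if_neg h2.ne', if_pos h2, if_pos rfl, if_pos rfl, if_neg h2.ne,
        if_pos (Fin.le_def.1 h2.le), if_pos le_rfl, if_pos (Nat.succ_le_of_lt h2),
        if_neg (Nat.not_succ_le_self _)]
      ring
    · rw [if_pos rfl, if_pos rfl, if_pos rfl, if_pos rfl,
        if_pos le_rfl, if_pos le_rfl, if_neg (Nat.not_succ_le_self _),
        if_neg (Nat.not_succ_le_self _)]
      linear_combination (algebraMap ℂ K (q ^ ((n : ℤ) - 1 - 2 * (b : ℤ))) *
        (xm - 1) * (1 - xp)) * hQ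
    · rw [if_neg h2.ne, if_neg h2.not_gt, if_pos rfl, if_pos rfl, if_neg h2.ne',
        if_neg (by have := Fin.lt_def.1 h2; omega), if_pos le_rfl, if_neg (by have := Fin.lt_def.1 h2; omega),
        if_neg (Nat.not_succ_le_self _)]
      ring
    · rw [if_neg h2.ne', if_pos h2, if_neg h1.ne, if_neg h1.not_gt, if_neg h1.ne',
        if_pos (Fin.le_def.1 h2.le), if_neg (by have := Fin.lt_def.1 h1; omega), if_pos (Nat.succ_le_of_lt h2),
        if_neg (by have := Fin.lt_def.1 h1; omega)]
      ring
    · rw [if_pos rfl, if_neg h1.ne, if_neg h1.not_gt, if_neg h1.ne',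
        if_pos le_rfl, if_neg (by have := Fin.lt_def.1 h1; omega), if_neg (Nat.not_succ_le_self _),
        if_neg (by have := Fin.lt_def.1 h1; omega)]
      ring
    · rw [if_neg h2.ne, if_neg h2.not_gt, if_neg h1.ne, if_neg h1.not_gt, if_neg h1.ne',
        if_neg (by have := Fin.lt_def.1 h2; omega), if_neg (by have := Fin.lt_def.1 h1; omega), if_neg (by have := Fin.lt_def.1 h2; omega),
        if_neg (by have := Fin.lt_def.1 h1; omega)]
      ring
  rw [Finset.sum_congr rfl fun b _ => hterm b, Finset.sum_add_distrib, ← Finset.mul_sum,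
    Fin.sum_univ_eq_sum_range (fun b => W b - W (b + 1)) n, Finset.sum_range_sub',
    Finset.sum_ite_eq' _ i, if_pos (Finset.mem_univ _)]
  have hW : W 0 - W n = 0 := by
    simp only [W, G]
    rw [if_pos (Nat.zero_le _), if_pos (Nat.zero_le _), if_neg (by have := j.2; omega),
      if_neg (by have := i.2; omega)]
    have e1 : q ^ ((n : ℤ) - 2 * ((0 : ℕ) : ℤ)) = q ^ n := by
      simp
    have e2 : (n : ℤ) - 2 * (n : ℤ) = -(n : ℤ) := by ring
    rw [e1, e2]
    linear_combination hx
  rw [hW, mul_zero, zero_add]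

/-- `TB` conserves the pair of indices, leaving two kinds of terms: `b = β` with `α = j` and `γ =
i`, which is the telescoping sum, and for `i = j`, `α = γ ≠ i` the single product of two swap
entries at `β = α`, `b = i`. -/
theorem sum_TB_crossing {K : Type*} [CommRing K] [Algebra ℂ K] (hq0 : q ≠ 0) {xm xp : K}
    (hx : xm * algebraMap ℂ K (q ^ n) = xp * algebraMap ℂ K (q ^ (-(n : ℤ)))) (i j α γ : Fin n) :
    ∑ b, ∑ β, TB n q 1 xm (α, b) (j, β) *
        (algebraMap ℂ K (q ^ ((n : ℤ) - 1 - 2 * (β : ℤ))) * TB n q xp 1 (i, β) (γ, b)) =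
      if i = j ∧ α = γ then
        (xm - 1) * (1 - xp) * algebraMap ℂ K (q ^ ((n : ℤ) - 1 - 2 * (α : ℤ))) else 0 := by
  have hterm : ∀ b β, TB n q 1 xm (α, b) (j, β) *
        (algebraMap ℂ K (q ^ ((n : ℤ) - 1 - 2 * (β : ℤ))) * TB n q xp 1 (i, β) (γ, b)) =
      (if b = β then if α = j ∧ γ = i then TB n q 1 xm (j, b) (j, b) *
        algebraMap ℂ K (q ^ ((n : ℤ) - 1 - 2 * (b : ℤ))) * TB n q xp 1 (i, b) (i, b) else 0 else 0)
      + if α = β then if b = i then if i = j ∧ α = γ ∧ α ≠ i then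
        (xm - 1) * (1 - xp) * algebraMap ℂ K (q ^ ((n : ℤ) - 1 - 2 * (α : ℤ))) else 0 else 0
          else 0 := by
    intro b β
    by_cases h1 : α = j ∧ b = β
    · obtain ⟨rfl, rfl⟩ := h1
      have h2 : (if α = b then if b = i then if i = α ∧ α = γ ∧ α ≠ i then
          (xm - 1) * (1 - xp) * algebraMap ℂ K (q ^ ((n : ℤ) - 1 - 2 * (α : ℤ))) else 0 else 0
          else 0) = 0 := by
        rw [if_neg (c := i = α ∧ α = γ ∧ α ≠ i) (by tauto)]
        simp
      rw [h2, add_zero, if_pos rfl]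
      by_cases h3 : γ = i
      · subst h3
        rw [if_pos ⟨rfl, rfl⟩]
        ring
      · rw [if_neg (by tauto)]
        by_cases h4 : i = b ∧ b = γ
        · exact absurd (h4.1.trans h4.2).symm h3
        · have z : TB n q xp 1 (i, b) (γ, b) = 0 := TB_apply_of_ne _ _ (by tauto) (by tauto)
          rw [z]
          ring
    · have h2 : (if b = β then if α = j ∧ γ = i then TB n q 1 xm (j, b) (j, b) *
        algebraMap ℂ K (q ^ ((n : ℤ) - 1 - 2 * (b : ℤ))) * TB n q xp 1 (i, b) (i, b) else 0
          else 0) = 0 := by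
        split_ifs <;> first | rfl | tauto
      rw [h2, zero_add]
      by_cases h3 : α = β ∧ b = j
      · obtain ⟨rfl, rfl⟩ := h3
        have hab : α ≠ b := fun e => h1 ⟨e, e.symm⟩
        rw [TB_apply_swap _ _ hab, if_pos rfl]
        by_cases h4 : b = i
        · subst h4
          rw [if_pos rfl]
          by_cases h5 : α = γ
          · subst h5
            rw [TB_apply_swap _ _ hab.symm, if_pos ⟨rfl, rfl, hab⟩]
            ring
          · have z : TB n q xp 1 (b, α) (γ, b) = 0 := TB_apply_of_ne _ _ (by tauto) (by tauto)
            rw [if_neg (by tauto), z]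
            ring
        · have z : TB n q xp 1 (i, α) (γ, b) = 0 := TB_apply_of_ne _ _ (by tauto) (by tauto)
          rw [if_neg h4, z]
          ring
      · have z : TB n q 1 xm (α, b) (j, β) = 0 := TB_apply_of_ne _ _ h1 h3
        rw [z, zero_mul]
        split_ifs <;> first | rfl | (exfalso; apply h3; subst_vars; tauto)
  simp only [hterm, Finset.sum_add_distrib, Finset.sum_ite_eq, Finset.mem_univ, if_true,
    Finset.sum_ite_eq']
  by_cases h : α = j ∧ γ = i
  · obtain ⟨rfl, rfl⟩ := h
    simp only [and_self, if_true]
    rw [sum_TB_diag_mul hq0 hx]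
    by_cases e : γ = α
    · subst e; simp
    · rw [if_neg e, if_neg (by tauto), if_neg (by tauto), add_zero]
  · simp only [if_neg h, Finset.sum_const_zero, zero_add]
    refine if_congr ?_ rfl rfl
    constructor
    · tauto
    · rintro ⟨rfl, rfl⟩
      exact ⟨rfl, rfl, fun e => h ⟨e, e⟩⟩

end RSeries

section Crossing

variable {n : ℕ} {q : ℂ}

theorem rFactor_mul_den (hq0 : q ≠ 0) :
    rFactor n q * (PowerSeries.C q - PowerSeries.C q⁻¹ * PowerSeries.X) = fSeries n q := by
  rw [rFactor, mul_assoc, mul_comm _ (PowerSeries.C q - _), den_mul_inv hq0, mul_one]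

theorem gSeries_mul (n : ℕ) (q : ℂ) :
    gSeries n q * ((1 - PowerSeries.X) * (1 - PowerSeries.C (q ^ (2 * n)) * PowerSeries.X)) =
      (1 - PowerSeries.C (q ^ 2) * PowerSeries.X) *
        (1 - PowerSeries.C (q ^ (2 * (n : ℤ) - 2)) * PowerSeries.X) := by
  rw [gSeries, mul_assoc, PowerSeries.inv_mul_cancel _ (by simp), mul_one]

theorem rescale_C (t c : ℂ) :
    PowerSeries.rescale t (PowerSeries.C c) = (PowerSeries.C c : ℂ⟦X⟧) := rescale_algebraMap t c

theorem rescale_X' (t : ℂ) :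
    PowerSeries.rescale t (PowerSeries.X : ℂ⟦X⟧) = PowerSeries.X * PowerSeries.C t :=
  rescale_X_eq t

/-- Here the functional equation of `f` enters: after the substitution `x ↦ q⁻ⁿ c x` it relates the
normalizations at the shifts `q⁻ⁿ` and `qⁿ`, and its rational factor matches the crossing and
unitarity scalars. -/
theorem crossing_factor (hn : 1 ≤ n) (hq0 : q ≠ 0) (hq : ∀ k : ℕ, 0 < k → q ^ k ≠ 1) (c : ℂ) :
    PowerSeries.rescale (q ^ (-(n : ℤ)) * c) (qFactor n q) *
      PowerSeries.rescale (q ^ n * c) (rFactor n q) *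
        ((PowerSeries.X * PowerSeries.C (q ^ (-(n : ℤ)) * c) - 1) *
          (1 - PowerSeries.X * PowerSeries.C (q ^ n * c))) = 1 := by
  set tm := q ^ (-(n : ℤ)) * c with htm
  set tp := q ^ n * c with htp
  have hqn : q ^ n ≠ 0 := pow_ne_zero _ hq0
  have hp : tp = tm * q ^ (2 * n) := by
    rw [htm, htp, zpow_neg, zpow_natCast, pow_mul', sq]
    field_simp
  have hp2 : tm * q ^ (2 * (n : ℤ) - 2) = tp * (q⁻¹) ^ 2 := by
    have : q ^ (2 * (n : ℤ) - 2) = q ^ (2 * n) * q⁻¹ ^ 2 := by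
      rw [zpow_sub₀ hq0, div_eq_mul_inv, inv_pow]
      norm_cast
    rw [hp, this]
    ring
  have h1 := congrArg (PowerSeries.rescale tm) (fSeries_functional hn hq)
  rw [PowerSeries.rescale_rescale, mul_comm (q ^ (2 * n)), ← hp, map_mul] at h1
  have h2 := congrArg (PowerSeries.rescale tm) (gSeries_mul n q)
  have h3 := congrArg (PowerSeries.rescale tm) (rFactor_mul_den (n := n) hq0)
  have h4 := congrArg (PowerSeries.rescale tp) (rFactor_mul_den (n := n) hq0)
  have h5 := congrArg (PowerSeries.rescale tm) (mul_qFactor (n := n) hq0)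
  simp only [map_mul, map_sub, map_pow, map_one, rescale_C, rescale_X'] at h2 h3 h4 h5
  have e1 : (PowerSeries.C q : ℂ⟦X⟧) * PowerSeries.C q⁻¹ = 1 := by
    rw [← map_mul, mul_inv_cancel₀ hq0, map_one]
  have e2 : (PowerSeries.C q : ℂ⟦X⟧) ^ (2 * n) * PowerSeries.C tm = PowerSeries.C tp := by
    rw [← map_pow, ← map_mul, hp, mul_comm]
  have e3 : (PowerSeries.C (q ^ (2 * (n : ℤ) - 2)) : ℂ⟦X⟧) * PowerSeries.C tm =
      PowerSeries.C tp * PowerSeries.C q⁻¹ ^ 2 := by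
    rw [← map_mul, mul_comm, hp2, map_mul, map_pow]
  -- This factor completes the scalar `rFactor` at the shift `qⁿ` to `f`. It is nonzero and is
  -- cancelled at the end.
  have hden : (PowerSeries.C q - PowerSeries.C q⁻¹ * (PowerSeries.X * PowerSeries.C tp) : ℂ⟦X⟧) ≠
      0 := by
    intro h
    have := congrArg PowerSeries.constantCoeff h
    simp [hq0] at this
  refine mul_right_cancel₀ hden ?_
  rw [one_mul]
  generalize PowerSeries.rescale tm (fSeries n q) = Fm at *
  generalize PowerSeries.rescale tp (fSeries n q) = Fp at *
  generalize PowerSeries.rescale tm (rFactor n q) = rm at *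
  generalize PowerSeries.rescale tp (rFactor n q) = rp at *
  generalize PowerSeries.rescale tm (qFactor n q) = Q at *
  generalize PowerSeries.rescale tm (gSeries n q) = g at *
  generalize (PowerSeries.C (q ^ (2 * (n : ℤ) - 2)) : ℂ⟦X⟧) = C2 at *
  generalize (PowerSeries.C q : ℂ⟦X⟧) ^ (2 * n) = C3 at *
  generalize (PowerSeries.C q⁻¹ : ℂ⟦X⟧) = u at *
  generalize (PowerSeries.C q : ℂ⟦X⟧) = v at *
  generalize (PowerSeries.C tm : ℂ⟦X⟧) = a at *
  generalize (PowerSeries.C tp : ℂ⟦X⟧) = b at *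
  generalize (PowerSeries.X : ℂ⟦X⟧) = x at *
  -- `k1` is the rational factor of the functional equation with denominators cleared, `k2` factors
  -- the unitarity scalar, and `k3` is the functional equation itself.
  have k1 : g * ((1 - x * a) * (1 - x * b)) = (1 - v ^ 2 * (x * a)) * (1 - u ^ 2 * (x * b)) := by
    linear_combination h2 + g * (1 - x * a) * x * e2 - (1 - v ^ 2 * (x * a)) * x * e3
  have k2 : x * a * (v - u) ^ 2 - (1 - x * a) ^ 2 = -(1 - v ^ 2 * (x * a)) * (1 - u ^ 2 * (x * a)) := by
    linear_combination (-2 * x * a + (x * a) ^ 2 * (v * u + 1)) * e1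
  rw [k2] at h5
  have k3 : Fp * ((1 - x * a) * (1 - x * b)) = Fm * ((1 - v ^ 2 * (x * a)) * (1 - u ^ 2 * (x * b))) := by
    rw [h1, mul_assoc, k1]
  calc Q * rp * ((x * a - 1) * (1 - x * b)) * (v - u * (x * b))
      = -(Q * (Fp * ((1 - x * a) * (1 - x * b)))) := by rw [← h4]; ring
    _ = -(Q * (rm * (v - u * (x * a)) * ((1 - v ^ 2 * (x * a)) * (1 - u ^ 2 * (x * b))))) := by
        rw [k3, ← h3]
    _ = v - u * (x * b) := by
        have k4 : ∀ y, v - u * y = v * (1 - u ^ 2 * y) := fun y => by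
          linear_combination (u * y) * e1
        rw [k4, k4]
        linear_combination (v * (1 - u ^ 2 * (x * b))) * h5

/-- Crossing symmetry: the contraction of indices is that of `sum_TB_crossing`, and
`crossing_factor` makes the resulting scalar exactly one. -/
theorem crossing_entry (hn : 1 ≤ n) (hq0 : q ≠ 0) (hq : ∀ k : ℕ, 0 < k → q ^ k ≠ 1) (c : ℂ)
    (i j α γ : Fin n) : ∑ b, ∑ β, Qs n q (q ^ (-(n : ℤ)) * c) α β b j *
      (algebraMap ℂ ℂ⟦X⟧ (q ^ ((n : ℤ) - 1 - 2 * (β : ℤ))) * Rs n q (q ^ n * c) β γ i b) =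
      if i = j ∧ α = γ then algebraMap ℂ ℂ⟦X⟧ (q ^ ((n : ℤ) - 1 - 2 * (α : ℤ))) else 0 := by
  have hx : PowerSeries.X * algebraMap ℂ ℂ⟦X⟧ (q ^ (-(n : ℤ)) * c) * algebraMap ℂ ℂ⟦X⟧ (q ^ n) =
      PowerSeries.X * algebraMap ℂ ℂ⟦X⟧ (q ^ n * c) * algebraMap ℂ ℂ⟦X⟧ (q ^ (-(n : ℤ))) := by
    rw [mul_assoc, mul_assoc, ← map_mul, ← map_mul]
    congr 2
    ring
  have h := sum_TB_crossing (n := n) hq0 hx i j α γ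
  have e : ∀ b β, Qs n q (q ^ (-(n : ℤ)) * c) α β b j *
      (algebraMap ℂ ℂ⟦X⟧ (q ^ ((n : ℤ) - 1 - 2 * (β : ℤ))) * Rs n q (q ^ n * c) β γ i b) =
      PowerSeries.rescale (q ^ (-(n : ℤ)) * c) (qFactor n q) *
        PowerSeries.rescale (q ^ n * c) (rFactor n q) *
      (TB n q 1 (PowerSeries.X * algebraMap ℂ ℂ⟦X⟧ (q ^ (-(n : ℤ)) * c)) (α, b) (j, β) *
        (algebraMap ℂ ℂ⟦X⟧ (q ^ ((n : ℤ) - 1 - 2 * (β : ℤ))) *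
          TB n q (PowerSeries.X * algebraMap ℂ ℂ⟦X⟧ (q ^ n * c)) 1 (i, β) (γ, b))) := by
    intro b β
    simp only [Rs, Qs, QsSwap, Smat, Matrix.smul_apply, Matrix.of_apply, smul_eq_mul]
    ring
  simp only [e, ← Finset.mul_sum, h]
  split_ifs with h1
  · rw [← mul_assoc]
    exact (congrArg (· * _) (crossing_factor hn hq0 hq c)).trans (one_mul _)
  · rw [mul_zero]

end Crossing

/-! ### Ordered products with matrix entries -/

/-- Matrices with matrix entries, with the two levels interchanged. -/
def swapNest (I J R : Type*) [Fintype I] [DecidableEq I] [Fintype J] [DecidableEq J] [Ring R] :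
    Matrix I I (Matrix J J R) ≃+* Matrix J J (Matrix I I R) where
  toFun M := Matrix.of fun i j => Matrix.of fun x y => M x y i j
  invFun M := Matrix.of fun x y => Matrix.of fun i j => M i j x y
  left_inv _ := rfl
  right_inv _ := rfl
  map_add' _ _ := rfl
  map_mul' M N := by
    ext i j x y
    simp only [Matrix.mul_apply, Matrix.of_apply, Matrix.sum_apply]
    exact Finset.sum_comm

theorem swapNest_apply {I J R : Type*} [Fintype I] [DecidableEq I] [Fintype J] [DecidableEq J]
    [Ring R] (M : Matrix I I (Matrix J J R)) (i j : J) (x y : I) :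
    swapNest I J R M i j x y = M x y i j := rfl

section SiteHom

variable {m n : ℕ} {Θ C : Type*} [Fintype Θ] [DecidableEq Θ] [Ring C]

/-- `C ↦ C_a` as a ring homomorphism. -/
def at1Hom (m n : ℕ) (C : Type*) [Ring C] (a : Fin m) :
    Matrix (Fin n) (Fin n) C →+* Matrix (Fin m → Fin n) (Fin m → Fin n) C where
  toFun := at1 a
  map_one' := at1_one a
  map_mul' := at1_mul a
  map_zero' := by ext I J; simp [at1_apply]
  map_add' := at1_add a

/-- The operator acting in the `a`-th tensor factor, depending on the index `Λ`. -/
def siteHom (m n : ℕ) (Θ C : Type*) [Fintype Θ] [DecidableEq Θ] [Ring C] (a : Fin m) :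
    (Θ → Matrix (Fin n) (Fin n) C) →+* Matrix ((Fin m → Fin n) × Θ) ((Fin m → Fin n) × Θ) C :=
  (Matrix.blockDiagonalRingHom (Fin m → Fin n) Θ C).comp
    (RingHom.pi fun Λ => (at1Hom m n C a).comp (Pi.evalRingHom _ Λ))

theorem siteHom_apply (a : Fin m) (f : Θ → Matrix (Fin n) (Fin n) C) :
    siteHom m n Θ C a f = Matrix.blockDiagonal fun Λ => at1 a (f Λ) := rfl

theorem prod_siteHom (f : Fin m → Θ → Matrix (Fin n) (Fin n) C) :
    (List.ofFn fun a => siteHom m n Θ C a (f a)).prod =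
      Matrix.blockDiagonal fun Λ => sprod fun a => f a Λ := by
  have h : ∀ l : List (Fin m), (l.map fun a => siteHom m n Θ C a (f a)).prod =
      Matrix.blockDiagonalRingHom (Fin m → Fin n) Θ C
        fun Λ => (l.map fun a => at1 a (f a Λ)).prod := by
    intro l
    induction l with
    | nil => exact (map_one _).symm
    | cons a l ih =>
      rw [List.map_cons, List.prod_cons, ih, siteHom, RingHom.comp_apply, ← map_mul]
      rfl
  rw [List.ofFn_eq_map, h]
  simp only [sprod, List.ofFn_eq_map]
  rfl

theorem siteHom_commute {a b : Fin m} (hab : a ≠ b) {f g : Θ → Matrix (Fin n) (Fin n) C}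
    (h : ∀ Λ i j k l, Commute (f Λ i j) (g Λ k l)) :
    Commute (siteHom m n Θ C a f) (siteHom m n Θ C b g) := by
  rw [siteHom_apply, siteHom_apply, Commute, SemiconjBy, ← Matrix.blockDiagonal_mul,
    ← Matrix.blockDiagonal_mul]
  congr 1
  funext Λ
  exact at1_commute hab (h Λ)

theorem siteHom_scalar (a : Fin m) (c : C) :
    siteHom m n Θ C a (fun _ => Matrix.scalar (Fin n) c) =
      Matrix.scalar ((Fin m → Fin n) × Θ) c := by
  ext ⟨I, Λ⟩ ⟨J, Γ⟩
  simp only [siteHom_apply, Matrix.blockDiagonal_apply, at1_apply, Matrix.scalar_apply,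
    Matrix.diagonal_apply, Prod.mk.injEq, ← ite_and]
  refine if_congr ⟨fun h => ⟨funext fun b => ?_, h.1⟩, by rintro ⟨rfl, rfl⟩; simp⟩ rfl rfl
  by_cases hb : b = a
  · rw [hb]; exact h.2.2
  · exact h.2.1 b hb

/-- The operator acting in the `a`-th tensor factor, with matrix entries. -/
def nestHom (m n : ℕ) (Θ J R : Type*) [Fintype Θ] [DecidableEq Θ] [Fintype J] [DecidableEq J]
    [Ring R] (a : Fin m) : (Θ → Matrix (Fin n) (Fin n) (Matrix J J R)) →+*
      Matrix J J (Matrix ((Fin m → Fin n) × Θ) ((Fin m → Fin n) × Θ) R) :=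
  (swapNest ((Fin m → Fin n) × Θ) J R).toRingHom.comp (siteHom m n Θ (Matrix J J R) a)

end SiteHom

section ListProd

variable {S : Type*} [Ring S]

theorem commute_prod_ofFn {m : ℕ} {g : Fin m → S} {x : S} (h : ∀ a, Commute x (g a)) :
    Commute x (List.ofFn g).prod :=
  Commute.list_prod_right _ _ fun y hy => by
    obtain ⟨a, rfl⟩ := (List.mem_ofFn' _ _).1 hy
    exact h a

/-- Moving an element through two ordered products. -/
theorem prod_mul_prod_mul_eq {m : ℕ} (r l r' : Fin m → S) (c : S)
    (h : ∀ a, r a * l a * c = c * l a * r' a) (hrl : ∀ a b, a ≠ b → Commute (r a) (l b))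
    (hrl' : ∀ a b, a ≠ b → Commute (r' a) (l b)) :
    (List.ofFn r).prod * (List.ofFn l).prod * c = c * (List.ofFn l).prod * (List.ofFn r').prod := by
  induction m with
  | zero => simp
  | succ m ih =>
    have ih' := ih (fun a => r a.succ) (fun a => l a.succ) (fun a => r' a.succ)
      (fun a => h a.succ) (fun a b hab => hrl _ _ (by simpa using hab))
      (fun a b hab => hrl' _ _ (by simpa using hab))
    have c1 : Commute (l 0) (List.ofFn fun a => r (Fin.succ a)).prod :=
      commute_prod_ofFn fun a => (hrl _ _ (Fin.succ_ne_zero a)).symm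
    have c2 : Commute (r' 0) (List.ofFn fun a => l (Fin.succ a)).prod :=
      commute_prod_ofFn fun a => hrl' _ _ (Fin.succ_ne_zero a).symm
    simp only [List.ofFn_succ, List.prod_cons]
    generalize (List.ofFn fun a => r (Fin.succ a)).prod = x at *
    generalize (List.ofFn fun a => l (Fin.succ a)).prod = y at *
    generalize (List.ofFn fun a => r' (Fin.succ a)).prod = z at *
    calc r 0 * x * (l 0 * y) * c = r 0 * (x * l 0) * y * c := by simp only [mul_assoc]
      _ = r 0 * l 0 * (x * y * c) := by rw [← c1.eq]; simp only [mul_assoc]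
      _ = (r 0 * l 0 * c) * y * z := by rw [ih']; simp only [mul_assoc]
      _ = c * l 0 * (r' 0 * y) * z := by rw [h]; simp only [mul_assoc]
      _ = c * (l 0 * y) * (r' 0 * z) := by rw [c2.eq]; simp only [mul_assoc]

/-- Moving an element through an ordered product and a product in the opposite order. -/
theorem prod_reverse_mul_mul_eq {m : ℕ} (r l : Fin m → S) (c : S)
    (h : ∀ a, r a * c * l a = l a * c * r a) (hrl : ∀ a b, a ≠ b → Commute (r a) (l b)) :
    (List.ofFn r).reverse.prod * c * (List.ofFn l).prod =
      (List.ofFn l).prod * c * (List.ofFn r).reverse.prod := by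
  induction m with
  | zero => simp
  | succ m ih =>
    have ih' := ih (fun a => r a.succ) (fun a => l a.succ)
      (fun a => h a.succ) (fun a b hab => hrl _ _ (by simpa using hab))
    have c1 : Commute (l 0) (List.ofFn fun a => r (Fin.succ a)).reverse.prod :=
      Commute.list_prod_right _ _ fun y hy => by
        obtain ⟨a, rfl⟩ := (List.mem_ofFn' _ _).1 (List.mem_reverse.1 hy)
        exact (hrl _ _ (Fin.succ_ne_zero a)).symm
    have c2 : Commute (r 0) (List.ofFn fun a => l (Fin.succ a)).prod :=
      commute_prod_ofFn fun a => hrl _ _ (Fin.succ_ne_zero a).symm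
    simp only [List.ofFn_succ, List.prod_cons, List.reverse_cons, List.prod_append, List.prod_nil,
      mul_one]
    generalize (List.ofFn fun a => r (Fin.succ a)).reverse.prod = x at *
    generalize (List.ofFn fun a => l (Fin.succ a)).prod = y at *
    calc x * r 0 * c * (l 0 * y) = x * (r 0 * c * l 0) * y := by simp only [mul_assoc]
      _ = (x * l 0) * c * (r 0 * y) := by rw [h]; simp only [mul_assoc]
      _ = l 0 * (x * c * y) * r 0 := by rw [c2.eq, ← c1.eq]; simp only [mul_assoc]
      _ = l 0 * y * c * (x * r 0) := by rw [ih']; simp only [mul_assoc]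

theorem prod_mul_prod_reverse {m : ℕ} (f g : Fin m → S) (h : ∀ a, f a * g a = 1) :
    (List.ofFn f).prod * (List.ofFn g).reverse.prod = 1 := by
  induction m with
  | zero => simp
  | succ m ih =>
    have ih' := ih (fun a => f a.succ) (fun a => g a.succ) fun a => h _
    simp only [List.ofFn_succ, List.prod_cons, List.reverse_cons, List.prod_append, List.prod_nil,
      mul_one]
    rw [mul_assoc, ← mul_assoc _ _ (g 0), ih', one_mul, h]

theorem prod_reverse_mul_prod {m : ℕ} (f g : Fin m → S) (h : ∀ a, g a * f a = 1) :
    (List.ofFn g).reverse.prod * (List.ofFn f).prod = 1 := by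
  induction m with
  | zero => simp
  | succ m ih =>
    have ih' := ih (fun a => f a.succ) (fun a => g a.succ) fun a => h _
    simp only [List.ofFn_succ, List.prod_cons, List.reverse_cons, List.prod_append, List.prod_nil,
      mul_one]
    rw [mul_assoc, ← mul_assoc (g 0), h, one_mul, ih']

theorem isUnit_prod_ofFn {m : ℕ} {f : Fin m → S} (h : ∀ a, IsUnit (f a)) :
    IsUnit (List.ofFn f).prod :=
  List.prod_isUnit fun y hy => by
    obtain ⟨a, rfl⟩ := (List.mem_ofFn' _ _).1 hy
    exact h a

variable {J : Type*} [Fintype J] [DecidableEq J]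

theorem entry_commute_list_prod {x : S} (l : List (Matrix J J S))
    (hl : ∀ y ∈ l, ∀ i j, Commute x (y i j)) (i j : J) : Commute x (l.prod i j) := by
  induction l generalizing i j with
  | nil =>
    rw [List.prod_nil, Matrix.one_apply]
    split_ifs
    · exact Commute.one_right _
    · exact Commute.zero_right _
  | cons y l ih =>
    rw [List.prod_cons, Matrix.mul_apply]
    exact Commute.sum_right _ _ _ fun k _ => (hl y (by simp) i k).mul_right
      (ih (fun y' hy' => hl y' (by simp [hy'])) k j)

theorem entry_commute_prod_reverse {m : ℕ} {g : Fin m → Matrix J J S} {x : S}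
    (h : ∀ a i j, Commute x (g a i j)) (i j : J) :
    Commute x ((List.ofFn g).reverse.prod i j) :=
  entry_commute_list_prod _ (fun y hy => by
    obtain ⟨a, rfl⟩ := (List.mem_ofFn' _ _).1 (List.mem_reverse.1 hy)
    exact h a) i j

/-- Crossing symmetry for ordered products. -/
theorem crossing_prod {m : ℕ} (M N : Fin m → Matrix J J S) (D : Fin m → S)
    (h : ∀ a i j, ∑ b, N a b j * D a * M a i b = if i = j then D a else 0)
    (hNN : ∀ a b, a ≠ b → ∀ i j k l, Commute (N a i j) (N b k l))
    (hNM : ∀ a b, a ≠ b → ∀ i j k l, Commute (N a i j) (M b k l))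
    (hND : ∀ a b, a ≠ b → ∀ i j, Commute (N a i j) (D b))
    (hDM : ∀ a b, a ≠ b → ∀ i j, Commute (D a) (M b i j)) (i j : J) :
    ∑ b, (List.ofFn N).reverse.prod b j * (List.ofFn D).prod * (List.ofFn M).prod i b =
      if i = j then (List.ofFn D).prod else 0 := by
  induction m generalizing i j with
  | zero => simp [Matrix.one_apply]
  | succ m ih =>
    have ih' := ih (fun a => M a.succ) (fun a => N a.succ) (fun a => D a.succ)
      (fun a => h _) (fun a b hab => hNN _ _ (by simpa using hab))
      (fun a b hab => hNM _ _ (by simpa using hab)) (fun a b hab => hND _ _ (by simpa using hab))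
      (fun a b hab => hDM _ _ (by simpa using hab))
    have c1 : ∀ i j k l, Commute (N 0 k l) ((List.ofFn fun a => N (Fin.succ a)).reverse.prod i j) :=
      fun i j k l => entry_commute_prod_reverse
        (fun a i j => hNN _ _ (Fin.succ_ne_zero a).symm k l i j) i j
    have c2 : ∀ i j, Commute (D 0) ((List.ofFn fun a => N (Fin.succ a)).reverse.prod i j) :=
      fun i j => entry_commute_prod_reverse
        (fun a i j => (hND _ _ (Fin.succ_ne_zero a) i j).symm) i j
    have c3 : ∀ i j k l, Commute (M 0 k l) ((List.ofFn fun a => N (Fin.succ a)).reverse.prod i j) :=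
      fun i j k l => entry_commute_prod_reverse
        (fun a i j => (hNM _ _ (Fin.succ_ne_zero a) i j k l).symm) i j
    have c4 : ∀ k l, Commute (M 0 k l) (List.ofFn fun a => D (Fin.succ a)).prod :=
      fun k l => commute_prod_ofFn fun a => (hDM _ _ (Fin.succ_ne_zero a) k l).symm
    simp only [List.ofFn_succ, List.prod_cons, List.reverse_cons, List.prod_append, List.prod_nil,
      mul_one]
    generalize (List.ofFn fun a => N (Fin.succ a)).reverse.prod = x at *
    generalize (List.ofFn fun a => D (Fin.succ a)).prod = y at *
    generalize (List.ofFn fun a => M (Fin.succ a)).prod = z at *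
    -- The entries of site `0` are moved to the left of all others. The sum over `b` then involves
    -- the remaining sites only and collapses by induction, after which `h` handles site `0`.
    have key : ∀ b, (x * N 0) b j * (D 0 * y) * (M 0 * z) i b =
        ∑ c, ∑ d, N 0 c j * D 0 * M 0 i d * (x b c * y * z d b) := by
      intro b
      rw [Matrix.mul_apply, Matrix.mul_apply, Finset.sum_mul, Finset.sum_mul]
      refine Finset.sum_congr rfl fun c _ => ?_
      rw [Finset.mul_sum]
      refine Finset.sum_congr rfl fun d _ => ?_
      calc x b c * N 0 c j * (D 0 * y) * (M 0 i d * z d b)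
          = N 0 c j * (x b c * D 0) * (y * M 0 i d) * z d b := by
            rw [← (c1 b c c j).eq]; simp only [mul_assoc]
        _ = N 0 c j * D 0 * (x b c * M 0 i d) * y * z d b := by
            rw [← (c2 b c).eq, ← (c4 i d).eq]; simp only [mul_assoc]
        _ = N 0 c j * D 0 * M 0 i d * (x b c * y * z d b) := by
            rw [← (c3 b c i d).eq]; simp only [mul_assoc]
    simp only [key]
    rw [Finset.sum_comm]
    have : ∀ c, ∑ b, ∑ d, N 0 c j * D 0 * M 0 i d * (x b c * y * z d b) =
        N 0 c j * D 0 * M 0 i c * y := by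
      intro c
      rw [Finset.sum_comm]
      simp only [← Finset.mul_sum, ih']
      simp
    simp only [this]
    rw [← Finset.sum_mul, h]
    split_ifs <;> simp

end ListProd

section CentralEntries

variable {V B : Type*} [Fintype V] [DecidableEq V] [Ring B]

/-- The entries of a matrix are central. -/
def CentralEntries (Q : Matrix V V B) : Prop := ∀ i j b, Commute (Q i j) b

theorem CentralEntries.mul {Q Q' : Matrix V V B} (h : CentralEntries Q) (h' : CentralEntries Q') :
    CentralEntries (Q * Q') := fun i j b => by
  rw [Matrix.mul_apply]
  exact Commute.sum_left _ _ _ fun k _ => (h i k b).mul_left (h' k j b)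

theorem CentralEntries.trace_mul_comm {Q : Matrix V V B} (h : CentralEntries Q)
    (Y : Matrix V V B) : (Q * Y).trace = (Y * Q).trace := by
  simp only [Matrix.trace, Matrix.diag, Matrix.mul_apply]
  rw [Finset.sum_comm]
  exact Finset.sum_congr rfl fun i _ => Finset.sum_congr rfl fun j _ => (h _ _ _).eq

theorem CentralEntries.scalar_commute {Q : Matrix V V B} (h : CentralEntries Q) (b : B) :
    Commute (Matrix.scalar V b) Q := by
  ext i j
  rw [Matrix.scalar_apply, Matrix.diagonal_mul, Matrix.mul_diagonal]
  exact (h i j b).eq.symm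

theorem hat_centralEntries [Algebra ℂ B] (M : Matrix V V ℂ) : CentralEntries (hat B M) :=
  fun _ _ b => Algebra.commutes _ b

/-- Cyclicity of the trace on a subspace preserved by both factors. -/
theorem trace_rotate {Q Y e : Matrix V V B} (hQ : CentralEntries Q) (he : CentralEntries e)
    (hQe : e * (Q * e) = Q * e) (hYe : e * (Y * e) = Y * e) :
    (Q * Y * e).trace = (Y * Q * e).trace := by
  calc (Q * Y * e).trace = ((Q * e) * (Y * e)).trace := by
        rw [mul_assoc Q, mul_assoc Q, hYe]
    _ = ((Y * e) * (Q * e)).trace := (hQ.mul he).trace_mul_comm _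
    _ = (Y * Q * e).trace := by rw [mul_assoc Y, hQe, mul_assoc]

theorem trace_scalar_mul (b : B) (Y : Matrix V V B) :
    (Matrix.scalar V b * Y).trace = b * Y.trace := by
  simp [Matrix.trace, Matrix.scalar_apply, Finset.mul_sum]

theorem trace_mul_scalar (b : B) (Y : Matrix V V B) :
    (Y * Matrix.scalar V b).trace = Y.trace * b := by
  simp [Matrix.trace, Matrix.scalar_apply, Finset.sum_mul]

end CentralEntries

section Nest

variable {m n : ℕ} {Θ J R : Type*} [Fintype Θ] [DecidableEq Θ] [Fintype J] [DecidableEq J]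
  [Ring R]

theorem nestHom_entry (a : Fin m) (f : Θ → Matrix (Fin n) (Fin n) (Matrix J J R)) (i j : J) :
    nestHom m n Θ J R a f i j =
      siteHom m n Θ R a fun Λ => Matrix.of fun α β => f Λ α β i j := by
  ext ⟨I, Λ⟩ ⟨I', Γ⟩
  change siteHom m n Θ (Matrix J J R) a f (I, Λ) (I', Γ) i j = _
  simp only [siteHom_apply, Matrix.blockDiagonal_apply, at1_apply, Matrix.of_apply]
  split_ifs <;> rfl

/-- The ordered product of operators with matrix entries. -/
def nestProd (F : Θ → Fin m → Matrix (Fin n) (Fin n) (Matrix J J R)) :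
    Matrix J J (Matrix ((Fin m → Fin n) × Θ) ((Fin m → Fin n) × Θ) R) :=
  (List.ofFn fun a => nestHom m n Θ J R a fun Λ => F Λ a).prod

theorem nestProd_eq (F : Θ → Fin m → Matrix (Fin n) (Fin n) (Matrix J J R)) :
    nestProd F = swapNest _ J R (Matrix.blockDiagonal fun Λ => sprod (F Λ)) := by
  rw [nestProd, ← prod_siteHom (fun a Λ => F Λ a), map_list_prod, List.map_ofFn]
  rfl

theorem nestHom_commute {a b : Fin m} (hab : a ≠ b)
    {f g : Θ → Matrix (Fin n) (Fin n) (Matrix J J R)}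
    (h : ∀ Λ i j k l, Commute (f Λ i j) (g Λ k l)) :
    Commute (nestHom m n Θ J R a f) (nestHom m n Θ J R b g) :=
  (siteHom_commute hab h).map (swapNest ((Fin m → Fin n) × Θ) J R)

theorem nestHom_isUnit (a : Fin m) {f : Θ → Matrix (Fin n) (Fin n) (Matrix J J R)}
    (h : ∀ Λ, IsUnit (f Λ)) : IsUnit (nestHom m n Θ J R a f) :=
  (Pi.isUnit_iff.2 h).map _

theorem nestHom_scalar (a : Fin m) (f : Θ → Matrix (Fin n) (Fin n) R) :
    nestHom m n Θ J R a (fun Λ => (f Λ).map (Matrix.scalar J)) =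
      Matrix.scalar J (siteHom m n Θ R a f) := by
  refine Matrix.ext fun i j => ?_
  rw [nestHom_entry, Matrix.scalar_apply]
  by_cases h : i = j
  · subst h
    rw [Matrix.diagonal_apply_eq]
    congr 1
    funext Λ
    ext α β
    simp [Matrix.scalar_apply]
  · rw [Matrix.diagonal_apply_ne _ h, ← map_zero (siteHom m n Θ R a)]
    congr 1
    funext Λ
    ext α β
    simp [Matrix.scalar_apply, h]

theorem siteHom_map {R' : Type*} [Ring R'] (φ : R →+* R') (a : Fin m)
    (f : Θ → Matrix (Fin n) (Fin n) R) :
    (siteHom m n Θ R a f).map φ = siteHom m n Θ R' a fun Λ => (f Λ).map φ := by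
  rw [siteHom_apply, siteHom_apply, Matrix.blockDiagonal_map _ _ (map_zero φ)]
  simp only [at1_map]

theorem nestHom_map {R' : Type*} [Ring R'] (φ : R →+* R') (a : Fin m)
    (f : Θ → Matrix (Fin n) (Fin n) (Matrix J J R)) :
    φ.mapMatrix.mapMatrix (nestHom m n Θ J R a f) =
      nestHom m n Θ J R' a fun Λ => (f Λ).map φ.mapMatrix := by
  refine Matrix.ext fun i j => ?_
  rw [nestHom_entry]
  change (nestHom m n Θ J R a f i j).map φ = _
  rw [nestHom_entry, siteHom_map]
  rfl

variable [Algebra ℂ R]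

theorem swapNest_hat {U : Type*} [Fintype U] [DecidableEq U] (M : Matrix U U ℂ) :
    swapNest U J R (hat (Matrix J J R) M) = Matrix.scalar J (hat R M) := by
  refine Matrix.ext fun i j => Matrix.ext fun x y => ?_
  rw [swapNest_apply, hat_apply, Matrix.scalar_apply, Matrix.algebraMap_matrix_apply,
    Matrix.diagonal_apply]
  split_ifs <;> rfl

/-- Interchanging the two levels of matrices turns the relation for the block-diagonal operator into
one for each matrix entry; every entry thus preserves the joint kernel. -/
theorem ExchRel.nest {q : ℂ} (hq0 : q ≠ 0) (hq : ∀ k : ℕ, 0 < k → q ^ k ≠ 1)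
    {F : ℂ → Matrix (Fin n) (Fin n) (Matrix J J R)} (hF : ExchRel q F) (μ : YoungDiagram)
    (k : Fin (μ.card - 1)) :
    Matrix.scalar J (hat R (delta (Rcheck n q) (youngMatrix q μ) k)) *
        nestProd (fun (Λ : StdTableau μ) a => F (q ^ (-2 * Λ.content a))) =
      nestProd (fun (Λ : StdTableau μ) a => F (q ^ (-2 * Λ.content (adjSwap k a)))) *
        Matrix.scalar J (hat R (delta (Rcheck n q) (youngMatrix q μ) k)) := by
  have h := congrArg (swapNest _ J R) (delta_mul_blockDiagonal (hF.delta_mul hq0 hq μ k).1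
    (hF.delta_mul hq0 hq μ k).2)
  rwa [map_mul, map_mul, swapNest_hat, ← nestProd_eq, ← nestProd_eq] at h

theorem ExchRel.nest_entry {q : ℂ} (hq0 : q ≠ 0) (hq : ∀ k : ℕ, 0 < k → q ^ k ≠ 1)
    {F : ℂ → Matrix (Fin n) (Fin n) (Matrix J J R)} (hF : ExchRel q F) (μ : YoungDiagram)
    (k : Fin (μ.card - 1)) (i j : J) :
    ∃ Y, hat R (delta (Rcheck n q) (youngMatrix q μ) k) *
        nestProd (fun (Λ : StdTableau μ) a => F (q ^ (-2 * Λ.content a))) i j =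
      Y * hat R (delta (Rcheck n q) (youngMatrix q μ) k) := by
  have h := congrFun (congrFun (hF.nest hq0 hq μ k) i) j
  rw [Matrix.scalar_apply, Matrix.diagonal_mul, Matrix.mul_diagonal] at h
  exact ⟨_, h⟩

/-- The product with exchanged contents is again invertible, so the exchange relation can be
inverted and the inverse also preserves the joint kernel. -/
theorem ExchRel.nest_inv_entry {q : ℂ} (hq0 : q ≠ 0) (hq : ∀ k : ℕ, 0 < k → q ^ k ≠ 1)
    {F : ℂ → Matrix (Fin n) (Fin n) (Matrix J J R)} (hF : ExchRel q F)
    (hu : ∀ a, IsUnit (F a)) (μ : YoungDiagram)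
    {N : Matrix J J (Matrix ((Fin μ.card → Fin n) × StdTableau μ)
      ((Fin μ.card → Fin n) × StdTableau μ) R)}
    (hN : nestProd (fun (Λ : StdTableau μ) a => F (q ^ (-2 * Λ.content a))) * N = 1)
    (k : Fin (μ.card - 1)) (i j : J) :
    ∃ Y, hat R (delta (Rcheck n q) (youngMatrix q μ) k) * N i j =
      Y * hat R (delta (Rcheck n q) (youngMatrix q μ) k) := by
  obtain ⟨w, hw⟩ : IsUnit
      (nestProd (fun (Λ : StdTableau μ) a => F (q ^ (-2 * Λ.content (adjSwap k a))))) :=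
    isUnit_prod_ofFn fun a => nestHom_isUnit a fun Λ => hu _
  have h := hF.nest hq0 hq μ k
  rw [← hw] at h
  have h' : Matrix.scalar J (hat R (delta (Rcheck n q) (youngMatrix q μ) k)) * N =
      (↑w⁻¹ : Matrix J J _) * Matrix.scalar J (hat R (delta (Rcheck n q) (youngMatrix q μ) k)) := by
    rw [Units.eq_inv_mul_iff_mul_eq, ← mul_assoc, ← h, mul_assoc, hN, mul_one]
  have h2 := congrFun (congrFun h' i) j
  rw [Matrix.scalar_apply, Matrix.diagonal_mul, Matrix.mul_diagonal] at h2
  exact ⟨_, h2⟩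

end Nest

/-! ### Crossing symmetry on the tensor power -/

section CrossingProd

variable {n : ℕ} {q : ℂ}

/-- Flattened to a matrix over the commutative ring `ℂ⟦X⟧`, a one-sided inverse is two-sided. -/
theorem Rs_isUnit (hq0 : q ≠ 0) (t : ℂ) : IsUnit (Rs n q t) := by
  have h := Rs_mul_Qs (n := n) hq0 t
  have h' : Qs n q t * Rs n q t = 1 := by
    have := congrArg (Matrix.compRingEquiv (Fin n) (Fin n) ℂ⟦X⟧) h
    rw [map_mul, map_one, mul_eq_one_comm, ← map_mul] at this
    exact (Matrix.compRingEquiv (Fin n) (Fin n) ℂ⟦X⟧).injective (this.trans (map_one _).symm)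
  exact ⟨⟨_, _, h, h'⟩, rfl⟩

theorem Qs_mul_Rs (hq0 : q ≠ 0) (t : ℂ) : Qs n q t * Rs n q t = 1 := by
  obtain ⟨w, hw⟩ := Rs_isUnit (n := n) hq0 t
  have h := Rs_mul_Qs (n := n) hq0 t
  rw [← hw] at h ⊢
  rw [← Units.inv_eq_of_mul_eq_one_right h]
  exact w.inv_mul

/-- The product of the `R`-matrices `R(s x q^{-2c_a})`, with matrix entries. -/
def RsProd (n : ℕ) (q s : ℂ) (μ : YoungDiagram) :
    Matrix (Fin n) (Fin n) (Matrix ((Fin μ.card → Fin n) × StdTableau μ)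
      ((Fin μ.card → Fin n) × StdTableau μ) ℂ⟦X⟧) :=
  nestProd fun (Λ : StdTableau μ) a => Rs n q (s * q ^ (-2 * Λ.content a))

/-- The inverse of the product of the `R`-matrices. -/
def QsProd (n : ℕ) (q s : ℂ) (μ : YoungDiagram) :
    Matrix (Fin n) (Fin n) (Matrix ((Fin μ.card → Fin n) × StdTableau μ)
      ((Fin μ.card → Fin n) × StdTableau μ) ℂ⟦X⟧) :=
  (List.ofFn fun a => nestHom μ.card n (StdTableau μ) (Fin n) ℂ⟦X⟧ a fun Λ =>
    Qs n q (s * q ^ (-2 * Λ.content a))).reverse.prod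

theorem RsProd_mul_QsProd (hq0 : q ≠ 0) (s : ℂ) (μ : YoungDiagram) :
    RsProd n q s μ * QsProd n q s μ = 1 := by
  refine prod_mul_prod_reverse _ _ fun a => ?_
  rw [← map_mul, ← map_one (nestHom μ.card n (StdTableau μ) (Fin n) ℂ⟦X⟧ a)]
  congr 1
  funext Λ
  exact Rs_mul_Qs hq0 _

theorem RsProd_entry (hq0 : q ≠ 0) (hq : ∀ k : ℕ, 0 < k → q ^ k ≠ 1) (s : ℂ) (μ : YoungDiagram)
    (k : Fin (μ.card - 1)) (i j : Fin n) :
    ∃ Y, hat ℂ⟦X⟧ (delta (Rcheck n q) (youngMatrix q μ) k) * RsProd n q s μ i j =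
      Y * hat ℂ⟦X⟧ (delta (Rcheck n q) (youngMatrix q μ) k) :=
  (Rs_exch hq0 s).nest_entry hq0 hq μ k i j

theorem QsProd_entry (hq0 : q ≠ 0) (hq : ∀ k : ℕ, 0 < k → q ^ k ≠ 1) (s : ℂ) (μ : YoungDiagram)
    (k : Fin (μ.card - 1)) (i j : Fin n) :
    ∃ Y, hat ℂ⟦X⟧ (delta (Rcheck n q) (youngMatrix q μ) k) * QsProd n q s μ i j =
      Y * hat ℂ⟦X⟧ (delta (Rcheck n q) (youngMatrix q μ) k) :=
  (Rs_exch hq0 s).nest_inv_entry hq0 hq (fun _ => Rs_isUnit hq0 _) μ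
    (RsProd_mul_QsProd hq0 s μ) k i j

/-- `D_1 … D_m`, in all blocks. -/
def Dblock (n : ℕ) (q : ℂ) (μ : YoungDiagram) : Matrix ((Fin μ.card → Fin n) × StdTableau μ)
      ((Fin μ.card → Fin n) × StdTableau μ) ℂ := Matrix.blockDiagonal fun _ => Dprod n μ.card q

theorem hat_blockDiagonal {B X Θ : Type*} [Ring B] [Algebra ℂ B] [Fintype X] [DecidableEq X]
    [Fintype Θ] [DecidableEq Θ] (M : Θ → Matrix X X ℂ) :
    hat B (Matrix.blockDiagonal M) = Matrix.blockDiagonal fun Λ => hat B (M Λ) :=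
  Matrix.blockDiagonal_map _ _ (map_zero _)

theorem hat_sprod {B : Type*} [Ring B] [Algebra ℂ B] {m : ℕ}
    (f : Fin m → Matrix (Fin n) (Fin n) ℂ) : hat B (sprod f) = sprod fun a => hat B (f a) := by
  rw [sprod, map_list_prod, List.map_ofFn, sprod]
  congr 2
  funext a
  exact at1_map (algebraMap ℂ B) a (f a)

theorem hat_Dblock (B : Type*) [Ring B] [Algebra ℂ B] (μ : YoungDiagram) :
    hat B (Dblock n q μ) = (List.ofFn fun a => siteHom μ.card n (StdTableau μ) B a fun _ =>
      hat B (Dmat n q)).prod := by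
  rw [Dblock, hat_blockDiagonal, prod_siteHom, Dprod, hat_sprod]

/-- At each site this is `crossing_entry`. Operators at different sites have entries in a
commutative ring, so they commute and `crossing_prod` applies. -/
theorem sum_QsProd_mul_RsProd (hn : 1 ≤ n) (hq0 : q ≠ 0) (hq : ∀ k : ℕ, 0 < k → q ^ k ≠ 1)
    (μ : YoungDiagram) (i j : Fin n) :
    ∑ b, QsProd n q (q ^ (-(n : ℤ))) μ b j * hat ℂ⟦X⟧ (Dblock n q μ) * RsProd n q (q ^ n) μ i b =
      if i = j then hat ℂ⟦X⟧ (Dblock n q μ) else 0 := by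
  rw [hat_Dblock]
  refine crossing_prod _ _ _ (fun a i j => ?_) (fun a b hab i j k l => ?_)
    (fun a b hab i j k l => ?_) (fun a b hab i j => ?_) (fun a b hab i j => ?_) i j
  · simp only [nestHom_entry, ← map_mul, ← map_sum]
    rw [← map_zero (siteHom μ.card n (StdTableau μ) ℂ⟦X⟧ a), ← apply_ite]
    congr 1
    funext Λ
    ext1 α γ
    have h := crossing_entry hn hq0 hq (q ^ (-2 * Λ.content a)) i j α γ
    rw [Finset.sum_apply, Matrix.sum_apply]
    refine Eq.trans (Finset.sum_congr rfl fun b _ => ?_) (h.trans ?_)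
    · simp only [Pi.mul_apply, mul_assoc]
      rw [Matrix.mul_apply]
      refine Finset.sum_congr rfl fun β _ => ?_
      congr 1
      have hD : hat ℂ⟦X⟧ (Dmat n q) = Matrix.diagonal fun β : Fin n =>
          algebraMap ℂ ℂ⟦X⟧ (q ^ ((n : ℤ) - 1 - 2 * (β : ℤ))) :=
        Matrix.diagonal_map (map_zero _)
      rw [hD, Matrix.diagonal_mul]
      rfl
    · by_cases hij : i = j
      · by_cases hag : α = γ
        · subst hag
          simp [hij, hat_apply, Dmat]
        · simp [hij, hag, hat_apply, Dmat]
      · simp [hij]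
  all_goals
    simp only [nestHom_entry]
    exact siteHom_commute hab fun _ _ _ _ _ => Commute.all _ _

end CrossingProd

/-! ### RLL relations on the tensor power. -/

section NestRLL

variable {n : ℕ} {K J B : Type*} [CommRing K] [Fintype J] [DecidableEq J] [Ring B]

theorem mapMatrix_hat [Algebra ℂ K] [Algebra ℂ B] {U : Type*} [Fintype U] [DecidableEq U] (ι : K →+* B)
    (hι : ∀ c, ι (algebraMap ℂ K c) = algebraMap ℂ B c) (M : Matrix U U ℂ) :
    ι.mapMatrix (hat K M) = hat B M := by
  ext i j
  exact hι _

theorem mapMatrix_centralEntries {U : Type*} [Fintype U] [DecidableEq U] (ι : K →+* B)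
    (hc : ∀ k b, Commute (ι k) b) (M : Matrix U U K) : CentralEntries (ι.mapMatrix M) :=
  fun _ _ _ => hc _ _

theorem nestHom_const_scalar {m : ℕ} {Θ : Type*} [Fintype Θ] [DecidableEq Θ] (a : Fin m)
    (ℓ : Matrix J J B) : nestHom m n Θ J B a (fun _ => Matrix.scalar (Fin n) ℓ) =
      swapNest ((Fin m → Fin n) × Θ) J B (Matrix.scalar _ ℓ) :=
  congrArg (swapNest ((Fin m → Fin n) × Θ) J B) (siteHom_scalar a ℓ)

theorem swapNest_scalar_apply {U : Type*} [Fintype U] [DecidableEq U] (ℓ : Matrix J J B) (i j : J) :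
    swapNest U J B (Matrix.scalar _ ℓ) i j = Matrix.scalar _ (ℓ i j) := by
  ext x y
  rw [swapNest_apply, Matrix.scalar_apply, Matrix.scalar_apply, Matrix.diagonal_apply,
    Matrix.diagonal_apply]
  split_ifs <;> rfl

theorem scalar_prod_siteHom {m : ℕ} {Θ : Type*} [Fintype Θ] [DecidableEq Θ]
    (f : Fin m → Θ → Matrix (Fin n) (Fin n) B) :
    (List.ofFn fun a => nestHom m n Θ J B a fun Λ => (f a Λ).map (Matrix.scalar J)).prod =
      Matrix.scalar J (Matrix.blockDiagonal fun Λ => sprod fun a => f a Λ) := by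
  rw [← prod_siteHom, map_list_prod, List.map_ofFn]
  congr 2
  funext a
  exact nestHom_scalar a _

theorem map_nestProd {m : ℕ} {Θ : Type*} [Fintype Θ] [DecidableEq Θ] (ι : K →+* B)
    (F : Θ → Fin m → Matrix (Fin n) (Fin n) (Matrix J J K)) :
    ι.mapMatrix.mapMatrix (nestProd F) =
      nestProd fun Λ a => (F Λ a).map ι.mapMatrix := by
  rw [nestProd, map_list_prod, List.map_ofFn, nestProd]
  congr 2
  funext a
  exact nestHom_map ι a _

/-- An `RLL` relation with one tensor factor extends to the tensor power. -/
theorem nestProd_mul_scalar_mul (ι : K →+* B) (hc : ∀ k b, Commute (ι k) b) {m : ℕ} {Θ : Type*}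
    [Fintype Θ] [DecidableEq Θ] {F F' : Θ → Fin m → Matrix (Fin n) (Fin n) (Matrix J J K)}
    {L : Θ → Fin m → Matrix (Fin n) (Fin n) B} {ℓ : Matrix J J B}
    (h : ∀ Λ a, (F Λ a).map ι.mapMatrix * (L Λ a).map (Matrix.scalar J) * Matrix.scalar (Fin n) ℓ =
      Matrix.scalar (Fin n) ℓ * (L Λ a).map (Matrix.scalar J) * (F' Λ a).map ι.mapMatrix) :
    ι.mapMatrix.mapMatrix (nestProd F) *
        Matrix.scalar J (Matrix.blockDiagonal fun Λ => sprod (L Λ)) *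
        swapNest _ J B (Matrix.scalar _ ℓ) =
      swapNest _ J B (Matrix.scalar _ ℓ) *
        Matrix.scalar J (Matrix.blockDiagonal fun Λ => sprod (L Λ)) *
        ι.mapMatrix.mapMatrix (nestProd F') := by
  rw [map_nestProd, map_nestProd, nestProd, nestProd, ← scalar_prod_siteHom fun a Λ => L Λ a]
  have hcomm : ∀ (G : Θ → Fin m → Matrix (Fin n) (Fin n) (Matrix J J K)) (a b : Fin m), a ≠ b →
      Commute (nestHom m n Θ J B a fun Λ => (G Λ a).map ι.mapMatrix)
        (nestHom m n Θ J B b fun Λ => (L Λ b).map (Matrix.scalar J)) := fun G a b hab =>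
    nestHom_commute hab fun Λ i j k l =>
      ((mapMatrix_centralEntries ι hc (G Λ a i j)).scalar_commute (L Λ b k l)).symm
  refine prod_mul_prod_mul_eq _ _ _ _ (fun a => ?_) (hcomm F) (hcomm F')
  rw [← nestHom_const_scalar a ℓ, ← map_mul, ← map_mul, ← map_mul, ← map_mul]
  congr 1
  funext Λ
  exact h Λ a

end NestRLL

section Preserves

variable {R ι : Type*} [Ring R] {δ : ι → R}

/-- `X` preserves the common kernel of the `δ_k`. -/
def Preserves (δ : ι → R) (X : R) : Prop := ∀ k, ∃ Y, δ k * X = Y * δ k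

theorem Preserves.mul {X X' : R} (h : Preserves δ X) (h' : Preserves δ X') :
    Preserves δ (X * X') := fun k => by
  obtain ⟨Y, hY⟩ := h k
  obtain ⟨Y', hY'⟩ := h' k
  exact ⟨Y * Y', by rw [← mul_assoc, hY, mul_assoc, hY', mul_assoc]⟩

theorem Preserves.one : Preserves δ 1 := fun k => ⟨1, by rw [mul_one, one_mul]⟩

theorem Preserves.list_prod {l : List R} (h : ∀ X ∈ l, Preserves δ X) : Preserves δ l.prod := by
  induction l with
  | nil => exact .one
  | cons X l ih =>
    rw [List.prod_cons]
    exact (h X (by simp)).mul (ih fun Y hY => h Y (by simp [hY]))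

end Preserves

section EntryTrace

theorem mul_scalar_mul_mul_apply {J S : Type*} [Fintype J] [DecidableEq J] [Ring S]
    (M W N : Matrix J J S) (x : S) (i j : J) : (M * Matrix.scalar J x * W * N) i j =
      ∑ b, ∑ c, M i b * x * W b c * N c j := by
  rw [Matrix.mul_apply, Finset.sum_comm]
  refine Finset.sum_congr rfl fun c _ => ?_
  rw [Matrix.mul_apply, Finset.sum_mul]
  refine Finset.sum_congr rfl fun b _ => ?_
  rw [Matrix.scalar_apply, Matrix.mul_diagonal]

theorem mul_scalar_apply {J S : Type*} [Fintype J] [DecidableEq J] [Ring S]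
    (W : Matrix J J S) (x : S) (i j : J) : (W * Matrix.scalar J x) i j = W i j * x := by
  rw [Matrix.scalar_apply, Matrix.mul_diagonal]

/-- Take the entry `(i, j)`, multiply by `D e` and apply the trace. The entries of `N`, `D`, `e` are
central, so `ℓ b c` moves to the far right, where it can act on the vacuum. -/
theorem entry_mul_trace {U J B : Type*} [Fintype U] [DecidableEq U] [Fintype J] [DecidableEq J]
    [Ring B] {M N : Matrix J J (Matrix U U B)} {𝓛 D e : Matrix U U B} {ℓ : Matrix J J B}
    (hN : ∀ i j, CentralEntries (N i j)) (hD : CentralEntries D) (he : CentralEntries e)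
    (h : M * Matrix.scalar J 𝓛 * swapNest U J B (Matrix.scalar U ℓ) * N =
      swapNest U J B (Matrix.scalar U ℓ) * Matrix.scalar J 𝓛) (i j : J) :
    ℓ i j * (𝓛 * D * e).trace =
      ∑ b, ∑ c, (M i b * 𝓛 * N c j * D * e).trace * ℓ b c := by
  have h0 : ∑ b, ∑ c, M i b * 𝓛 * Matrix.scalar U (ℓ b c) * N c j =
      Matrix.scalar U (ℓ i j) * 𝓛 := by
    have h1 := congrFun (congrFun h i) j
    rw [mul_scalar_mul_mul_apply M _ N 𝓛 i j, mul_scalar_apply _ 𝓛 i j] at h1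
    simpa only [swapNest_scalar_apply] using h1
  have h1 := congrArg (fun Z : Matrix U U B => (Z * (D * e)).trace) h0
  simp only [Finset.sum_mul, Matrix.trace_sum] at h1
  rw [← trace_scalar_mul, mul_assoc 𝓛, ← mul_assoc, ← h1]
  refine Finset.sum_congr rfl fun b _ => Finset.sum_congr rfl fun c _ => ?_
  rw [← trace_mul_scalar]
  congr 1
  have c1 : Commute (Matrix.scalar U (ℓ b c)) (N c j * (D * e)) :=
    ((hN c j).mul (hD.mul he)).scalar_commute _
  rw [mul_assoc _ (N c j), mul_assoc _ (Matrix.scalar U (ℓ b c)), c1.eq]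
  simp only [mul_assoc]

end EntryTrace

/-! ### Moving L⁻ past the trace. -/

section Vacuum

variable {n : ℕ} {q : ℂ} {B : Type*} [Ring B] [Algebra ℂ B]

/-- The core of the invariance: once `ℓ b c` acts on the vacuum as the Kronecker symbol, the first
identity reduces to the sum evaluated by the second. -/
theorem exists_eq_sum_mul (hn : 1 ≤ n) (hq0 : q ≠ 0) (hq : ∀ k : ℕ, 0 < k → q ^ k ≠ 1)
    (ι : ℂ⟦X⟧ →+* B) (hc : ∀ k b, Commute (ι k) b)
    (hι : ∀ c, ι (algebraMap ℂ ℂ⟦X⟧ c) = algebraMap ℂ B c)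
    {L : ℂ → Matrix (Fin n) (Fin n) B} (hL : ExchRel q L) (ℓ : Matrix (Fin n) (Fin n) B)
    (h : ∀ a, (Rs n q (q ^ n * a)).map ι.mapMatrix * (L a).map (Matrix.scalar (Fin n)) *
        Matrix.scalar (Fin n) ℓ =
      Matrix.scalar (Fin n) ℓ * (L a).map (Matrix.scalar (Fin n)) *
        (Rs n q (q ^ (-(n : ℤ)) * a)).map ι.mapMatrix)
    {μ : YoungDiagram}
    {e : Matrix ((Fin μ.card → Fin n) × StdTableau μ) ((Fin μ.card → Fin n) × StdTableau μ) ℂ}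
    (he : IsKerProj (delta (Rcheck n q) (youngMatrix q μ)) e) {s : B}
    (hs : s = (Matrix.blockDiagonal (fun Λ : StdTableau μ =>
      sprod fun a => L (q ^ (-2 * Λ.content a))) * hat B (Dblock n q μ) * hat B e).trace) :
    ∃ t : Fin n → Fin n → Fin n → Fin n → B,
      (∀ i j, ℓ i j * s = ∑ b, ∑ c, t i b c j * ℓ b c) ∧
      ∀ i j, ∑ b, t i b b j = if i = j then s else 0 := by
  set 𝓛 : Matrix ((Fin μ.card → Fin n) × StdTableau μ) ((Fin μ.card → Fin n) × StdTableau μ) B :=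
    Matrix.blockDiagonal (fun Λ : StdTableau μ =>
      sprod fun a => L (q ^ (-2 * Λ.content a))) with h𝓛
  let M := ι.mapMatrix.mapMatrix (RsProd n q (q ^ n) μ)
  let N := ι.mapMatrix.mapMatrix (QsProd n q (q ^ (-(n : ℤ))) μ)
  have hM : ∀ i j, CentralEntries (M i j) := fun i j => mapMatrix_centralEntries ι hc _
  have hN : ∀ i j, CentralEntries (N i j) := fun i j => mapMatrix_centralEntries ι hc _
  -- The R-matrices at the shift `q⁻ⁿ` on the right are removed by their inverse `N`.
  have hrel : M * Matrix.scalar (Fin n) 𝓛 * swapNest _ (Fin n) B (Matrix.scalar _ ℓ) * N =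
      swapNest _ (Fin n) B (Matrix.scalar _ ℓ) * Matrix.scalar (Fin n) 𝓛 := by
    have := nestProd_mul_scalar_mul ι hc (L := fun (Λ : StdTableau μ) a =>
      L (q ^ (-2 * Λ.content a))) (ℓ := ℓ) fun Λ a => h (q ^ (-2 * Λ.content a))
    have h2 := congrArg ι.mapMatrix.mapMatrix
      (RsProd_mul_QsProd (n := n) hq0 (q ^ (-(n : ℤ))) μ)
    rw [map_mul, map_one] at h2
    exact (congrArg (· * N) this).trans (by rw [mul_assoc]; erw [h2]; rw [mul_one])
  have hD : CentralEntries (hat B (Dblock n q μ)) := hat_centralEntries _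
  have hE : CentralEntries (hat B e) := hat_centralEntries _
  have hMp : ∀ i j, Preserves (fun k => hat B (delta (Rcheck n q) (youngMatrix q μ) k)) (M i j) :=
    fun i j k => by
      obtain ⟨Y, hY⟩ := RsProd_entry (n := n) hq0 hq (q ^ n) μ k i j
      have := congrArg ι.mapMatrix hY
      rw [map_mul, map_mul, mapMatrix_hat ι hι] at this
      exact ⟨_, this⟩
  have hNp : ∀ i j, Preserves (fun k => hat B (delta (Rcheck n q) (youngMatrix q μ) k)) (N i j) :=
    fun i j k => by
      obtain ⟨Y, hY⟩ := QsProd_entry (n := n) hq0 hq (q ^ (-(n : ℤ))) μ k i j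
      have := congrArg ι.mapMatrix hY
      rw [map_mul, map_mul, mapMatrix_hat ι hι] at this
      exact ⟨_, this⟩
  have hLp : Preserves (fun k => hat B (delta (Rcheck n q) (youngMatrix q μ) k)) 𝓛 := fun k =>
    (hL.exchanges hq0 hq μ).delta_mul k
  have hDp : Preserves (fun k => hat B (delta (Rcheck n q) (youngMatrix q μ) k))
      (hat B (Dblock n q μ)) := fun k => by
    have h1 : Exchanges (B := B) (Rcheck n q) (youngMatrix q μ)
        fun _ => hat B (Dprod n μ.card q) := fun k => ⟨fun _ => hat B (Dprod n μ.card q),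
          fun Λ => by
            rw [← map_mul, ← map_mul]
            congr 1
            exact ((Rcheck_commute_Dprod k).sub_left ((Commute.one_left _).smul_left _)).eq,
          fun _ _ _ _ => rfl⟩
    have := h1.delta_mul k
    rwa [← hat_blockDiagonal] at this
  refine ⟨fun i b c j => (M i b * 𝓛 * N c j * hat B (Dblock n q μ) * hat B e).trace,
    fun i j => ?_, fun i j => ?_⟩
  · rw [hs]
    exact entry_mul_trace hN hD hE hrel i j
  -- `M i b` has central entries and preserves the joint kernel, as does the rest of the product, so
  -- it rotates to the end. Crossing symmetry `h2` then collapses the sum over `b`.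
  · have h1 : ∀ b, (M i b * 𝓛 * N b j * hat B (Dblock n q μ) * hat B e).trace =
        (𝓛 * (N b j * hat B (Dblock n q μ) * M i b) * hat B e).trace := fun b => by
      have := trace_rotate (hM i b) hE ((he.map (hat B)).mul_mul_eq (hMp i b))
        ((he.map (hat B)).mul_mul_eq ((hLp.mul (hNp b j)).mul hDp))
      simpa only [mul_assoc] using this
    have h2 : ∑ b, N b j * hat B (Dblock n q μ) * M i b =
        if i = j then hat B (Dblock n q μ) else 0 := by
      have := congrArg ι.mapMatrix (sum_QsProd_mul_RsProd hn hq0 hq μ i j)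
      rw [map_sum] at this
      simp only [map_mul, mapMatrix_hat ι hι, apply_ite ι.mapMatrix, map_zero] at this
      exact this
    rw [Finset.sum_congr rfl fun b _ => h1 b, ← Matrix.trace_sum, ← Finset.sum_mul,
      ← Finset.mul_sum, h2]
    split_ifs
    · exact hs.symm
    · simp

end Vacuum

theorem rll_of_entries {n : ℕ} {q : ℂ} {B : Type*} [Ring B] [Algebra ℂ B] (hq0 : q ≠ 0)
    (ι : ℂ⟦X⟧ →+* B) {L ℓ : Matrix (Fin n) (Fin n) B} {t t' : ℂ}
    (h : ∀ I J : Fin n × Fin n,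
      ∑ K, ι (PowerSeries.rescale t (Rser n q I K)) * (L K.1 J.1 * ℓ K.2 J.2) =
        ∑ K, ℓ I.2 K.2 * L I.1 K.1 * ι (PowerSeries.rescale t' (Rser n q K J))) :
    (Rs n q t).map ι.mapMatrix * L.map (Matrix.scalar (Fin n)) * Matrix.scalar (Fin n) ℓ =
      Matrix.scalar (Fin n) ℓ * L.map (Matrix.scalar (Fin n)) * (Rs n q t').map ι.mapMatrix := by
  refine Matrix.ext fun α β => Matrix.ext fun i j => ?_
  have e1 : ((Rs n q t).map ι.mapMatrix * L.map (Matrix.scalar (Fin n)) *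
      Matrix.scalar (Fin n) ℓ) α β i j =
      ∑ γ, ∑ k, ι (Rs n q t α γ i k) * (L γ β * ℓ k j) := by
    have e : ((Rs n q t).map ι.mapMatrix * L.map (Matrix.scalar (Fin n))) α β =
        ∑ γ, ι.mapMatrix (Rs n q t α γ) * Matrix.scalar (Fin n) (L γ β) := Matrix.mul_apply
    rw [mul_scalar_apply, e, Finset.sum_mul, Matrix.sum_apply]
    refine Finset.sum_congr rfl fun γ _ => ?_
    rw [Matrix.mul_apply]
    refine Finset.sum_congr rfl fun k _ => ?_
    rw [← mul_assoc]
    congr 1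
    exact mul_scalar_apply (ι.mapMatrix (Rs n q t α γ)) (L γ β) i k
  have e2 : (Matrix.scalar (Fin n) ℓ * L.map (Matrix.scalar (Fin n)) *
      (Rs n q t').map ι.mapMatrix) α β i j =
      ∑ γ, ∑ k, ℓ i k * L α γ * ι (Rs n q t' γ β k j) := by
    rw [Matrix.mul_apply, Matrix.sum_apply]
    refine Finset.sum_congr rfl fun γ _ => ?_
    rw [Matrix.scalar_apply, Matrix.diagonal_mul, Matrix.mul_apply]
    refine Finset.sum_congr rfl fun k _ => ?_
    congr 1
    exact mul_scalar_apply ℓ (L α γ) i k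
  rw [e1, e2]
  have := h (α, i) (β, j)
  rw [Fintype.sum_prod_type, Fintype.sum_prod_type] at this
  simp only [Rs_apply hq0]
  exact this

section MapTrace

variable {n : ℕ} {B B' : Type*} [Ring B] [Ring B']

theorem sprod_map (φ : B →+* B') {m : ℕ} (f : Fin m → Matrix (Fin n) (Fin n) B) :
    φ.mapMatrix (sprod f) = sprod fun a => (f a).map φ := by
  rw [sprod, map_list_prod, List.map_ofFn, sprod]
  congr 2
  funext a
  exact at1_map φ a (f a)

theorem map_trace_blockDiagonal [Algebra ℂ B] [Algebra ℂ B'] (φ : B →ₐ[ℂ] B') {m : ℕ}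
    {Θ : Type*} [Fintype Θ] [DecidableEq Θ] (f : Θ → Fin m → Matrix (Fin n) (Fin n) B)
    (D e : Matrix ((Fin m → Fin n) × Θ) ((Fin m → Fin n) × Θ) ℂ) :
    φ (Matrix.blockDiagonal (fun Λ => sprod (f Λ)) * hat B D * hat B e).trace =
      (Matrix.blockDiagonal (fun Λ => sprod fun a => (f Λ a).map φ) * hat B' D *
        hat B' e).trace := by
  have h : ∀ M : Matrix ((Fin m → Fin n) × Θ) ((Fin m → Fin n) × Θ) ℂ,
      (φ : B →+* B').mapMatrix (hat B M) = hat B' M := fun M => by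
    ext i j
    exact φ.commutes _
  have h2 : (φ : B →+* B').mapMatrix (Matrix.blockDiagonal (fun Λ => sprod (f Λ))) =
      Matrix.blockDiagonal fun Λ => sprod fun a => (f Λ a).map φ := by
    refine (Matrix.blockDiagonal_map _ _ (map_zero φ)).trans ?_
    congr 1
    funext Λ
    exact sprod_map (φ : B →+* B') (f Λ)
  rw [← h D, ← h e, ← h2, ← map_mul, ← map_mul]
  exact map_sum φ _ _

end MapTrace

/-! ### Power series in two variables. -/

section Diag

variable {A : Type*} [Ring A]

/-- The substitution `f(z) ↦ f(x y)`. -/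
def diagHom (A : Type*) [Ring A] : A⟦X⟧ →+* A⟦X⟧⟦X⟧ where
  toFun f := PowerSeries.mk fun k => PowerSeries.monomial k (PowerSeries.coeff k f)
  map_zero' := by ext; simp
  map_one' := by
    ext k : 1
    rw [PowerSeries.coeff_mk, PowerSeries.coeff_one, PowerSeries.coeff_one]
    split_ifs with h
    · subst h
      simp
    · simp
  map_add' f g := by ext; simp
  map_mul' f g := by
    ext k : 1
    simp only [PowerSeries.coeff_mul, PowerSeries.coeff_mk, map_sum]
    refine Finset.sum_congr rfl fun p hp => ?_
    rw [PowerSeries.monomial_mul_monomial, show p.1 + p.2 = k by simpa using hp]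

theorem coeff_diagHom (f : A⟦X⟧) (k : ℕ) : PowerSeries.coeff k (diagHom A f) =
    PowerSeries.monomial k (PowerSeries.coeff k f) := by
  change PowerSeries.coeff k (PowerSeries.mk fun k =>
    PowerSeries.monomial k (PowerSeries.coeff k f)) = _
  rw [PowerSeries.coeff_mk]

theorem diagHom_algebraMap [Algebra ℂ A] (c : ℂ) :
    diagHom A (algebraMap ℂ A⟦X⟧ c) = algebraMap ℂ A⟦X⟧⟦X⟧ c := by
  ext k : 1
  rw [coeff_diagHom]
  simp only [PowerSeries.algebraMap_apply, PowerSeries.coeff_C]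
  split_ifs with h
  · subst h
    simp [PowerSeries.monomial_zero_eq_C_apply]
  · simp

theorem coeff_monomial_mul (a : A) (G : A⟦X⟧) (k p : ℕ) :
    PowerSeries.coeff p (PowerSeries.monomial k a * G) =
      if k ≤ p then a * PowerSeries.coeff (p - k) G else 0 := by
  rw [PowerSeries.monomial_eq_C_mul_X_pow, mul_assoc, PowerSeries.coeff_C_mul,
    PowerSeries.coeff_X_pow_mul', mul_ite, mul_zero]

theorem coeff_diagHom_mul (f : A⟦X⟧) (G : A⟦X⟧⟦X⟧) (p r : ℕ) :
    PowerSeries.coeff p (PowerSeries.coeff r (diagHom A f * G)) =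
      ∑ k ∈ Finset.range (p + r + 1), if k ≤ r ∧ k ≤ p then PowerSeries.coeff k f *
        PowerSeries.coeff (p - k) (PowerSeries.coeff (r - k) G) else 0 := by
  rw [PowerSeries.coeff_mul, Finset.Nat.sum_antidiagonal_eq_sum_range_succ
    fun k l => PowerSeries.coeff k (diagHom A f) * PowerSeries.coeff l G, map_sum]
  rw [← Finset.sum_subset (Finset.range_mono (by omega : r + 1 ≤ p + r + 1))]
  · refine Finset.sum_congr rfl fun k hk => ?_
    have hk' : k ≤ r := by simpa [Nat.lt_succ_iff] using hk
    rw [coeff_diagHom, coeff_monomial_mul]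
    simp [hk']
  · intro k _ hk
    rw [if_neg]
    simp at hk
    omega

variable [Algebra ℂ A]

/-- Scalar power series in the product of the variables. -/
abbrev diagHat (A : Type*) [Ring A] [Algebra ℂ A] : ℂ⟦X⟧ →+* A⟦X⟧⟦X⟧ :=
  (diagHom A).comp (serHat A)

theorem diagHat_commute (f : ℂ⟦X⟧) (G : A⟦X⟧⟦X⟧) : Commute (diagHat A f) G := by
  ext r : 1
  rw [PowerSeries.coeff_mul, PowerSeries.coeff_mul, ← Finset.Nat.sum_antidiagonal_swap]
  refine Finset.sum_congr rfl fun k _ => ?_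
  have : Commute (serHat A (PowerSeries.monomial k.swap.1 (PowerSeries.coeff k.swap.1 f)))
    (PowerSeries.coeff k.swap.2 G) := serHat_commute _ _
  have e : serHat A (PowerSeries.monomial k.swap.1 (PowerSeries.coeff k.swap.1 f)) =
      PowerSeries.coeff k.swap.1 (diagHat A f) := by
    rw [RingHom.comp_apply, coeff_diagHom]
    ext j
    simp only [PowerSeries.coeff_map, PowerSeries.coeff_monomial]
    split_ifs <;> simp
  rw [e] at this
  exact this.eq

theorem diagHat_algebraMap (c : ℂ) :
    diagHat A (algebraMap ℂ ℂ⟦X⟧ c) = algebraMap ℂ A⟦X⟧⟦X⟧ c := by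
  rw [RingHom.comp_apply, ← diagHom_algebraMap]
  congr 1

end Diag

/-! ### Invariance of the coefficients. -/

section Invariants

variable {n : ℕ} {q : ℂ}

/-- The matrix `L⁻` as a series in the second variable. -/
def LMinus (n : ℕ) (q : ℂ) : Matrix (Fin n) (Fin n) (UqCrit n q)⟦X⟧⟦X⟧ :=
  Matrix.of fun i j => PowerSeries.mk fun r => PowerSeries.C (lMinus n q i j r)

theorem coeff_LPlus_mul_LMinus (c : ℂ) (i j k l : Fin n) (p r : ℕ) :
    PowerSeries.coeff p (PowerSeries.coeff r
      ((LPlus n q c).map PowerSeries.C i j * LMinus n q k l)) =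
        (c ^ p • lPlus n q i j p) * lMinus n q k l r := by
  rw [Matrix.map_apply, PowerSeries.coeff_C_mul, LMinus, Matrix.of_apply, PowerSeries.coeff_mk,
    PowerSeries.coeff_mul_C, LPlus, Matrix.of_apply, PowerSeries.coeff_mk]

theorem coeff_LMinus_mul_LPlus (c : ℂ) (i j k l : Fin n) (p r : ℕ) :
    PowerSeries.coeff p (PowerSeries.coeff r
      (LMinus n q k l * (LPlus n q c).map PowerSeries.C i j)) =
        lMinus n q k l r * (c ^ p • lPlus n q i j p) := by
  rw [Matrix.map_apply, PowerSeries.coeff_mul_C, LMinus, Matrix.of_apply, PowerSeries.coeff_mk,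
    PowerSeries.coeff_C_mul, LPlus, Matrix.of_apply, PowerSeries.coeff_mk]

/-- The inner variable is `z`, with `L⁺` taken at `u = c z`, and the outer one is `v⁻¹`. The
argument `u/v` is `c` times the product of both variables, hence the use of `diagHat`. -/
theorem plus_minus_rll (hq0 : q ≠ 0) (c : ℂ) :
    (Rs n q (q ^ n * c)).map (diagHat (UqCrit n q)).mapMatrix *
        ((LPlus n q c).map PowerSeries.C).map (Matrix.scalar (Fin n)) *
        Matrix.scalar (Fin n) (LMinus n q) =
      Matrix.scalar (Fin n) (LMinus n q) *
        ((LPlus n q c).map PowerSeries.C).map (Matrix.scalar (Fin n)) *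
        (Rs n q (q ^ (-(n : ℤ)) * c)).map (diagHat (UqCrit n q)).mapMatrix := by
  refine rll_of_entries hq0 _ fun I J => ?_
  ext r p
  have h := congrArg (c ^ p • ·) (rll_mixed_crit (q := q) hq0 (p : ℤ) (-(r : ℤ)) I J)
  simp only [rllLeft_apply, rllRight_apply, Int.natAbs_natCast, Int.natAbs_neg] at h
  have hp : ∀ (k : ℕ) i j, plusMode (lPlus n q) ((p : ℤ) - k) i j =
      if k ≤ p then lPlus n q i j (p - k) else 0 := by
    intro k i j
    simp only [plusMode, Matrix.of_apply]
    refine if_ctx_congr (by omega) (fun hh => ?_) fun _ => rfl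
    congr 1
    omega
  have hm : ∀ (k : ℕ) i j, minusMode (lMinus n q) (-(r : ℤ) + k) i j =
      if k ≤ r then lMinus n q i j (r - k) else 0 := by
    intro k i j
    simp only [minusMode, Matrix.of_apply]
    refine if_ctx_congr (by omega) (fun hh => ?_) fun _ => rfl
    congr 1
    omega
  simp only [hp, hm, Finset.smul_sum] at h
  simp only [← (diagHat_commute _ _).eq]
  simp only [map_sum, RingHom.comp_apply, coeff_diagHom_mul]
  rw [Finset.sum_comm, Finset.sum_comm (s := Finset.univ)]
  refine Eq.trans (Finset.sum_congr rfl fun k _ => Finset.sum_congr rfl fun K _ => ?_)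
    (h.trans (Finset.sum_congr rfl fun k _ => Finset.sum_congr rfl fun K _ => ?_))
  · rw [PowerSeries.coeff_map, PowerSeries.coeff_rescale, coeff_LPlus_mul_LMinus]
    by_cases hk : k ≤ r ∧ k ≤ p
    · rw [if_pos hk, if_pos hk.1, if_pos hk.2, smul_mul_assoc, Algebra.algebraMap_eq_smul_one,
        Algebra.algebraMap_eq_smul_one, Algebra.algebraMap_eq_smul_one]
      simp only [smul_pow, one_pow, smul_mul_assoc, mul_smul_comm, one_mul, smul_smul]
      congr 1
      rw [coeff_Rser, ← Nat.sub_add_cancel hk.2, pow_add, mul_pow, Nat.add_sub_cancel]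
      ring
    · rw [if_neg hk]
      rcases not_and_or.1 hk with h | h <;> simp [h]
  · rw [PowerSeries.coeff_map, PowerSeries.coeff_rescale, coeff_LMinus_mul_LPlus]
    by_cases hk : k ≤ r ∧ k ≤ p
    · rw [if_pos hk, if_pos hk.1, if_pos hk.2, mul_smul_comm, Algebra.algebraMap_eq_smul_one,
        Algebra.algebraMap_eq_smul_one, Algebra.algebraMap_eq_smul_one]
      simp only [smul_pow, one_pow, smul_mul_assoc, mul_smul_comm, one_mul, mul_one, smul_smul]
      congr 1
      rw [coeff_Rser, ← Nat.sub_add_cancel hk.2, pow_add, mul_pow, Nat.add_sub_cancel]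
      ring
    · rw [if_neg hk]
      rcases not_and_or.1 hk with h | h <;> simp [h]

/-- The positive modes of `L⁻` kill the vacuum and the zero modes give the Kronecker symbol, so only
the top coefficient of `t` survives. -/
theorem coeff_mul_LMinus_smul_vac (t : (UqCrit n q)⟦X⟧⟦X⟧) (b c : Fin n) (p r : ℕ) :
    PowerSeries.coeff p (PowerSeries.coeff r (t * LMinus n q b c)) • vac n q =
      if b = c then PowerSeries.coeff p (PowerSeries.coeff r t) • vac n q else 0 := by
  rw [PowerSeries.coeff_mul, map_sum, Finset.sum_smul, Finset.sum_eq_single (r, 0)]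
  · rw [LMinus, Matrix.of_apply, PowerSeries.coeff_mk, PowerSeries.coeff_mul_C, mul_smul,
      vac_mem n q b c 0]
    split_ifs with h1 h2 h2 <;> simp_all
  · intro k hk hne
    rw [LMinus, Matrix.of_apply, PowerSeries.coeff_mk, PowerSeries.coeff_mul_C, mul_smul,
      vac_mem n q b c k.2, if_neg, smul_zero]
    rintro ⟨-, h⟩
    have : k.1 + k.2 = r := by simpa using hk
    exact hne (Prod.ext (by omega) h)
  · simp

theorem blockDiagonal_LDprod (μ : YoungDiagram) :
    Matrix.blockDiagonal (LDprod n q : StdTableau μ → _) =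
      Matrix.blockDiagonal (fun Λ : StdTableau μ =>
        sprod fun a => LPlus n q (q ^ (-2 * Λ.content a))) * hat _ (Dblock n q μ) := by
  rw [Dblock, hat_blockDiagonal, ← Matrix.blockDiagonal_mul]
  rfl

theorem coeff_Sbar_smul_vac_mem (hn : 1 ≤ n) (hq0 : q ≠ 0) (hq : ∀ k : ℕ, 0 < k → q ^ k ≠ 1)
    {μ : YoungDiagram} (Λ : StdTableau μ) (p : ℕ) :
    PowerSeries.coeff p (Sbar n q Λ) • vac n q ∈ invariants n q := by
  obtain ⟨e, he⟩ := exists_isKerProj (delta (Rcheck n q) (youngMatrix q μ))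
  obtain ⟨κ, hκ⟩ := exists_Sbar_eq hq0 hq he
  rw [hκ, PowerSeries.coeff_smul, smul_assoc]
  refine (invariants n q).smul_mem κ ?_
  set S := (Matrix.blockDiagonal (LDprod n q : StdTableau μ → _) * hat _ e).trace with hS
  -- `S` is constant in the outer variable, so only the outer coefficient `r = 0` will be nonzero in
  -- the end.
  let CAlg : (UqCrit n q)⟦X⟧ →ₐ[ℂ] (UqCrit n q)⟦X⟧⟦X⟧ :=
    { PowerSeries.C with commutes' := fun _ => PowerSeries.algebraMap_apply.symm }
  obtain ⟨t, ht1, ht2⟩ := exists_eq_sum_mul hn hq0 hq (diagHat (UqCrit n q)) diagHat_commute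
    diagHat_algebraMap ((LPlus_exch hq0).map CAlg) (LMinus n q)
    (fun a => plus_minus_rll hq0 a) he (s := PowerSeries.C S) (by
      rw [hS, blockDiagonal_LDprod]
      exact map_trace_blockDiagonal CAlg _ _ _)
  intro i j r
  have h1 := congrArg (fun f => PowerSeries.coeff p (PowerSeries.coeff r f) • vac n q) (ht1 i j)
  have h2 := congrArg (fun f => PowerSeries.coeff p (PowerSeries.coeff r f) • vac n q) (ht2 i j)
  simp only [map_sum, Finset.sum_smul] at h1 h2
  simp only [coeff_mul_LMinus_smul_vac, Finset.sum_ite_eq, Finset.mem_univ, if_true, h2] at h1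
  rw [LMinus, Matrix.of_apply, PowerSeries.coeff_mul_C, PowerSeries.coeff_mk,
    PowerSeries.coeff_C_mul, mul_smul] at h1
  rw [h1, ite_and]
  split_ifs with hij hr
  · rw [hr, PowerSeries.coeff_zero_C]
  · rw [PowerSeries.coeff_C, if_neg hr, map_zero, zero_smul]
  · rw [map_zero, map_zero, zero_smul]

end Invariants

/-! ### Two tensor powers at once. -/

section Nested

variable {U J B : Type*} [Fintype U] [DecidableEq U] [Fintype J] [DecidableEq J] [Ring B]

theorem swapNest_scalar (ℓ : Matrix J J B) :
    swapNest U J B (Matrix.scalar U ℓ) = ℓ.map (Matrix.scalar U) :=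
  Matrix.ext fun i j => swapNest_scalar_apply ℓ i j

theorem swapNest_map_scalar (ℓ : Matrix U U B) :
    swapNest U J B (ℓ.map (Matrix.scalar J)) = Matrix.scalar J ℓ := by
  rw [← swapNest_scalar (U := J) ℓ]
  rfl

theorem scalar_commute_map_scalar {X : Matrix U U B} {N : Matrix J J B}
    (h : ∀ i j, Commute X (Matrix.scalar U (N i j))) :
    Commute (Matrix.scalar J X) (N.map (Matrix.scalar U)) := by
  refine Matrix.ext fun i j => ?_
  rw [Matrix.scalar_apply, Matrix.diagonal_mul, Matrix.mul_diagonal]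
  exact h i j

/-- The two operators act on different levels of the double space. The trace factors, and the order
of its factors records the order of the operators. -/
theorem trace_scalar_mul_map_scalar (X : Matrix U U B) (N : Matrix J J B) :
    (Matrix.compRingEquiv J U B (Matrix.scalar J X * N.map (Matrix.scalar U))).trace =
      X.trace * N.trace := by
  rw [Matrix.trace, Fintype.sum_prod_type, Finset.sum_comm, Matrix.trace, Finset.sum_mul]
  refine Finset.sum_congr rfl fun u _ => ?_
  rw [Matrix.trace, Finset.mul_sum]
  refine Finset.sum_congr rfl fun x _ => ?_
  change (Matrix.scalar J X * N.map (Matrix.scalar U)) x x u u = _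
  rw [Matrix.scalar_apply, Matrix.diagonal_mul, Matrix.map_apply, mul_scalar_apply]
  rfl

theorem trace_map_scalar_mul_scalar (X : Matrix U U B) (N : Matrix J J B) :
    (Matrix.compRingEquiv J U B (N.map (Matrix.scalar U) * Matrix.scalar J X)).trace =
      N.trace * X.trace := by
  rw [Matrix.trace, Fintype.sum_prod_type, Matrix.trace, Finset.sum_mul]
  refine Finset.sum_congr rfl fun x _ => ?_
  rw [Matrix.trace, Finset.mul_sum]
  refine Finset.sum_congr rfl fun u _ => ?_
  change (N.map (Matrix.scalar U) * Matrix.scalar J X) x x u u = _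
  rw [Matrix.scalar_apply, Matrix.mul_diagonal, Matrix.map_apply, Matrix.scalar_apply,
    Matrix.diagonal_mul]
  rfl

end Nested

section PreservesMore

variable {R ι : Type*} [Ring R] {δ : ι → R}

theorem Preserves.map {S : Type*} [Ring S] {X : R} (h : Preserves δ X) (f : R →+* S) :
    Preserves (fun k => f (δ k)) (f X) := fun k => by
  obtain ⟨Y, hY⟩ := h k
  exact ⟨f Y, by rw [← map_mul, hY, map_mul]⟩

theorem Preserves.of_commute {X : R} (h : ∀ k, Commute (δ k) X) : Preserves δ X :=
  fun k => ⟨X, (h k).eq⟩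

theorem exists_mul_eq_of_isUnit {δ X X' N : R} (h : δ * X = X' * δ) (hu : IsUnit X')
    (hN : X * N = 1) : ∃ Y, δ * N = Y * δ := by
  obtain ⟨w, rfl⟩ := hu
  exact ⟨↑w⁻¹, by rw [Units.eq_inv_mul_iff_mul_eq, ← mul_assoc, ← h, mul_assoc, hN, mul_one]⟩

/-- For commuting projections `e e'` projects onto the intersection of the two kernels, which `Y`
preserves as soon as it preserves each. -/
theorem mul_mul_mul_eq {e e' Y : R} (hc : Commute e e') (h : e * (Y * e) = Y * e)
    (h' : e' * (Y * e') = Y * e') : e * e' * (Y * (e * e')) = Y * (e * e') := by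
  calc e * e' * (Y * (e * e')) = e * (e' * (Y * e')) * e := by
        nth_rewrite 2 [hc.eq]
        simp only [mul_assoc]
    _ = e * (Y * e) * e' := by
        rw [h', mul_assoc, mul_assoc, ← hc.eq]
        simp only [mul_assoc]
    _ = Y * (e * e') := by rw [h, mul_assoc]

end PreservesMore

section ExchRelMore

variable {n : ℕ} {q : ℂ}

theorem ExchRel.one {C : Type*} [Ring C] [Algebra ℂ C] :
    ExchRel q (fun _ => (1 : Matrix (Fin n) (Fin n) C)) := by
  intro a b _ _
  have : tmul (1 : Matrix (Fin n) (Fin n) C) 1 = 1 := by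
    ext p p'
    simp only [tmul, Matrix.of_apply, Matrix.one_apply, Prod.ext_iff, ite_and]
    split_ifs <;> simp
  rw [this, mul_one, one_mul]

theorem ExchRel.list_prod {C ι : Type*} [Ring C] [Algebra ℂ C]
    {F : ι → ℂ → Matrix (Fin n) (Fin n) C} (hF : ∀ a, ExchRel q (F a))
    (hc : ∀ a b, a ≠ b → ∀ x y i j k l, Commute (F a x i j) (F b y k l)) {l : List ι}
    (hl : l.Nodup) : ExchRel q fun x => (l.map fun a => F a x).prod := by
  induction l with
  | nil => exact ExchRel.one
  | cons a l ih =>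
    simp only [List.map_cons, List.prod_cons]
    refine (hF a).mul (ih hl.of_cons) fun x y i j k m => entry_commute_list_prod _ ?_ k m
    intro Y hY
    obtain ⟨b, hb, rfl⟩ := List.mem_map.1 hY
    exact hc a b (fun e => (List.nodup_cons.1 hl).1 (e ▸ hb)) x y i j

theorem ExchRel.pi {C Θ : Type*} [Ring C] [Algebra ℂ C]
    {F : Θ → ℂ → Matrix (Fin n) (Fin n) C} (hF : ∀ Γ, ExchRel q (F Γ)) :
    ExchRel q fun x => Matrix.of fun α β => fun Γ => F Γ x α β := by
  intro a b ha hb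
  ext I J Γ
  have := congrFun (congrFun (hF Γ a b ha hb) I) J
  simp only [Matrix.mul_apply, Finset.sum_apply, Pi.mul_apply, tmul, Matrix.of_apply,
    hat_apply, Pi.algebraMap_apply] at this ⊢
  exact this

/-- `siteHom` as an algebra homomorphism. -/
def siteAlgHom (m n : ℕ) (Θ C : Type*) [Fintype Θ] [DecidableEq Θ] [Ring C] [Algebra ℂ C]
    (a : Fin m) : (Θ → Matrix (Fin n) (Fin n) C) →ₐ[ℂ]
      Matrix ((Fin m → Fin n) × Θ) ((Fin m → Fin n) × Θ) C :=
  { siteHom m n Θ C a with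
    commutes' := fun c => siteHom_scalar a (algebraMap ℂ C c) }

end ExchRelMore

/-! ### Products of R-matrices between two tensor powers. -/

section Row

variable {n : ℕ} {q : ℂ} {ν : YoungDiagram}

/-- The product of the `R`-matrices `R(c x q^{2c_b})`, in decreasing order, with matrix entries. -/
def rowR (n : ℕ) (q : ℂ) (ν : YoungDiagram) (c : ℂ) :
    Matrix (Fin n) (Fin n) (Matrix ((Fin ν.card → Fin n) × StdTableau ν)
      ((Fin ν.card → Fin n) × StdTableau ν) ℂ⟦X⟧) :=
  (List.ofFn fun b => nestHom ν.card n (StdTableau ν) (Fin n) ℂ⟦X⟧ b fun Γ =>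
    swapNest _ _ _ (Rs n q (c * (q ^ (-2 * Γ.content b))⁻¹))).reverse.prod

/-- The inverse of the product of the `R`-matrices. -/
def rowQ (n : ℕ) (q : ℂ) (ν : YoungDiagram) (c : ℂ) :
    Matrix (Fin n) (Fin n) (Matrix ((Fin ν.card → Fin n) × StdTableau ν)
      ((Fin ν.card → Fin n) × StdTableau ν) ℂ⟦X⟧) :=
  nestProd fun (Γ : StdTableau ν) b => QsSwap n q (c * (q ^ (-2 * Γ.content b))⁻¹)

theorem swapNest_Rs_mul_QsSwap (hq0 : q ≠ 0) (t : ℂ) :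
    swapNest _ _ _ (Rs n q t) * QsSwap n q t = 1 := by
  have := congrArg (swapNest (Fin n) (Fin n) ℂ⟦X⟧) (Rs_mul_Qs (n := n) hq0 t)
  rw [map_mul, map_one] at this
  exact this

theorem QsSwap_mul_swapNest_Rs (hq0 : q ≠ 0) (t : ℂ) :
    QsSwap n q t * swapNest _ _ _ (Rs n q t) = 1 := by
  have := congrArg (swapNest (Fin n) (Fin n) ℂ⟦X⟧) (Qs_mul_Rs (n := n) hq0 t)
  rw [map_mul, map_one] at this
  exact this

theorem QsSwap_isUnit (hq0 : q ≠ 0) (t : ℂ) : IsUnit (QsSwap n q t) :=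
  ⟨⟨_, _, QsSwap_mul_swapNest_Rs hq0 t, swapNest_Rs_mul_QsSwap hq0 t⟩, rfl⟩

theorem rowR_mul_rowQ (hq0 : q ≠ 0) (c : ℂ) : rowR n q ν c * rowQ n q ν c = 1 := by
  refine prod_reverse_mul_prod _ _ fun b => ?_
  rw [← map_mul, ← map_one (nestHom ν.card n (StdTableau ν) (Fin n) ℂ⟦X⟧ b)]
  congr 1
  funext Γ
  exact swapNest_Rs_mul_QsSwap hq0 _

theorem rowQ_mul_rowR (hq0 : q ≠ 0) (c : ℂ) : rowQ n q ν c * rowR n q ν c = 1 := by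
  refine prod_mul_prod_reverse _ _ fun b => ?_
  rw [← map_mul, ← map_one (nestHom ν.card n (StdTableau ν) (Fin n) ℂ⟦X⟧ b)]
  congr 1
  funext Γ
  exact QsSwap_mul_swapNest_Rs hq0 _

/-- As a function of `c` each factor solves the RLL relation, and factors at different sites
commute, so their product is again a solution. -/
theorem rowR_exch (hq0 : q ≠ 0) : ExchRel q (rowR n q ν) := by
  have h := ExchRel.list_prod (q := q) (n := n)
    (F := fun (b : Fin ν.card) c => nestHom ν.card n (StdTableau ν) (Fin n) ℂ⟦X⟧ b fun Γ =>
      swapNest _ _ _ (Rs n q (c * (q ^ (-2 * Γ.content b))⁻¹))) (fun b => ?_) (fun a b hab x y i j k l => ?_)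
    (List.nodup_reverse.2 (List.nodup_finRange ν.card))
  · simp only [List.map_reverse, ← List.ofFn_eq_map] at h
    exact h
  · have h1 : ∀ Γ : StdTableau ν, ExchRel q fun c => Rs n q (c * (q ^ (-2 * Γ.content b))⁻¹) := by
      intro Γ
      have := Rs_exch (n := n) hq0 (q ^ (-2 * Γ.content b))⁻¹
      simpa only [mul_comm] using this
    have h2 := (ExchRel.pi h1).map (siteAlgHom ν.card n (StdTableau ν) ℂ⟦X⟧ b)
    refine cast ?_ h2
    congr 1
    funext c
    refine Matrix.ext fun i j => ?_
    rw [nestHom_entry]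
    rfl
  · rw [nestHom_entry, nestHom_entry]
    exact siteHom_commute hab fun _ _ _ _ _ => Commute.all _ _

/-- The variable is now the parameter of the second tensor power, on which the R-matrix depends
inversely. It is the inverse R-matrix that satisfies the RLL relation here, and `rowR` is then
handled as its inverse. -/
theorem rowQ_preserves (hq0 : q ≠ 0) (hq : ∀ k : ℕ, 0 < k → q ^ k ≠ 1) (c : ℂ) :
    Preserves (fun k => Matrix.scalar (Fin n) (hat ℂ⟦X⟧ (delta (Rcheck n q) (youngMatrix q ν) k)))
      (rowQ n q ν c) := fun k => ⟨_, (QsSwap_exch hq0 c).nest hq0 hq ν k⟩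

theorem rowR_preserves (hq0 : q ≠ 0) (hq : ∀ k : ℕ, 0 < k → q ^ k ≠ 1) (c : ℂ) :
    Preserves (fun k => Matrix.scalar (Fin n) (hat ℂ⟦X⟧ (delta (Rcheck n q) (youngMatrix q ν) k)))
      (rowR n q ν c) := fun k =>
  exists_mul_eq_of_isUnit ((QsSwap_exch hq0 c).nest hq0 hq ν k)
    (isUnit_prod_ofFn fun a => nestHom_isUnit a fun _ => QsSwap_isUnit hq0 _)
    (rowQ_mul_rowR hq0 c)

end Row

section Pair

variable {n : ℕ} {q : ℂ}

theorem nestHom_preserves {ι : Type*} {m : ℕ} {Θ J R : Type*} [Fintype Θ] [DecidableEq Θ]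
    [Fintype J] [DecidableEq J] [Ring R] {δ : ι → Matrix J J R} (a : Fin m)
    {X : Θ → Matrix (Fin n) (Fin n) (Matrix J J R)}
    (h : ∀ Λ, Preserves (fun k => Matrix.scalar (Fin n) (δ k)) (X Λ)) :
    Preserves (fun k => (δ k).map (Matrix.scalar ((Fin m → Fin n) × Θ)))
      (nestHom m n Θ J R a X) := fun k => by
  choose Y hY using fun Λ => h Λ k
  refine ⟨nestHom m n Θ J R a Y, ?_⟩
  beta_reduce
  rw [← swapNest_scalar, ← nestHom_const_scalar a (δ k), ← map_mul, ← map_mul]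
  congr 1
  funext Λ
  exact hY Λ

/-- The product of the `R`-matrices over all pairs of tensor factors. -/
def pairR (n : ℕ) (q : ℂ) (μ ν : YoungDiagram) :
    Matrix ((Fin ν.card → Fin n) × StdTableau ν) ((Fin ν.card → Fin n) × StdTableau ν)
      (Matrix ((Fin μ.card → Fin n) × StdTableau μ) ((Fin μ.card → Fin n) × StdTableau μ) ℂ⟦X⟧) :=
  nestProd fun (Λ : StdTableau μ) a => rowR n q ν (q ^ (-2 * Λ.content a))

/-- The inverse of the product of the `R`-matrices over all pairs of tensor factors. -/
def pairQ (n : ℕ) (q : ℂ) (μ ν : YoungDiagram) :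
    Matrix ((Fin ν.card → Fin n) × StdTableau ν) ((Fin ν.card → Fin n) × StdTableau ν)
      (Matrix ((Fin μ.card → Fin n) × StdTableau μ) ((Fin μ.card → Fin n) × StdTableau μ) ℂ⟦X⟧) :=
  (List.ofFn fun a => nestHom μ.card n (StdTableau μ) _ ℂ⟦X⟧ a fun Λ =>
    rowQ n q ν (q ^ (-2 * Λ.content a))).reverse.prod

variable {μ ν : YoungDiagram}

theorem pairR_mul_pairQ (hq0 : q ≠ 0) : pairR n q μ ν * pairQ n q μ ν = 1 := by
  refine prod_mul_prod_reverse _ _ fun a => ?_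
  rw [← map_mul, ← map_one (nestHom μ.card n (StdTableau μ)
    ((Fin ν.card → Fin n) × StdTableau ν) ℂ⟦X⟧ a)]
  congr 1
  funext Λ
  exact rowR_mul_rowQ hq0 _

theorem pairQ_mul_pairR (hq0 : q ≠ 0) : pairQ n q μ ν * pairR n q μ ν = 1 := by
  refine prod_reverse_mul_prod _ _ fun a => ?_
  rw [← map_mul, ← map_one (nestHom μ.card n (StdTableau μ)
    ((Fin ν.card → Fin n) × StdTableau ν) ℂ⟦X⟧ a)]
  congr 1
  funext Λ
  exact rowQ_mul_rowR hq0 _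

theorem pairR_preserves_left (hq0 : q ≠ 0) (hq : ∀ k : ℕ, 0 < k → q ^ k ≠ 1) :
    Preserves (fun k => Matrix.scalar ((Fin ν.card → Fin n) × StdTableau ν)
      (hat ℂ⟦X⟧ (delta (Rcheck n q) (youngMatrix q μ) k))) (pairR n q μ ν) :=
  fun k => ⟨_, (rowR_exch hq0).nest hq0 hq μ k⟩

theorem pairQ_preserves_left (hq0 : q ≠ 0) (hq : ∀ k : ℕ, 0 < k → q ^ k ≠ 1) :
    Preserves (fun k => Matrix.scalar ((Fin ν.card → Fin n) × StdTableau ν)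
      (hat ℂ⟦X⟧ (delta (Rcheck n q) (youngMatrix q μ) k))) (pairQ n q μ ν) :=
  fun k => exists_mul_eq_of_isUnit ((rowR_exch hq0).nest hq0 hq μ k)
    (isUnit_prod_ofFn fun a => nestHom_isUnit a fun _ =>
      ⟨⟨_, _, rowR_mul_rowQ hq0 _, rowQ_mul_rowR hq0 _⟩, rfl⟩) (pairR_mul_pairQ hq0)

theorem pairR_preserves_right (hq0 : q ≠ 0) (hq : ∀ k : ℕ, 0 < k → q ^ k ≠ 1) :
    Preserves (fun k => (hat ℂ⟦X⟧ (delta (Rcheck n q) (youngMatrix q ν) k)).map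
      (Matrix.scalar ((Fin μ.card → Fin n) × StdTableau μ))) (pairR n q μ ν) :=
  .list_prod fun X hX => by
    obtain ⟨a, rfl⟩ := (List.mem_ofFn' _ _).1 hX
    exact nestHom_preserves a fun Λ => rowR_preserves hq0 hq _

theorem pairQ_preserves_right (hq0 : q ≠ 0) (hq : ∀ k : ℕ, 0 < k → q ^ k ≠ 1) :
    Preserves (fun k => (hat ℂ⟦X⟧ (delta (Rcheck n q) (youngMatrix q ν) k)).map
      (Matrix.scalar ((Fin μ.card → Fin n) × StdTableau μ))) (pairQ n q μ ν) :=
  .list_prod fun X hX => by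
    obtain ⟨a, rfl⟩ := (List.mem_ofFn' _ _).1 (List.mem_reverse.1 hX)
    exact nestHom_preserves a fun Λ => rowQ_preserves hq0 hq _

variable {B : Type*} [Ring B]

/-- `L` crosses the factors `L'` from left to right, so the R-matrix of the first of them has to
stand next to `L`; this is the reason for the decreasing order in `rowR`. -/
theorem rowR_rll (ι : ℂ⟦X⟧ →+* B) (hc : ∀ k b, Commute (ι k) b)
    {L : Matrix (Fin n) (Fin n) B} {L' : ℂ → Matrix (Fin n) (Fin n) B} {c : ℂ}
    (h : ∀ b, b ≠ 0 → (Rs n q (c * b⁻¹)).map ι.mapMatrix * L.map (Matrix.scalar (Fin n)) *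
        Matrix.scalar (Fin n) (L' b) =
      Matrix.scalar (Fin n) (L' b) * L.map (Matrix.scalar (Fin n)) *
        (Rs n q (c * b⁻¹)).map ι.mapMatrix) (hq0 : q ≠ 0) {ℓ} (hℓ : ℓ =
          Matrix.blockDiagonal fun Γ : StdTableau ν => sprod fun b => L' (q ^ (-2 * Γ.content b))) :
    ι.mapMatrix.mapMatrix (rowR n q ν c) * L.map (Matrix.scalar _) * Matrix.scalar (Fin n) ℓ =
      Matrix.scalar (Fin n) ℓ * L.map (Matrix.scalar _) *
        ι.mapMatrix.mapMatrix (rowR n q ν c) := by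
  rw [hℓ, ← scalar_prod_siteHom fun b (Γ : StdTableau ν) => L' (q ^ (-2 * Γ.content b)), rowR,
    map_list_prod, List.map_reverse, List.map_ofFn]
  refine prod_reverse_mul_mul_eq _ _ _ (fun b => ?_) fun a b hab => ?_
  · rw [Function.comp_apply, nestHom_map, ← swapNest_scalar, ← nestHom_const_scalar b L, ← map_mul,
      ← map_mul, ← map_mul, ← map_mul]
    congr 1
    funext Γ
    have := congrArg (swapNest (Fin n) (Fin n) B) (h _ (zpow_ne_zero (-2 * Γ.content b) hq0))
    rw [map_mul, map_mul, map_mul, map_mul, swapNest_map_scalar, swapNest_scalar] at this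
    exact this
  · rw [Function.comp_apply, nestHom_map]
    exact nestHom_commute hab fun Λ i j k l =>
      ((mapMatrix_centralEntries ι hc _).scalar_commute _).symm

end Pair

/-! ### Commuting transfer matrices. -/

section PairTrace

variable {n : ℕ} {q : ℂ} {μ ν : YoungDiagram} {B : Type*} [Ring B]

theorem mapMatrix_mapMatrix_scalar {K U J : Type*} [CommRing K] [Fintype U] [DecidableEq U]
    [Fintype J] [DecidableEq J] (ι : K →+* B) (M : Matrix U U K) :
    ι.mapMatrix.mapMatrix (Matrix.scalar J M) = Matrix.scalar J (ι.mapMatrix M) :=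
  Matrix.diagonal_map (map_zero ι.mapMatrix)

theorem mapMatrix_mapMatrix_map_scalar {K U J : Type*} [CommRing K] [Fintype U] [DecidableEq U]
    [Fintype J] [DecidableEq J] (ι : K →+* B) (M : Matrix J J K) :
    ι.mapMatrix.mapMatrix (M.map (Matrix.scalar U)) = (ι.mapMatrix M).map (Matrix.scalar U) :=
  Matrix.ext fun _ _ => Matrix.diagonal_map (map_zero ι)

theorem nested_centralEntries {K U J : Type*} [CommRing K] [Fintype U] [DecidableEq U]
    [Fintype J] [DecidableEq J] (ι : K →+* B) (hc : ∀ k b, Commute (ι k) b)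
    (M : Matrix J J (Matrix U U K)) :
    CentralEntries (Matrix.compRingEquiv J U B (ι.mapMatrix.mapMatrix M)) :=
  fun _ _ _ => hc _ _

/-- Transfer matrices intertwined by an invertible scalar matrix commute. -/
theorem commute_trace_of_intertwine {K U J ι₁ ι₂ : Type*} [CommRing K] [Algebra ℂ K] [Algebra ℂ B]
    [Fintype U] [DecidableEq U] [Fintype J] [DecidableEq J] [Fintype ι₁] [Fintype ι₂]
    (ι : K →+* B) (hc : ∀ k b, Commute (ι k) b)
    (hι : ∀ c, ι (algebraMap ℂ K c) = algebraMap ℂ B c)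
    {δ : ι₁ → Matrix U U ℂ} {δ' : ι₂ → Matrix J J ℂ} {e : Matrix U U ℂ} {e' : Matrix J J ℂ}
    (he : IsKerProj δ e) (he' : IsKerProj δ' e')
    {R Q : Matrix J J (Matrix U U K)} (hRQ : R * Q = 1) (hQR : Q * R = 1)
    (hR : Preserves (fun k => Matrix.scalar J (hat K (δ k))) R)
    (hQ : Preserves (fun k => Matrix.scalar J (hat K (δ k))) Q)
    (hR' : Preserves (fun k => (hat K (δ' k)).map (Matrix.scalar U)) R)
    (hQ' : Preserves (fun k => (hat K (δ' k)).map (Matrix.scalar U)) Q)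
    {X : Matrix U U B} {X' : Matrix J J B}
    (hX : Preserves (fun k => hat B (δ k)) X) (hX' : Preserves (fun k => hat B (δ' k)) X')
    (h : ι.mapMatrix.mapMatrix R * Matrix.scalar J X * X'.map (Matrix.scalar U) =
      X'.map (Matrix.scalar U) * Matrix.scalar J X * ι.mapMatrix.mapMatrix R) :
    Commute (X * hat B e).trace (X' * hat B e').trace := by
  set r := ι.mapMatrix.mapMatrix R with hr
  set s := ι.mapMatrix.mapMatrix Q with hs
  set x : Matrix J J (Matrix U U B) := Matrix.scalar J X with hx
  set x' : Matrix J J (Matrix U U B) := X'.map (Matrix.scalar U) with hx'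
  set E : Matrix J J (Matrix U U B) := Matrix.scalar J (hat B e) with hE
  set E' : Matrix J J (Matrix U U B) := (hat B e').map (Matrix.scalar U) with hE'
  have hrs : r * s = 1 := by rw [hr, hs, ← map_mul, hRQ, map_one]
  have hsr : s * r = 1 := by rw [hr, hs, ← map_mul, hQR, map_one]
  have cz : ∀ (Z : Matrix U U ℂ) (N : Matrix J J B),
      Commute (Matrix.scalar J (hat B Z)) (N.map (Matrix.scalar U)) := fun Z N =>
    scalar_commute_map_scalar fun i j => ((hat_centralEntries Z).scalar_commute _).symm
  have cz' : ∀ (N : Matrix U U B) (Z : Matrix J J ℂ),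
      Commute (Matrix.scalar J N) ((hat B Z).map (Matrix.scalar U)) := fun N Z =>
    scalar_commute_map_scalar fun i j => by
      ext u v
      rw [Matrix.scalar_apply, Matrix.diagonal_mul, Matrix.mul_diagonal]
      exact (hat_centralEntries Z i j (N u v)).eq.symm
  have d1 : (fun k => ι.mapMatrix.mapMatrix (Matrix.scalar J (hat K (δ k)))) =
      fun k => Matrix.scalar J (hat B (δ k)) := by
    funext k
    rw [mapMatrix_mapMatrix_scalar, mapMatrix_hat ι hι]
  have d2 : (fun k => ι.mapMatrix.mapMatrix ((hat K (δ' k)).map (Matrix.scalar U))) =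
      fun k => (hat B (δ' k)).map (Matrix.scalar U) := by
    funext k
    rw [mapMatrix_mapMatrix_map_scalar, mapMatrix_hat ι hι]
  have r1 := hR.map ι.mapMatrix.mapMatrix
  have s1 := hQ.map ι.mapMatrix.mapMatrix
  have r2 := hR'.map ι.mapMatrix.mapMatrix
  have s2 := hQ'.map ι.mapMatrix.mapMatrix
  rw [d1] at r1 s1
  rw [d2] at r2 s2
  have x1 : Preserves (fun k => Matrix.scalar J (hat B (δ k))) x := hX.map (Matrix.scalar J)
  have x1' : Preserves (fun k => Matrix.scalar J (hat B (δ k))) x' :=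
    .of_commute fun k => cz _ _
  have x2 : Preserves (fun k => (hat B (δ' k)).map (Matrix.scalar U)) x :=
    .of_commute fun k => (cz' _ _).symm
  have x2' : Preserves (fun k => (hat B (δ' k)).map (Matrix.scalar U)) x' :=
    hX'.map (Matrix.scalar U).mapMatrix
  have k1 : IsKerProj (fun k => Matrix.scalar J (hat B (δ k))) E :=
    (he.map (hat B)).map (Matrix.scalar J)
  have k2 : IsKerProj (fun k => (hat B (δ' k)).map (Matrix.scalar U)) E' :=
    (he'.map (hat B)).map (Matrix.scalar U).mapMatrix
  have hcE : Commute E E' := cz _ _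
  have hs' : E * E' * (s * (E * E')) = s * (E * E') :=
    mul_mul_mul_eq hcE (k1.mul_mul_eq s1) (k2.mul_mul_eq s2)
  have hy : E * E' * (r * x * x' * (E * E')) = r * x * x' * (E * E') :=
    mul_mul_mul_eq hcE (k1.mul_mul_eq ((r1.mul x1).mul x1')) (k2.mul_mul_eq ((r2.mul x2).mul x2'))
  have c1 : CentralEntries (Matrix.compRingEquiv J U B s) := nested_centralEntries ι hc Q
  have c2 : CentralEntries (Matrix.compRingEquiv J U B (E * E')) := by
    have : E * E' = ι.mapMatrix.mapMatrix
        (Matrix.scalar J (hat K e) * (hat K e').map (Matrix.scalar U)) := by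
      rw [map_mul, mapMatrix_mapMatrix_scalar, mapMatrix_mapMatrix_map_scalar, mapMatrix_hat ι hι,
        mapMatrix_hat ι hι]
    rw [this]
    exact nested_centralEntries ι hc _
  have hs'' := congrArg (Matrix.compRingEquiv J U B) hs'
  have hy'' := congrArg (Matrix.compRingEquiv J U B) hy
  -- The inverse `s` of `r` has central entries and preserves both kernels, so it rotates through
  -- the trace. On one side `s r x x' = x x'`, on the other `r x x' s = x' x`, which gives the two
  -- orders of the product of traces.
  have key := trace_rotate c1 c2 (Y := Matrix.compRingEquiv J U B (r * x * x'))
    (by simpa only [map_mul] using hs'') (by simpa only [map_mul] using hy'')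
  rw [← map_mul, ← map_mul, ← map_mul, ← map_mul] at key
  have m1 : Matrix.scalar J (X * hat B e) = x * E := map_mul _ _ _
  have m2 : (X' * hat B e').map (Matrix.scalar U) = x' * E' :=
    map_mul (Matrix.scalar U).mapMatrix _ _
  have e1 : s * (r * x * x') * (E * E') =
      Matrix.scalar J (X * hat B e) * (X' * hat B e').map (Matrix.scalar U) := by
    calc s * (r * x * x') * (E * E') = (s * r) * (x * (x' * E) * E') := by simp only [mul_assoc]
      _ = _ := by
        have : Commute E x' := cz e X'
        rw [hsr, one_mul, ← this.eq, m1, m2]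
        simp only [mul_assoc]
  have e2 : r * x * x' * s * (E * E') =
      (X' * hat B e').map (Matrix.scalar U) * Matrix.scalar J (X * hat B e) := by
    calc r * x * x' * s * (E * E') = x' * x * (r * s) * (E * E') := by
          rw [h]; simp only [mul_assoc]
      _ = x' * (x * E') * E := by rw [hrs, mul_one, hcE.eq]; simp only [mul_assoc]
      _ = _ := by
        have : Commute x E' := cz' X e'
        rw [this.eq, m1, m2]
        simp only [mul_assoc]
  rw [e1, e2, trace_scalar_mul_map_scalar, trace_map_scalar_mul_scalar] at key
  exact key

theorem commute_trace [Algebra ℂ B] (hq0 : q ≠ 0) (hq : ∀ k : ℕ, 0 < k → q ^ k ≠ 1)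
    (ι : ℂ⟦X⟧ →+* B) (hc : ∀ k b, Commute (ι k) b)
    (hι : ∀ c, ι (algebraMap ℂ ℂ⟦X⟧ c) = algebraMap ℂ B c)
    {L L' : ℂ → Matrix (Fin n) (Fin n) B} (hL : ExchRel q L) (hL' : ExchRel q L')
    (h : ∀ a b, b ≠ 0 → (Rs n q (a * b⁻¹)).map ι.mapMatrix * (L a).map (Matrix.scalar (Fin n)) *
        Matrix.scalar (Fin n) (L' b) =
      Matrix.scalar (Fin n) (L' b) * (L a).map (Matrix.scalar (Fin n)) *
        (Rs n q (a * b⁻¹)).map ι.mapMatrix)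
    {e : Matrix ((Fin μ.card → Fin n) × StdTableau μ) ((Fin μ.card → Fin n) × StdTableau μ) ℂ}
    (he : IsKerProj (delta (Rcheck n q) (youngMatrix q μ)) e)
    {e' : Matrix ((Fin ν.card → Fin n) × StdTableau ν) ((Fin ν.card → Fin n) × StdTableau ν) ℂ}
    (he' : IsKerProj (delta (Rcheck n q) (youngMatrix q ν)) e') :
    Commute
      (Matrix.blockDiagonal (fun Λ : StdTableau μ => sprod fun a => L (q ^ (-2 * Λ.content a))) *
        hat B e).trace
      (Matrix.blockDiagonal (fun Γ : StdTableau ν => sprod fun a => L' (q ^ (-2 * Γ.content a))) *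
        hat B e').trace := by
  refine commute_trace_of_intertwine ι hc hι he he' (pairR_mul_pairQ hq0) (pairQ_mul_pairR hq0)
    (pairR_preserves_left hq0 hq) (pairQ_preserves_left hq0 hq) (pairR_preserves_right hq0 hq)
    (pairQ_preserves_right hq0 hq) (fun k => (hL.exchanges hq0 hq μ).delta_mul k)
    (fun k => (hL'.exchanges hq0 hq ν).delta_mul k) ?_
  rw [← swapNest_scalar]
  exact nestProd_mul_scalar_mul ι hc (L := fun (Λ : StdTableau μ) a => L (q ^ (-2 * Λ.content a)))
    fun Λ a => rowR_rll ι hc (h (q ^ (-2 * Λ.content a))) hq0 rfl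

end PairTrace

/-! ### Absorbing D into L⁺. -/

section DiagonalTwist

variable {n : ℕ} {q : ℂ}

theorem TB_commute_Dmat {K : Type*} [CommRing K] [Algebra ℂ K] (u v : K) :
    Commute (TB n q u v) (hat K (tmul (Dmat n q) (Dmat n q))) := by
  have h : Commute (hat K (Tmat n q)) (hat K (tmul (Dmat n q) (Dmat n q))) :=
    (Tmat_commute_Dmat n q).map (hat K)
  exact (h.smul_left _).add_left ((Commute.one_left _).smul_left _)

theorem hat_Dmat_exch (n : ℕ) (q : ℂ) (B : Type*) [Ring B] [Algebra ℂ B] :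
    ExchRel q fun _ => hat B (Dmat n q) := by
  intro a b _ _
  have e : tmul (hat B (Dmat n q)) (hat B (Dmat n q)) = hat B (tmul (Dmat n q) (Dmat n q)) :=
    (tmul_map (algebraMap ℂ B) _ _).symm
  rw [e, ← map_mul, ← map_mul]
  congr 1
  have := TB_commute_Dmat (n := n) (q := q) a b
  have h1 : hat ℂ (tmul (Dmat n q) (Dmat n q)) = tmul (Dmat n q) (Dmat n q) := rfl
  rw [h1] at this
  exact this.eq

/-- The commutation of Ř with `D ⊗ D`, transferred to matrices with matrix entries, where the two
copies of `D` act on different levels. -/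
theorem Smat_mul_Dmat {K : Type*} [CommRing K] [Algebra ℂ K] (f u w : K) :
    Commute (f • Smat n q u w) ((hat K (Dmat n q)).map (Matrix.scalar (Fin n)) *
      Matrix.scalar (Fin n) (hat K (Dmat n q))) := by
  refine Commute.smul_left ?_ f
  have hd : (hat K (Dmat n q)).map (Matrix.scalar (Fin n)) *
      Matrix.scalar (Fin n) (hat K (Dmat n q)) = Matrix.diagonal fun α : Fin n =>
        Matrix.diagonal fun i : Fin n => algebraMap ℂ K (q ^ ((n : ℤ) - 1 - 2 * (i : ℤ)) *
          q ^ ((n : ℤ) - 1 - 2 * (α : ℤ))) := by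
    refine Matrix.ext fun α β => ?_
    rw [mul_scalar_apply, Matrix.map_apply, hat_apply, Dmat, Matrix.diagonal_apply,
      Matrix.diagonal_apply]
    split_ifs with h
    · ext i j
      rw [Matrix.scalar_apply, Matrix.diagonal_mul, hat_apply, Matrix.diagonal_apply,
        Matrix.diagonal_apply]
      split_ifs <;> simp [mul_comm]
    · rw [map_zero, map_zero, zero_mul]
  rw [hd]
  refine Matrix.ext fun α β => ?_
  rw [Matrix.mul_diagonal, Matrix.diagonal_mul]
  ext i j
  rw [Matrix.mul_diagonal, Matrix.diagonal_mul]
  have := congrFun (congrFun (TB_commute_Dmat (n := n) (q := q) u w).eq (i, α)) (β, j)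
  rw [tmul_Dmat] at this
  have e : hat K (Matrix.diagonal fun p : Fin n × Fin n =>
      q ^ ((n : ℤ) - 1 - 2 * (p.1 : ℤ)) * q ^ ((n : ℤ) - 1 - 2 * (p.2 : ℤ))) =
      Matrix.diagonal fun p : Fin n × Fin n => algebraMap ℂ K
      (q ^ ((n : ℤ) - 1 - 2 * (p.1 : ℤ)) * q ^ ((n : ℤ) - 1 - 2 * (p.2 : ℤ))) :=
    Matrix.diagonal_map (map_zero _)
  rw [e, Matrix.mul_diagonal, Matrix.diagonal_mul, mul_comm (q ^ ((n : ℤ) - 1 - 2 * (β : ℤ)))] at this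
  exact this

/-- Twisting both factors by the diagonal matrix preserves the `RLL` relation. -/
theorem rll_mul_Dmat {B : Type*} [Ring B] [Algebra ℂ B] (ι : ℂ⟦X⟧ →+* B)
    (hι : ∀ c, ι (algebraMap ℂ ℂ⟦X⟧ c) = algebraMap ℂ B c)
    {L ℓ : Matrix (Fin n) (Fin n) B} {t : ℂ}
    (h : (Rs n q t).map ι.mapMatrix * L.map (Matrix.scalar (Fin n)) * Matrix.scalar (Fin n) ℓ =
      Matrix.scalar (Fin n) ℓ * L.map (Matrix.scalar (Fin n)) * (Rs n q t).map ι.mapMatrix) :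
    (Rs n q t).map ι.mapMatrix * (L * hat B (Dmat n q)).map (Matrix.scalar (Fin n)) *
        Matrix.scalar (Fin n) (ℓ * hat B (Dmat n q)) =
      Matrix.scalar (Fin n) (ℓ * hat B (Dmat n q)) *
        (L * hat B (Dmat n q)).map (Matrix.scalar (Fin n)) * (Rs n q t).map ι.mapMatrix := by
  have hR : Commute ((Rs n q t).map ι.mapMatrix) ((hat B (Dmat n q)).map (Matrix.scalar (Fin n)) *
      Matrix.scalar (Fin n) (hat B (Dmat n q))) := by
    have : Commute (Rs n q t) _ := Smat_mul_Dmat _ _ _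
    have := this.map ι.mapMatrix.mapMatrix
    rwa [map_mul, mapMatrix_mapMatrix_scalar, mapMatrix_mapMatrix_map_scalar,
      mapMatrix_hat ι hι] at this
  set r := (Rs n q t).map ι.mapMatrix
  have m1 : (L * hat B (Dmat n q)).map (Matrix.scalar (Fin n)) =
      L.map (Matrix.scalar (Fin n)) * (hat B (Dmat n q)).map (Matrix.scalar (Fin n)) :=
    map_mul (Matrix.scalar (Fin n)).mapMatrix _ _
  have m2 : Matrix.scalar (Fin n) (ℓ * hat B (Dmat n q)) =
      Matrix.scalar (Fin n) ℓ * Matrix.scalar (Fin n) (hat B (Dmat n q)) := map_mul _ _ _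
  have c1 : Commute (Matrix.scalar (Fin n) ℓ) ((hat B (Dmat n q)).map (Matrix.scalar (Fin n))) :=
    scalar_commute_map_scalar fun i j => by
      ext u v
      rw [Matrix.scalar_apply, Matrix.diagonal_mul, Matrix.mul_diagonal]
      exact (hat_centralEntries (Dmat n q) i j (ℓ u v)).eq.symm
  have c2 : ∀ N : Matrix (Fin n) (Fin n) B, Commute (Matrix.scalar (Fin n) (hat B (Dmat n q)))
      (N.map (Matrix.scalar (Fin n))) := fun N =>
    scalar_commute_map_scalar fun i j => ((hat_centralEntries _).scalar_commute _).symm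
  have c3 := (c2 L)
  have c4 := c2 (hat B (Dmat n q))
  rw [m1, m2]
  set d := (hat B (Dmat n q)).map (Matrix.scalar (Fin n))
  set d' := Matrix.scalar (Fin n) (hat B (Dmat n q))
  set l := L.map (Matrix.scalar (Fin n))
  set l' := Matrix.scalar (Fin n) ℓ
  calc r * (l * d) * (l' * d') = r * l * (d * l') * d' := by simp only [mul_assoc]
    _ = r * l * l' * (d * d') := by rw [← c1.eq]; simp only [mul_assoc]
    _ = l' * l * (d * d' * r) := by rw [h, mul_assoc, hR.eq]
    _ = l' * (l * d') * d * r := by rw [← c4.eq]; simp only [mul_assoc]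
    _ = _ := by rw [← c3.eq]; simp only [mul_assoc]

theorem prod_ofFn_mul {S : Type*} [Monoid S] {m : ℕ} (f g : Fin m → S)
    (h : ∀ a b, a ≠ b → Commute (g a) (f b)) :
    (List.ofFn fun a => f a * g a).prod = (List.ofFn f).prod * (List.ofFn g).prod := by
  induction m with
  | zero => simp
  | succ m ih =>
    have c : Commute (g 0) (List.ofFn fun a => f (Fin.succ a)).prod :=
      Commute.list_prod_right _ _ fun y hy => by
        obtain ⟨a, rfl⟩ := (List.mem_ofFn' _ _).1 hy
        exact h _ _ (Fin.succ_ne_zero a).symm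
    simp only [List.ofFn_succ, List.prod_cons]
    rw [ih (fun a => f a.succ) (fun a => g a.succ)
      fun a b hab => h _ _ (by simpa using hab)]
    rw [mul_assoc, ← mul_assoc (g 0), c.eq]
    simp only [mul_assoc]

theorem sprod_mul_hat {B : Type*} [Ring B] [Algebra ℂ B] {m : ℕ}
    (f : Fin m → Matrix (Fin n) (Fin n) B) (D : Matrix (Fin n) (Fin n) ℂ) :
    sprod (fun a => f a * hat B D) = sprod f * hat B (sprod fun _ => D) := by
  rw [hat_sprod, sprod, sprod, sprod, ← prod_ofFn_mul]
  · congr 2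
    funext a
    exact at1_mul a _ _
  · intro a b hab
    exact at1_commute hab fun i j k l => hat_centralEntries D i j _

end DiagonalTwist

/-! ### The two-variable form of the L⁺L⁺ relation. -/

section PlusPlus

variable {n : ℕ} {q : ℂ}

/-- Scalar power series in the first variable. -/
abbrev constHat (A : Type*) [Ring A] [Algebra ℂ A] : ℂ⟦X⟧ →+* A⟦X⟧⟦X⟧ :=
  PowerSeries.C.comp (serHat A)

theorem constHat_commute {A : Type*} [Ring A] [Algebra ℂ A] (f : ℂ⟦X⟧) (G : A⟦X⟧⟦X⟧) :
    Commute (constHat A f) G := by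
  ext r : 1
  rw [RingHom.comp_apply, PowerSeries.coeff_C_mul, PowerSeries.coeff_mul_C]
  exact (serHat_commute _ _).eq

theorem constHat_algebraMap {A : Type*} [Ring A] [Algebra ℂ A] (c : ℂ) :
    constHat A (algebraMap ℂ ℂ⟦X⟧ c) = algebraMap ℂ A⟦X⟧⟦X⟧ c := by
  rw [RingHom.comp_apply, PowerSeries.algebraMap_apply (A := A⟦X⟧)]
  congr 1

theorem coeff_serHat_rescale_mul {A : Type*} [Ring A] [Algebra ℂ A] (t c : ℂ) (f : ℂ⟦X⟧)
    {F F' : A⟦X⟧} (h : ∀ l, PowerSeries.coeff l F' = (t ^ l * c) • PowerSeries.coeff l F) (s : ℕ) :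
    PowerSeries.coeff s (serHat A (PowerSeries.rescale t f) * F') =
      (t ^ s * c) • PowerSeries.coeff s (serHat A f * F) := by
  rw [PowerSeries.coeff_mul, PowerSeries.coeff_mul, Finset.smul_sum]
  refine Finset.sum_congr rfl fun k hk => ?_
  have hk' : k.1 + k.2 = s := by simpa using hk
  rw [h, PowerSeries.coeff_map, PowerSeries.coeff_map, PowerSeries.coeff_rescale, map_mul,
    Algebra.algebraMap_eq_smul_one (t ^ k.1), smul_mul_assoc, one_mul, smul_mul_smul_comm,
    ← hk', pow_add, mul_assoc]

theorem coeff_diagHom_mul_map_C {A : Type*} [Ring A] (f g : A⟦X⟧) (N s : ℕ) :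
    PowerSeries.coeff s (PowerSeries.coeff N (diagHom A f * PowerSeries.map PowerSeries.C g)) =
      if s ≤ N then PowerSeries.coeff s f * PowerSeries.coeff (N - s) g else 0 := by
  rw [coeff_diagHom_mul]
  split_ifs with h
  · rw [Finset.sum_eq_single s]
    · simp [h]
    · intro k _ hk
      split_ifs with h'
      · rw [PowerSeries.coeff_map, PowerSeries.coeff_C, if_neg (by omega), mul_zero]
      · rfl
    · intro h'
      simp at h'
  · refine Finset.sum_eq_zero fun k _ => ?_
    split_ifs with h'
    · rw [PowerSeries.coeff_map, PowerSeries.coeff_C, if_neg (by omega), mul_zero]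
    · rfl

theorem coeff_map_C_mul_diagHom {A : Type*} [Ring A] (f g : A⟦X⟧) (N s : ℕ) :
    PowerSeries.coeff s (PowerSeries.coeff N (PowerSeries.map PowerSeries.C g * diagHom A f)) =
      if s ≤ N then PowerSeries.coeff (N - s) g * PowerSeries.coeff s f else 0 := by
  rw [PowerSeries.coeff_mul, map_sum]
  simp only [PowerSeries.coeff_map, PowerSeries.coeff_C_mul, coeff_diagHom,
    PowerSeries.coeff_monomial]
  split_ifs with h
  · rw [Finset.sum_eq_single (N - s, s)]
    · simp
    · intro k hk hne
      have hk' : k.1 + k.2 = N := by simpa using hk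
      rw [if_neg, mul_zero]
      rintro rfl
      exact hne (Prod.ext (by simp; omega) rfl)
    · intro h'
      simp at h'
      omega
  · refine Finset.sum_eq_zero fun k hk => ?_
    have hk' : k.1 + k.2 = N := by simpa using hk
    rw [if_neg (by omega), mul_zero]

/-- With inner variable `x` and outer variable `y` the two arguments are `a x y` and `b y`. Their
ratio involves only `x`, hence `constHat`; the coefficient of `y^N` brings back the homogeneous
component of `Rser_mul_plusPlus`. -/
theorem plus_plus_rll (hq0 : q ≠ 0) (a b : ℂ) (hb : b ≠ 0) :
    (Rs n q (a * b⁻¹)).map (constHat (UqCrit n q)).mapMatrix *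
        ((LPlus n q a).map (diagHom (UqCrit n q))).map (Matrix.scalar (Fin n)) *
        Matrix.scalar (Fin n) ((LPlus n q b).map (PowerSeries.map PowerSeries.C)) =
      Matrix.scalar (Fin n) ((LPlus n q b).map (PowerSeries.map PowerSeries.C)) *
        ((LPlus n q a).map (diagHom (UqCrit n q))).map (Matrix.scalar (Fin n)) *
        (Rs n q (a * b⁻¹)).map (constHat (UqCrit n q)).mapMatrix := by
  refine rll_of_entries hq0 _ fun I J => ?_
  simp only [← (constHat_commute _ _).eq]
  ext N s
  -- Rescaling the coefficient of `x^s` by `(a/b)^s b^N` inserts the parameters `a` and `b`.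
  have h := congrArg (fun M => ((a * b⁻¹) ^ s * b ^ N) • PowerSeries.coeff s M)
    (congrFun (congrFun (Rser_mul_plusPlus (n := n) (q := q) N) I) J)
  have hab : ∀ l ≤ N, a ^ l * b ^ (N - l) = (a * b⁻¹) ^ l * b ^ N := by
    intro l hl
    rw [mul_pow, inv_pow, ← Nat.sub_add_cancel hl, pow_add, Nat.add_sub_cancel]
    field_simp
  simp only [Matrix.mul_apply, map_sum, Finset.smul_sum, Matrix.map_apply,
    ← (serHat_commute _ _).eq] at h
  simp only [map_sum, RingHom.comp_apply, PowerSeries.coeff_C_mul]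
  refine Eq.trans (Finset.sum_congr rfl fun K _ => coeff_serHat_rescale_mul _ _ _ (fun l => ?_) s)
    (h.trans (Finset.sum_congr rfl fun K _ =>
      (coeff_serHat_rescale_mul _ _ _ (fun l => ?_) s).symm))
  · rw [Matrix.map_apply, Matrix.map_apply, coeff_diagHom_mul_map_C]
    simp only [LPlus, plusPlus, Matrix.of_apply, PowerSeries.coeff_mk]
    split_ifs with hl
    · rw [smul_mul_smul_comm, hab l hl]
    · rw [smul_zero]
  · rw [Matrix.map_apply, Matrix.map_apply, coeff_map_C_mul_diagHom]
    simp only [LPlus, plusPlusRev, Matrix.of_apply, PowerSeries.coeff_mk]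
    split_ifs with hl
    · rw [smul_mul_smul_comm, mul_comm (b ^ _), hab l hl]
    · rw [smul_zero]

end PlusPlus

/-! ### Commutativity of the coefficients. -/

section Commuting

variable {n : ℕ} {q : ℂ}

/-- `f(z) ↦ f(x y)` as an algebra homomorphism. -/
def diagAlgHom (A : Type*) [Ring A] [Algebra ℂ A] : A⟦X⟧ →ₐ[ℂ] A⟦X⟧⟦X⟧ :=
  { diagHom A with commutes' := diagHom_algebraMap }

/-- `f(z) ↦ f(y)` as an algebra homomorphism. -/
def secondAlgHom (A : Type*) [Ring A] [Algebra ℂ A] : A⟦X⟧ →ₐ[ℂ] A⟦X⟧⟦X⟧ :=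
  { PowerSeries.map PowerSeries.C with
    commutes' := fun c => by
      rw [PowerSeries.algebraMap_apply, PowerSeries.algebraMap_apply (A := A⟦X⟧),
        PowerSeries.algebraMap_apply]
      exact PowerSeries.map_C _ _ }

theorem map_trace_LDprod {B : Type*} [Ring B] [Algebra ℂ B] (φ : (UqCrit n q)⟦X⟧ →ₐ[ℂ] B)
    {μ : YoungDiagram}
    (e : Matrix ((Fin μ.card → Fin n) × StdTableau μ) ((Fin μ.card → Fin n) × StdTableau μ) ℂ) :
    φ (Matrix.blockDiagonal (LDprod n q : StdTableau μ → _) * hat _ e).trace =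
      (Matrix.blockDiagonal (fun Λ : StdTableau μ => sprod fun a =>
        (LPlus n q (q ^ (-2 * Λ.content a))).map φ * hat B (Dmat n q)) * hat B e).trace := by
  rw [blockDiagonal_LDprod, map_trace_blockDiagonal, Dblock, hat_blockDiagonal,
    ← Matrix.blockDiagonal_mul]
  congr 3
  funext Λ
  exact (sprod_mul_hat _ _).symm

/-- `commute_trace` gives the commutation of the two series at the arguments `x y` and `y`. The
coefficient of `x^r y^{r+s}` isolates the product of the `r`-th and the `s`-th coefficients. -/
theorem Sbar_coeff_commute (hq0 : q ≠ 0) (hq : ∀ k : ℕ, 0 < k → q ^ k ≠ 1)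
    {μ ν : YoungDiagram} (Λ : StdTableau μ) (Γ : StdTableau ν) (r s : ℕ) :
    Commute (PowerSeries.coeff r (Sbar n q Λ)) (PowerSeries.coeff s (Sbar n q Γ)) := by
  obtain ⟨e, he⟩ := exists_isKerProj (delta (Rcheck n q) (youngMatrix q μ))
  obtain ⟨κ, hκ⟩ := exists_Sbar_eq hq0 hq he
  obtain ⟨e', he'⟩ := exists_isKerProj (delta (Rcheck n q) (youngMatrix q ν))
  obtain ⟨κ', hκ'⟩ := exists_Sbar_eq hq0 hq he'
  rw [hκ, hκ', PowerSeries.coeff_smul, PowerSeries.coeff_smul]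
  refine (Commute.smul_left ?_ κ).smul_right κ'
  have h := commute_trace hq0 hq (constHat (UqCrit n q)) constHat_commute constHat_algebraMap
    (((LPlus_exch hq0).map (diagAlgHom (UqCrit n q))).mul (hat_Dmat_exch n q _) fun _ _ _ _ k l =>
      (hat_centralEntries (Dmat n q) k l _).symm)
    (((LPlus_exch hq0).map (secondAlgHom (UqCrit n q))).mul (hat_Dmat_exch n q _) fun _ _ _ _ k l =>
      (hat_centralEntries (Dmat n q) k l _).symm)
    (fun a b hb => rll_mul_Dmat _ constHat_algebraMap (plus_plus_rll hq0 a b hb)) he he'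
  rw [← map_trace_LDprod, ← map_trace_LDprod] at h
  have h1 := congrArg (fun f => PowerSeries.coeff r (PowerSeries.coeff (r + s) f)) h.eq
  have h2 := coeff_diagHom_mul_map_C
    (Matrix.blockDiagonal (LDprod n q : StdTableau μ → _) * hat _ e).trace
    (Matrix.blockDiagonal (LDprod n q : StdTableau ν → _) * hat _ e').trace (r + s) r
  have h3 := coeff_map_C_mul_diagHom
    (Matrix.blockDiagonal (LDprod n q : StdTableau μ → _) * hat _ e).trace
    (Matrix.blockDiagonal (LDprod n q : StdTableau ν → _) * hat _ e').trace (r + s) r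
  rw [if_pos (by omega), Nat.add_sub_cancel_left] at h2 h3
  exact h2.symm.trans (h1.trans h3)

theorem invariants_commute {v w : invariants n q} {x y : UqCrit n q}
    (hv : (v : Vac n q) = x • vac n q) (hw : (w : Vac n q) = y • vac n q) (h : Commute x y) :
    Commute v w := by
  refine Subtype.ext ?_
  rw [coe_mul_of_eq v w x y hv hw, coe_mul_of_eq w v y x hw hv, h.eq]

end Commuting

end QSugawara

end

theorem corollary3p4 (n : ℕ) (hn : 1 ≤ n) (q : ℂ) (hq0 : q ≠ 0)
    (hq : ∀ k : ℕ, 0 < k → q ^ k ≠ 1) :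
    -- `S̄_Λ(z)·1` does not depend on the standard `μ`-tableau `Λ`
    (∀ μ : YoungDiagram, μ.colLen 0 ≤ n → ∀ Λ Γ : StdTableau μ, ∀ r : ℕ,
      PowerSeries.coeff r (Sbar n q Λ) • vac n q = PowerSeries.coeff r (Sbar n q Γ) • vac n q) ∧
    -- all its coefficients are invariants of the vacuum module
    (∀ μ : YoungDiagram, μ.colLen 0 ≤ n → ∀ Λ : StdTableau μ, ∀ r : ℕ,
      PowerSeries.coeff r (Sbar n q Λ) • vac n q ∈ invariants n q) ∧
    -- the coefficients of all series `S̄_Λ(z)` pairwise commute in the quantum affine algebra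
    (∀ μ ν : YoungDiagram, μ.colLen 0 ≤ n → ν.colLen 0 ≤ n →
      ∀ (Λ : StdTableau μ) (Γ : StdTableau ν) (r s : ℕ),
        Commute (PowerSeries.coeff r (Sbar n q Λ)) (PowerSeries.coeff s (Sbar n q Γ))) ∧
    -- and so do the coefficients of all series `S̄_Λ(z)·1` in the algebra of invariants
    (∀ μ ν : YoungDiagram, μ.colLen 0 ≤ n → ν.colLen 0 ≤ n →
      ∀ (Λ : StdTableau μ) (Γ : StdTableau ν) (r s : ℕ) (v w : invariants n q),
        (v : Vac n q) = PowerSeries.coeff r (Sbar n q Λ) • vac n q →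
        (w : Vac n q) = PowerSeries.coeff s (Sbar n q Γ) • vac n q → Commute v w) := by
  refine ⟨fun μ _ Λ Γ r => by rw [Sbar_eq_Sbar hq0 hq Λ Γ],
    fun μ _ Λ r => coeff_Sbar_smul_vac_mem hn hq0 hq Λ r,
    fun μ ν _ _ Λ Γ r s => Sbar_coeff_commute hq0 hq Λ Γ r s,
    fun μ ν _ _ Λ Γ r s v w hv hw =>
      invariants_commute hv hw (Sbar_coeff_commute hq0 hq Λ Γ r s)⟩
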